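/- Let $d\ge 2$ and let $(p^{(i)})_{i\ge 0}$ be probability distributions on the unit vectors $\{\pm e_j: 1\le j\le d\}$ of $\mathbb{Z}^d$. For a subgraph $\mathcal Z$ of the nearest-neighbour graph $\mathbb{Z}^d$, a $p$-random walk on $\mathcal Z$ is the Markov chain that starts at $0$ and steps from $x$ to $x+e$ with probability $p(e)/\sum_{e':\{x,x+e'\}\in\mathcal Z}p(e')$ if $\{x,x+e\}$ is an edge of $\mathcal Z$, and with probability $0$ otherwise. Let $\mathcal Z^{(0)}=\mathbb{Z}^d$. For each $i\ge 0$, conditionally on $X^{(0)},\dots,X^{(i-1)}$, let $X^{(i)}$ be a $p^{(i)}$-random walk on $\mathcal Z^{(i)}$, and let $\mathcal Z^{(i+1)}$ be the trace of $X^{(i)}$, i.e. the graph of the vertices visited and the undirected edges crossed by $X^{(i)}$. Let $\mathcal Z^{(\infty)}=\bigcap_{i\ge0}\mathcal Z^{(i)}$. Write $\delta^{(i)}_j=p^{(i)}(e_j)-p^{(i)}(-e_j)$ and $\hat\ell^{(i)}_j=\log\big(p^{(i)}(e_j)/p^{(i)}(-e_j)\big)$, and, with the Euclidean norm, $\ell^{(i)}=\hat\ell^{(i)}/\|\hat\ell^{(i)}\|$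 and $\beta_{(i)}=\exp\|\hat\ell^{(i)}\|$. For neighbours $x,y\in\mathbb{Z}^d$ let $$c^{(i)}(x,y)=\Big(\prod_{j=1}^d p^{(i)}(-e_j)^{|y_j-x_j|}\Big)\beta_{(i)}^{(x\vee y)\cdot \ell^{(i)}},$$ where $x\vee y$ is the coordinatewise maximum. Assume that $\delta^{(0)}_j\ge 0$ for all $j$ and $\delta^{(0)}_1>0$; that $p^{(i)}(e)>0$ for all $i\ge 0$ and all $e\in\{\pm e_j\}$; and that $\delta^{(0)}\cdot\ell^{(i)}>0$ for all $i\ge 1$. (a) If for some $i$ one has $p^{(i')}=p^{(i)}$ for infinitely many $i'$, then $\mathcal Z^{(\infty)}$ is almost surely an infinite simple (self-avoiding) path with initial vertex $0$. (b) If for some $e\in\{\pm e_j\}$ with $e\neq e_1$, and for every $c\in(0,\infty)$, $$\sum_{i=1}^\infty \frac{c^{(i)}(0,e_1)}{c^{(i)}(0,e)}\min\Big\{1,\big(\beta_{(i)}^{c\,\delta^{(0)}\cdot\ell^{(i)}}-1\big)\beta_{(i)}^{c}\Big\}<\infty ,$$ then with positive probability $\mathcal Z^{(\infty)}$ is not an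 infinite simple path (from any initial vertex). -/

import Mathlib

open MeasureTheory

namespace IteratedTrace

/-- The lattice `ℤ^d`. -/
abbrev Site (d : ℕ) : Type := Fin d → ℤ

/-- The `2 d` directions `± e_j`: the pair `(j, s)` stands for `s e_j`. -/
abbrev Dir (d : ℕ) : Type := Fin d × ℤˣ

/-- The unit vector `± e_j` that belongs to a direction. -/
def unitVec {d : ℕ} (e : Dir d) : Site d := Pi.single e.1 (e.2 : ℤ)

/-- The direction `e_1` (the first coordinate has index `0`). -/
def dirOne (d : ℕ) [NeZero d] : Dir d := (0, 1)

theorem unitVec_neg {d : ℕ} (j : Fin d) (s : ℤˣ) :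
    unitVec (j, -s) = -unitVec (j, s) := by
  simp [unitVec, Pi.single_neg]

theorem unitVec_ne_zero {d : ℕ} (e : Dir d) : unitVec e ≠ 0 := by
  simp [unitVec]

/-- The nearest-neighbour graph on `ℤ^d`. -/
def latticeGraph (d : ℕ) : SimpleGraph (Site d) where
  Adj x y := ∃ e : Dir d, y = x + unitVec e
  symm := ⟨by
    rintro x y ⟨⟨j, s⟩, rfl⟩
    exact ⟨(j, -s), by simp [unitVec_neg]⟩⟩
  loopless := ⟨by
    rintro x ⟨e, h⟩
    exact unitVec_ne_zero e (by simpa using h.symm)⟩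

/-- The trace of a sequence of sites: the vertices are the sites that it visits, the (undirected)
edges are the lattice edges that it crosses. -/
def trace {d : ℕ} (w : ℕ → Site d) : (latticeGraph d).Subgraph where
  verts := Set.range w
  Adj x y := (latticeGraph d).Adj x y ∧ ∃ n, s(w n, w (n + 1)) = s(x, y)
  adj_sub h := h.1
  edge_vert := by
    rintro x y ⟨-, n, h⟩
    rcases Sym2.eq_iff.1 h with ⟨h, -⟩ | ⟨-, h⟩
    · exact ⟨n, h⟩
    · exact ⟨n + 1, h⟩
  symm := ⟨fun x y h => ⟨h.1.symm, h.2.imp fun n hn => hn.trans Sym2.eq_swap⟩⟩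

/-- `Z` is an infinite simple (self-avoiding) path with initial vertex `x`. -/
def IsSimplePathFrom {d : ℕ} (Z : (latticeGraph d).Subgraph) (x : Site d) : Prop :=
  ∃ w : ℕ → Site d, w 0 = x ∧ (∀ n, (latticeGraph d).Adj (w n) (w (n + 1))) ∧
    Function.Injective w ∧ Z = trace w

/-- `Z` is an infinite simple (self-avoiding) path. -/
def IsSimplePath {d : ℕ} (Z : (latticeGraph d).Subgraph) : Prop :=
  ∃ x, IsSimplePathFrom Z x

section StepLaws

variable {d : ℕ}

/-- The drift `δ` of a step distribution `q`. -/
noncomputable def drift (q : Dir d → ℝ) : EuclideanSpace ℝ (Fin d) :=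
  WithLp.toLp 2 fun j => q (j, 1) - q (j, -1)

/-- The vector with coordinates `log (q(e_j) / q(-e_j))`. -/
noncomputable def logBias (q : Dir d → ℝ) : EuclideanSpace ℝ (Fin d) :=
  WithLp.toLp 2 fun j => Real.log (q (j, 1) / q (j, -1))

/-- The normalised vector `ℓ`. -/
noncomputable def ell (q : Dir d → ℝ) : EuclideanSpace ℝ (Fin d) :=
  ‖logBias q‖⁻¹ • logBias q

/-- The growth rate `β` of the conductances. -/
noncomputable def beta (q : Dir d → ℝ) : ℝ := Real.exp ‖logBias q‖

/-- The conductance `(∏_j q(-e_j)^{|y_j - x_j|}) β^{(x ∨ y) ⬝ ℓ}` of the edge between the lattice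
neighbours `x` and `y`. -/
noncomputable def conductance (q : Dir d → ℝ) (x y : Site d) : ℝ :=
  (∏ j, q (j, -1) ^ (y j - x j).natAbs) *
    beta q ^ (inner ℝ (WithLp.toLp 2 fun j => (((x ⊔ y) j : ℤ) : ℝ)) (ell q))

open Classical in
/-- The probability that a `q`-random walk on `Z`, currently at `x`, makes the step `e`. -/
noncomputable def stepProb (q : Dir d → ℝ) (Z : (latticeGraph d).Subgraph) (x : Site d)
    (e : Dir d) : ℝ :=
  if Z.Adj x (x + unitVec e) then
    q e / ∑ e' : Dir d, if Z.Adj x (x + unitVec e') then q e' else 0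
  else 0

/-- The standing assumption on the step distributions `p 0, p 1, p 2, …`. -/
structure Admissible [NeZero d] (p : ℕ → Dir d → ℝ) : Prop where
  drift_nonneg : ∀ j, 0 ≤ drift (p 0) j
  drift_pos : 0 < drift (p 0) 0
  pos : ∀ i e, 0 < p i e
  transient : ∀ i, 1 ≤ i → 0 < inner ℝ (drift (p 0)) (ell (p i))

end StepLaws

section Walks

variable {d : ℕ} {Ω : Type*}

/-- The graph `Z^(i)` on which the `i`-th walk moves: `ℤ^d` for `i = 0`, and the trace of the
preceding walk otherwise. Here `X i n ω` is the position of the `i`-th walk at time `n`. -/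
def graph (X : ℕ → ℕ → Ω → Site d) : ℕ → Ω → (latticeGraph d).Subgraph
  | 0, _ => ⊤
  | i + 1, ω => trace fun n => X i n ω

/-- The limiting graph, the intersection of all `Z^(i)`. -/
def limitGraph (X : ℕ → ℕ → Ω → Site d) (ω : Ω) : (latticeGraph d).Subgraph :=
  ⨅ i, graph X i ω

/-- The σ-algebra generated by the complete walks with index less than `i` and by the `i`-th walk
up to time `n`. -/
@[reducible] def history (X : ℕ → ℕ → Ω → Site d) (i n : ℕ) : MeasurableSpace Ω :=
  (⨆ j < i, ⨆ m, MeasurableSpace.comap (X j m) inferInstance) ⊔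
    ⨆ m ≤ n, MeasurableSpace.comap (X i m) inferInstance

/-- `X 0, X 1, X 2, …` is a sequence of walks from the origin such that, conditionally on
the earlier walks, `X i` is a `p i`-random walk on `Z^(i)`. (So `X i` depends on the earlier
walks only through `Z^(i)`.) -/
structure IsWalkSequence [MeasurableSpace Ω] (μ : Measure Ω) (p : ℕ → Dir d → ℝ)
    (X : ℕ → ℕ → Ω → Site d) : Prop where
  measurable : ∀ i n, Measurable (X i n)
  start : ∀ i, ∀ᵐ ω ∂μ, X i 0 ω = 0
  step : ∀ i n (e : Dir d),
    μ[Set.indicator {ω | X i (n + 1) ω = X i n ω + unitVec e} (fun _ => (1 : ℝ)) | history X i n]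
      =ᵐ[μ] fun ω => stepProb (p i) (graph X i ω) (X i n ω) e

end Walks

end IteratedTrace

namespace IteratedTrace

/-! ### Finite electrical networks: summation by parts, Dirichlet principle, resistance of a path.
-/

section Network

variable {V : Type*}

/-! A walk with step law q on a subgraph is the reversible walk of an electrical network: with L the
vector `logBias q`, the edge from x to x + e has conductance exp(L·x) q(e)
(`conductance_add_unitVec`). Hitting probabilities are therefore harmonic, the Dirichlet principle
controls their energy, and both halves become resistance estimates on the trace of X^(0), which
contains all later graphs and along which L·x grows linearly because δ^(0)·L > 0.

(a) The graphs Z^(i) decrease and are connected and infinite, so by compactness they share an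
infinite simple path γ from 0 (`exists_injective_path`). Let q be a law that recurs infinitely
often. Almost surely Σ exp(-L·X^(0)_n) is finite, so far tails of γ have small q-resistance, and a
q-walk started far out on γ hits a given finite set with probability at most 1/2
(`hitProb_univ_sq_le`). Hence, given the past, each q-walk misses a given edge off γ with
probability at least ε^n/2, with n independent of the walk: it follows γ for n steps and then never
meets the ends of the edge (`ae_le_condExp_not_cross`). By Lévy's Borel–Cantelli lemma some walk
does miss it, so only γ survives.

(b) With positive probability X^(0) steps to a neighbour v of 0, crosses an edge {v, w} back and
forth, and then escapes from v by a step e_1 into the half-space x_1 > v_1. If all later walks visit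
w, then v keeps the three neighbours 0, w and v + e_1 in the limit. A later walk with law q avoids w
with probability at most q(e_1)/q(e) times the normalised conductance J of the series of cut edges,
which separate the past of X^(0) from its future (`IsBranching.ofReal_le_mul_cutCond`).

The heart is the bound E J ≤ δ^(0)·L / δ^(0)_1 (`lintegral_cutCond_le`). Sum J, as seen from
X^(0)_n, over the record times n ≤ M of the first coordinate. At a cut time n it is at most c_n / Σ
c_k, where c_k = exp(-L·X^(0)_k) and k runs over the cut times in [n, M]; such quotients add up to
the logarithm of a ratio, which is about L·X^(0)_M. A record depends on the past and J on the
future, so they are independent, and the expected number of records is at least M δ^(0)_1. Dividing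
by M gives the bound. Since x ≤ e^x - 1, the assumed series with c = 1/δ^(0)_1 dominates the
avoidance probabilities. With positive probability a tail of their sum is at most 1/2; the finitely
many walks before it visit w by an explicit two-step path, and a union bound handles the others
(`measure_iInter_ne_zero`). -/

theorem sum_conductance_mul_sub_mul_sub (S : Finset V) (c : V → V → ℝ)
    (hc : ∀ x y, c x y = c y x) (f u : V → ℝ) :
    ∑ x ∈ S, ∑ y ∈ S, c x y * ((f x - f y) * (u x - u y)) =
      2 * ∑ x ∈ S, u x * ∑ y ∈ S, c x y * (f x - f y) := by
  have h1 : ∑ x ∈ S, ∑ y ∈ S, c x y * (f x - f y) * u y =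
      -∑ x ∈ S, ∑ y ∈ S, c x y * (f x - f y) * u x := by
    rw [Finset.sum_comm, ← Finset.sum_neg_distrib]
    refine Finset.sum_congr rfl fun x _ => ?_
    rw [← Finset.sum_neg_distrib]
    refine Finset.sum_congr rfl fun y _ => ?_
    rw [hc y x]; ring
  have h2 : ∑ x ∈ S, u x * ∑ y ∈ S, c x y * (f x - f y) =
      ∑ x ∈ S, ∑ y ∈ S, c x y * (f x - f y) * u x := by
    refine Finset.sum_congr rfl fun x _ => ?_
    rw [Finset.mul_sum]
    exact Finset.sum_congr rfl fun y _ => by ring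
  have h3 : ∑ x ∈ S, ∑ y ∈ S, c x y * ((f x - f y) * (u x - u y)) =
      ∑ x ∈ S, ∑ y ∈ S, c x y * (f x - f y) * u x -
        ∑ x ∈ S, ∑ y ∈ S, c x y * (f x - f y) * u y := by
    simp only [← Finset.sum_sub_distrib]
    exact Finset.sum_congr rfl fun x _ => Finset.sum_congr rfl fun y _ => by ring
  rw [h3, h1, h2]; ring

/-- Twice the Dirichlet energy of `f` on the finite network `S` with conductances `c`. -/
def energy (S : Finset V) (c : V → V → ℝ) (f : V → ℝ) : ℝ :=
  ∑ x ∈ S, ∑ y ∈ S, c x y * (f x - f y) ^ 2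

theorem energy_eq (S : Finset V) (c : V → V → ℝ) (hc : ∀ x y, c x y = c y x) (f : V → ℝ) :
    energy S c f = 2 * ∑ x ∈ S, f x * ∑ y ∈ S, c x y * (f x - f y) := by
  rw [← sum_conductance_mul_sub_mul_sub S c hc]
  simp only [energy, sq]

/-- The Dirichlet principle. -/
theorem energy_le_of_harmonic (S : Finset V) (c : V → V → ℝ) (hc : ∀ x y, c x y = c y x)
    (hc0 : ∀ x y, 0 ≤ c x y) (h g : V → ℝ)
    (hg : ∀ x ∈ S, ∑ y ∈ S, c x y * (h x - h y) = 0 ∨ g x = h x) :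
    energy S c h ≤ energy S c g := by
  have h1 := sum_conductance_mul_sub_mul_sub S c hc h fun x => g x - h x
  have h2 : ∑ x ∈ S, (g x - h x) * ∑ y ∈ S, c x y * (h x - h y) = 0 := by
    refine Finset.sum_eq_zero fun x hx => ?_
    rcases hg x hx with h | h <;> simp [h]
  -- Expand g = h + (g - h). Summation by parts kills the cross term, since at each site either h is
  -- harmonic or g - h vanishes.
  have h3 : energy S c g = energy S c h +
      2 * ∑ x ∈ S, ∑ y ∈ S, c x y * ((h x - h y) * (g x - h x - (g y - h y))) +
        energy S c fun x => g x - h x := by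
    simp only [energy, Finset.mul_sum, ← Finset.sum_add_distrib]
    exact Finset.sum_congr rfl fun x _ => Finset.sum_congr rfl fun y _ => by ring
  have h4 : 0 ≤ energy S c fun x => g x - h x :=
    Finset.sum_nonneg fun x _ => Finset.sum_nonneg fun y _ => mul_nonneg (hc0 x y) (sq_nonneg _)
  rw [h3, h1, h2]; linarith

/-- Cauchy–Schwarz applied to the telescoping sum of h along the path. Injectivity makes the crossed
edges distinct ordered pairs, so their energies add up to at most `energy`. -/
theorem sq_sub_le_resistance_mul_energy (S : Finset V) (c : V → V → ℝ)
    (hc0 : ∀ x y, 0 ≤ c x y) (h : V → ℝ) (w : ℕ → V) (hw : Function.Injective w) (N : ℕ)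
    (hS : ∀ k ≤ N, w k ∈ S) (hpos : ∀ k < N, 0 < c (w k) (w (k + 1))) :
    (h (w 0) - h (w N)) ^ 2 ≤
      (∑ k ∈ Finset.range N, (c (w k) (w (k + 1)))⁻¹) * energy S c h := by
  classical
  have h1 : h (w 0) - h (w N) = ∑ k ∈ Finset.range N, (h (w k) - h (w (k + 1))) :=
    (Finset.sum_range_sub' (fun k => h (w k)) N).symm
  have h2 : ∑ k ∈ Finset.range N, c (w k) (w (k + 1)) * (h (w k) - h (w (k + 1))) ^ 2 ≤
      energy S c h := by
    rw [energy, ← Finset.sum_product' S S fun x y => c x y * (h x - h y) ^ 2]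
    rw [← Finset.sum_image (f := fun p : V × V => c p.1 p.2 * (h p.1 - h p.2) ^ 2)
      (g := fun k => (w k, w (k + 1))) (s := Finset.range N)]
    · refine Finset.sum_le_sum_of_subset_of_nonneg ?_
        fun p _ _ => mul_nonneg (hc0 _ _) (sq_nonneg _)
      intro p hp
      obtain ⟨k, hk, rfl⟩ := Finset.mem_image.1 hp
      rw [Finset.mem_range] at hk
      exact Finset.mem_product.2 ⟨hS k hk.le, hS (k + 1) hk⟩
    · intro a _ b _ hab
      exact hw (Prod.ext_iff.1 hab).1
  rw [h1]
  refine (Finset.sum_sq_le_sum_mul_sum_of_sq_le_mul _ (f := fun k => (c (w k) (w (k + 1)))⁻¹)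
    (g := fun k => c (w k) (w (k + 1)) * (h (w k) - h (w (k + 1))) ^ 2) ?_ ?_ ?_).trans ?_
  · exact fun k _ => inv_nonneg.2 (hc0 _ _)
  · exact fun k _ => mul_nonneg (hc0 _ _) (sq_nonneg _)
  · intro k hk
    have := hpos k (Finset.mem_range.1 hk)
    refine le_of_eq ?_
    field_simp
  · exact mul_le_mul_of_nonneg_left h2 (Finset.sum_nonneg fun k _ => inv_nonneg.2 (hc0 _ _))

end Network

/-! ### Conductances as exponentials of a linear function. -/

section Conductance

variable {d : ℕ}

/-- The scalar product of a lattice site with the vector `logBias q`. -/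
noncomputable def height (q : Dir d → ℝ) (x : Site d) : ℝ := ∑ j, (x j : ℝ) * logBias q j

theorem height_add (q : Dir d → ℝ) (x y : Site d) :
    height q (x + y) = height q x + height q y := by
  simp [height, add_mul, Finset.sum_add_distrib]

theorem height_zero (q : Dir d → ℝ) : height q 0 = 0 := by simp [height]

theorem height_unitVec (q : Dir d → ℝ) (e : Dir d) :
    height q (unitVec e) = (e.2 : ℤ) * logBias q e.1 := by
  rw [height, Finset.sum_eq_single e.1]
  · simp [unitVec]
  · intro j _ hj; simp [unitVec, hj]
  · simp

/-- Undoes the normalisation of `ell`, so that powers of `beta q` become exponentials of `height q`;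
a vanishing `logBias q` is harmless. -/
theorem norm_logBias_mul_inner (q : Dir d → ℝ) (v : EuclideanSpace ℝ (Fin d)) :
    ‖logBias q‖ * inner ℝ v (ell q) = ∑ j, v j * logBias q j := by
  rw [ell, inner_smul_right, ← mul_assoc]
  rcases eq_or_ne (logBias q) 0 with h | h
  · simp [h]
  · rw [mul_inv_cancel₀ (norm_ne_zero_iff.2 h), one_mul, PiLp.inner_apply]
    simp [mul_comm]

theorem beta_rpow_inner (q : Dir d → ℝ) (v : EuclideanSpace ℝ (Fin d)) (c : ℝ) :
    beta q ^ (c * inner ℝ v (ell q)) = Real.exp (c * ∑ j, v j * logBias q j) := by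
  rw [beta, ← Real.exp_mul, ← norm_logBias_mul_inner]; ring_nf

theorem conductance_comm (q : Dir d → ℝ) (x y : Site d) :
    conductance q x y = conductance q y x := by
  rw [conductance, conductance, sup_comm]
  congr 1
  refine Finset.prod_congr rfl fun j _ => ?_
  rw [← Int.natAbs_neg, neg_sub]

/-- Reversibility of the walk with respect to exp(height). For a positive step the maximum x ∨ y is
x + e_j, and the extra factor q(e_j)/q(-e_j) turns q(-e_j) into q(e_j); for a negative step it is x.
-/
theorem conductance_add_unitVec (q : Dir d → ℝ) (hq : ∀ e, 0 < q e) (x : Site d) (e : Dir d) :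
    conductance q x (x + unitVec e) = Real.exp (height q x) * q e := by
  obtain ⟨j, s⟩ := e
  have h1 : ∏ k, q (k, -1) ^ ((x + unitVec (j, s)) k - x k).natAbs = q (j, -1) := by
    rw [Finset.prod_eq_single j]
    · rcases Int.units_eq_one_or s with rfl | rfl <;> simp [unitVec]
    · intro k _ hk; simp [unitVec, hk]
    · simp
  have h2 : beta q ^ (inner ℝ (WithLp.toLp 2 fun k => (((x ⊔ (x + unitVec (j, s))) k : ℤ) : ℝ))
      (ell q)) = Real.exp (height q (x ⊔ (x + unitVec (j, s)))) := by
    have := beta_rpow_inner q (WithLp.toLp 2 fun k => (((x ⊔ (x + unitVec (j, s))) k : ℤ) : ℝ)) 1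
    rw [one_mul, one_mul] at this
    exact this
  rw [conductance, h1, h2]
  rcases Int.units_eq_one_or s with rfl | rfl
  · have : x ⊔ (x + unitVec (j, 1)) = x + unitVec (j, 1) := by
      refine sup_eq_right.2 fun k => ?_
      by_cases hk : k = j
      · subst hk; simp [unitVec]
      · simp [unitVec, hk]
    rw [this, height_add, height_unitVec, Real.exp_add]
    simp only [logBias, Units.val_one, Int.cast_one, one_mul]
    rw [Real.exp_log (div_pos (hq _) (hq _))]
    have := (hq (j, -1)).ne'
    field_simp
  · have : x ⊔ (x + unitVec (j, -1)) = x := by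
      refine sup_eq_left.2 fun k => ?_
      by_cases hk : k = j
      · subst hk; simp [unitVec]
      · simp [unitVec, hk]
    rw [this, mul_comm]

end Conductance

/-! ### Hitting probabilities as harmonic functions of the network. -/

section Hitting

variable {d : ℕ}

theorem unitVec_injective : Function.Injective (unitVec : Dir d → Site d) := by
  rintro ⟨j, s⟩ ⟨k, t⟩ h
  have h1 := congr_fun h j
  by_cases hjk : j = k
  · subst hjk
    simp only [unitVec, Pi.single_eq_same, Units.val_inj] at h1
    rw [h1]
  · simp [unitVec, hjk] at h1

theorem stepProb_nonneg {q : Dir d → ℝ} (hq : ∀ e, 0 < q e) (Z : (latticeGraph d).Subgraph)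
    (x : Site d) (e : Dir d) : 0 ≤ stepProb q Z x e := by
  unfold stepProb
  split_ifs
  · exact div_nonneg (hq e).le (Finset.sum_nonneg fun e' _ => by split_ifs; exacts [(hq e').le, le_rfl])
  · exact le_rfl

theorem le_stepProb {q : Dir d → ℝ} (hq : ∀ e, 0 < q e) (hq1 : ∑ e, q e = 1)
    {Z : (latticeGraph d).Subgraph} {x : Site d} {e : Dir d} (h : Z.Adj x (x + unitVec e)) :
    q e ≤ stepProb q Z x e := by
  classical
  rw [stepProb, if_pos h]
  refine le_div_self (hq e).le ?_ ?_
  · refine (hq e).trans_le ?_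
    refine le_of_eq_of_le (if_pos h).symm (Finset.single_le_sum
      (f := fun e' => if Z.Adj x (x + unitVec e') then q e' else 0) (fun e' _ => ?_)
      (Finset.mem_univ e))
    split_ifs; exacts [(hq e').le, le_rfl]
  · rw [← hq1]
    refine Finset.sum_le_sum fun e' _ => ?_
    split_ifs; exacts [le_rfl, (hq e').le]

theorem sum_stepProb_eq_one {q : Dir d → ℝ} (hq : ∀ e, 0 < q e)
    {Z : (latticeGraph d).Subgraph} {x y : Site d} (h : Z.Adj x y) :
    ∑ e, stepProb q Z x e = 1 := by
  classical
  obtain ⟨e, rfl⟩ := Z.adj_sub h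
  have h1 : ∀ e, stepProb q Z x e = (if Z.Adj x (x + unitVec e) then q e else 0) /
      ∑ e' : Dir d, if Z.Adj x (x + unitVec e') then q e' else 0 := by
    intro e
    rw [stepProb]; split_ifs <;> simp
  simp only [h1]
  rw [← Finset.sum_div]
  refine div_self (ne_of_gt ((hq e).trans_le ?_))
  refine le_of_eq_of_le (if_pos h).symm (Finset.single_le_sum
      (f := fun e' => if Z.Adj x (x + unitVec e') then q e' else 0) (fun e' _ => ?_)
      (Finset.mem_univ e))
  split_ifs; exacts [(hq e').le, le_rfl]

theorem stepProb_eq_zero {q : Dir d → ℝ} {Z : (latticeGraph d).Subgraph} {x : Site d} {e : Dir d}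
    (h : ¬ Z.Adj x (x + unitVec e)) : stepProb q Z x e = 0 := by
  rw [stepProb, if_neg h]

theorem sum_stepProb_le_one {q : Dir d → ℝ} (hq : ∀ e, 0 < q e)
    (Z : (latticeGraph d).Subgraph) (x : Site d) : ∑ e, stepProb q Z x e ≤ 1 := by
  by_cases h : ∃ y, Z.Adj x y
  · exact (sum_stepProb_eq_one hq h.choose_spec).le
  · rw [Finset.sum_eq_zero]
    · exact zero_le_one
    · exact fun e _ => stepProb_eq_zero fun he => h ⟨_, he⟩

open Classical in
/-- The conductances of the edges of `Z`, extended by zero. -/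
noncomputable def netCond (q : Dir d → ℝ) (Z : (latticeGraph d).Subgraph) (x y : Site d) : ℝ :=
  if Z.Adj x y then conductance q x y else 0

theorem netCond_comm (q : Dir d → ℝ) (Z : (latticeGraph d).Subgraph) (x y : Site d) :
    netCond q Z x y = netCond q Z y x := by
  by_cases h : Z.Adj x y
  · rw [netCond, netCond, if_pos h, if_pos h.symm, conductance_comm]
  · rw [netCond, netCond, if_neg h, if_neg fun h' => h h'.symm]

theorem conductance_pos {q : Dir d → ℝ} (hq : ∀ e, 0 < q e) (x y : Site d) :
    0 < conductance q x y :=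
  mul_pos (Finset.prod_pos fun _ _ => pow_pos (hq _) _) (Real.rpow_pos_of_pos (Real.exp_pos _) _)

theorem netCond_nonneg {q : Dir d → ℝ} (hq : ∀ e, 0 < q e) (Z : (latticeGraph d).Subgraph)
    (x y : Site d) : 0 ≤ netCond q Z x y := by
  rw [netCond]; split_ifs; exacts [(conductance_pos hq x y).le, le_rfl]

open Classical in
theorem sum_netCond_mul {q : Dir d → ℝ} (hq : ∀ e, 0 < q e) (Z : (latticeGraph d).Subgraph)
    (S : Finset (Site d)) (x : Site d) (hS : ∀ e, x + unitVec e ∈ S) (F : Site d → ℝ) :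
    ∑ y ∈ S, netCond q Z x y * F y =
      Real.exp (height q x) *
        ∑ e, (if Z.Adj x (x + unitVec e) then q e else 0) * F (x + unitVec e) := by
  have h1 : ∑ y ∈ Finset.univ.image (fun e => x + unitVec e), netCond q Z x y * F y =
      ∑ y ∈ S, netCond q Z x y * F y := by
    refine Finset.sum_subset (fun y hy => ?_) fun y _ hy => ?_
    · obtain ⟨e, -, rfl⟩ := Finset.mem_image.1 hy
      exact hS e
    · rw [netCond, if_neg, zero_mul]
      intro h
      obtain ⟨e, rfl⟩ := Z.adj_sub h
      exact hy (Finset.mem_image_of_mem _ (Finset.mem_univ e))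
  rw [← h1, Finset.sum_image fun a _ b _ h => unitVec_injective (add_left_cancel h),
    Finset.mul_sum]
  refine Finset.sum_congr rfl fun e _ => ?_
  rw [netCond]
  split_ifs
  · rw [conductance_add_unitVec q hq]; ring
  · ring

/-- Kirchhoff's node law: up to the factor exp(height) and the normalisation, the weights `netCond`
at x are the step probabilities. At an isolated site all weights vanish. -/
theorem sum_netCond_mul_sub_eq_zero {q : Dir d → ℝ} (hq : ∀ e, 0 < q e)
    (Z : (latticeGraph d).Subgraph) (S : Finset (Site d)) (x : Site d)
    (hS : ∀ e, x + unitVec e ∈ S) (h : Site d → ℝ)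
    (hx : h x = ∑ e, stepProb q Z x e * h (x + unitVec e)) :
    ∑ y ∈ S, netCond q Z x y * (h x - h y) = 0 := by
  classical
  by_cases hadj : ∃ y, Z.Adj x y
  · have h2 : ∑ e, stepProb q Z x e * (h x - h (x + unitVec e)) = 0 := by
      simp only [mul_sub, Finset.sum_sub_distrib, ← Finset.sum_mul]
      rw [sum_stepProb_eq_one hq hadj.choose_spec, one_mul, ← hx, sub_self]
    have h1 : ∀ e, stepProb q Z x e = (if Z.Adj x (x + unitVec e) then q e else 0) /
        ∑ e' : Dir d, if Z.Adj x (x + unitVec e') then q e' else 0 := by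
      intro e
      rw [stepProb]; split_ifs <;> simp
    have h3 : (∑ e' : Dir d, if Z.Adj x (x + unitVec e') then q e' else 0) ≠ 0 := by
      intro h0
      have := sum_stepProb_eq_one hq hadj.choose_spec
      simp [h1, h0] at this
    rw [sum_netCond_mul hq Z S x hS fun y => h x - h y]
    simp only [h1, div_mul_eq_mul_div, ← Finset.sum_div] at h2
    rw [div_eq_zero_iff, or_iff_left h3] at h2
    rw [h2, mul_zero]
  · refine Finset.sum_eq_zero fun y _ => ?_
    rw [netCond, if_neg fun h => hadj ⟨y, h⟩, zero_mul]

open Classical in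
/-- The probability that the `q`-walk on `Z` from `x` hits `B` within `t` steps, before it has made
a step from a site outside of `Λ`. -/
noncomputable def hitProb (q : Dir d → ℝ) (Z : (latticeGraph d).Subgraph) (B Λ : Set (Site d)) :
    ℕ → Site d → ℝ
  | 0, x => if x ∈ B then 1 else 0
  | t + 1, x => if x ∈ B then 1 else
      if x ∈ Λ then ∑ e, stepProb q Z x e * hitProb q Z B Λ t (x + unitVec e) else 0

variable {q : Dir d → ℝ}

theorem hitProb_mem_Icc (hq : ∀ e, 0 < q e) (Z : (latticeGraph d).Subgraph) (B Λ : Set (Site d))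
    (t : ℕ) (x : Site d) : hitProb q Z B Λ t x ∈ Set.Icc (0 : ℝ) 1 := by
  induction t generalizing x with
  | zero => rw [hitProb]; split_ifs <;> simp
  | succ t ih =>
    rw [hitProb]
    split_ifs
    · simp
    · refine ⟨Finset.sum_nonneg fun e _ => mul_nonneg (stepProb_nonneg hq Z x e) (ih _).1, ?_⟩
      refine le_trans (Finset.sum_le_sum fun e _ => ?_) (sum_stepProb_le_one hq Z x)
      exact mul_le_of_le_one_right (stepProb_nonneg hq Z x e) (ih _).2
    · simp

theorem hitProb_mono_set (hq : ∀ e, 0 < q e) (Z : (latticeGraph d).Subgraph) (B : Set (Site d))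
    {Λ Λ' : Set (Site d)} (h : Λ ⊆ Λ') (t : ℕ) (x : Site d) :
    hitProb q Z B Λ t x ≤ hitProb q Z B Λ' t x := by
  induction t generalizing x with
  | zero => simp [hitProb]
  | succ t ih =>
    by_cases hB : x ∈ B
    · simp [hitProb, hB]
    by_cases hx : x ∈ Λ
    · simp only [hitProb, hB, hx, h hx, if_true, if_false]
      exact Finset.sum_le_sum fun e _ => mul_le_mul_of_nonneg_left (ih _) (stepProb_nonneg hq Z x e)
    · refine le_of_eq_of_le ?_ (hitProb_mem_Icc hq Z B Λ' (t + 1) x).1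
      simp [hitProb, hB, hx]

theorem hitProb_monotone (hq : ∀ e, 0 < q e) (Z : (latticeGraph d).Subgraph) (B Λ : Set (Site d))
    (x : Site d) : Monotone fun t => hitProb q Z B Λ t x := by
  refine monotone_nat_of_le_succ fun t => ?_
  induction t generalizing x with
  | zero =>
    by_cases hB : x ∈ B
    · simp [hitProb, hB]
    · refine le_of_eq_of_le ?_ (hitProb_mem_Icc hq Z B Λ (0 + 1) x).1
      simp [hitProb, hB]
  | succ t ih =>
    rw [hitProb, hitProb]
    split_ifs
    · exact le_rfl
    · exact Finset.sum_le_sum fun e _ => mul_le_mul_of_nonneg_left (ih _) (stepProb_nonneg hq Z x e)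
    · exact le_rfl

/-- Only finitely many sites can be reached in t steps. This reduces hitting probabilities on
infinite graphs to finite networks. -/
theorem exists_finset_hitProb_univ_le (hq : ∀ e, 0 < q e) (Z : (latticeGraph d).Subgraph)
    (B : Set (Site d)) (t : ℕ) (x : Site d) :
    ∃ Λ : Finset (Site d), hitProb q Z B Set.univ t x ≤ hitProb q Z B Λ t x := by
  classical
  induction t generalizing x with
  | zero => exact ⟨∅, by simp [hitProb]⟩
  | succ t ih =>
    choose f hf using ih
    refine ⟨insert x (Finset.univ.biUnion fun e => f (x + unitVec e)), ?_⟩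
    by_cases hB : x ∈ B
    · simp [hitProb, hB]
    rw [hitProb, hitProb, if_neg hB, if_neg hB, if_pos (Set.mem_univ x),
      if_pos (Finset.mem_coe.2 (Finset.mem_insert_self _ _))]
    refine Finset.sum_le_sum fun e _ => mul_le_mul_of_nonneg_left ?_ (stepProb_nonneg hq Z x e)
    refine (hf _).trans (hitProb_mono_set hq Z B ?_ t _)
    intro y hy
    exact Finset.mem_coe.2 (Finset.mem_insert_of_mem
      (Finset.mem_biUnion.2 ⟨e, Finset.mem_univ e, hy⟩))

/-- The probability that the `q`-walk on `Z` from `x` hits `B` before it has made a step from a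
site outside of `Λ`. -/
noncomputable def hitLim (q : Dir d → ℝ) (Z : (latticeGraph d).Subgraph) (B Λ : Set (Site d))
    (x : Site d) : ℝ := ⨆ t, hitProb q Z B Λ t x

theorem bddAbove_hitProb (hq : ∀ e, 0 < q e) (Z : (latticeGraph d).Subgraph)
    (B Λ : Set (Site d)) (x : Site d) : BddAbove (Set.range fun t => hitProb q Z B Λ t x) :=
  ⟨1, by rintro _ ⟨t, rfl⟩; exact (hitProb_mem_Icc hq Z B Λ t x).2⟩

theorem tendsto_hitProb (hq : ∀ e, 0 < q e) (Z : (latticeGraph d).Subgraph)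
    (B Λ : Set (Site d)) (x : Site d) :
    Filter.Tendsto (fun t => hitProb q Z B Λ t x) Filter.atTop (nhds (hitLim q Z B Λ x)) :=
  tendsto_atTop_ciSup (hitProb_monotone hq Z B Λ x) (bddAbove_hitProb hq Z B Λ x)

theorem hitProb_le_hitLim (hq : ∀ e, 0 < q e) (Z : (latticeGraph d).Subgraph)
    (B Λ : Set (Site d)) (t : ℕ) (x : Site d) : hitProb q Z B Λ t x ≤ hitLim q Z B Λ x :=
  le_ciSup (bddAbove_hitProb hq Z B Λ x) t

theorem hitLim_of_mem (Z : (latticeGraph d).Subgraph) {B : Set (Site d)} (Λ : Set (Site d))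
    {x : Site d} (hx : x ∈ B) : hitLim q Z B Λ x = 1 := by
  have : ∀ t, hitProb q Z B Λ t x = 1 := by rintro (_ | t) <;> simp [hitProb, hx]
  simp [hitLim, this]

theorem hitLim_of_notMem (Z : (latticeGraph d).Subgraph) {B Λ : Set (Site d)}
    {x : Site d} (hx : x ∉ B) (hx' : x ∉ Λ) : hitLim q Z B Λ x = 0 := by
  have : ∀ t, hitProb q Z B Λ t x = 0 := by rintro (_ | t) <;> simp [hitProb, hx, hx']
  simp [hitLim, this]

theorem hitLim_harmonic (hq : ∀ e, 0 < q e) (Z : (latticeGraph d).Subgraph) {B Λ : Set (Site d)}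
    {x : Site d} (hx : x ∉ B) (hx' : x ∈ Λ) :
    hitLim q Z B Λ x = ∑ e, stepProb q Z x e * hitLim q Z B Λ (x + unitVec e) := by
  refine tendsto_nhds_unique ((Filter.tendsto_add_atTop_iff_nat 1).2 (tendsto_hitProb hq Z B Λ x)) ?_
  simp only [hitProb, hx, hx', if_true, if_false]
  exact tendsto_finsetSum _ fun e _ => (tendsto_hitProb hq Z B Λ _).const_mul _

theorem sum_netCond_mul_sub_hitLim (hq : ∀ e, 0 < q e) (Z : (latticeGraph d).Subgraph)
    {B Λ : Set (Site d)} (S : Finset (Site d)) (hS : ∀ x ∈ Λ, ∀ e, x + unitVec e ∈ S) {x : Site d}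
    (hx : x ∉ B) (hx' : x ∈ Λ) :
    ∑ y ∈ S, netCond q Z x y * (hitLim q Z B Λ x - hitLim q Z B Λ y) = 0 :=
  sum_netCond_mul_sub_eq_zero hq Z S x (hS x hx') _ (hitLim_harmonic hq Z hx hx')

theorem energy_hitLim_le (hq : ∀ e, 0 < q e) (Z : (latticeGraph d).Subgraph)
    {B Λ : Set (Site d)} (S : Finset (Site d)) (hS : ∀ x ∈ Λ, ∀ e, x + unitVec e ∈ S)
    (g : Site d → ℝ) (hg1 : ∀ x ∈ B, g x = 1) (hg0 : ∀ x ∉ B, x ∉ Λ → g x = 0) :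
    energy S (netCond q Z) (hitLim q Z B Λ) ≤ energy S (netCond q Z) g := by
  refine energy_le_of_harmonic S _ (netCond_comm q Z) (netCond_nonneg hq Z) _ _ fun x _ => ?_
  by_cases hx : x ∈ B
  · exact Or.inr (by rw [hg1 x hx, hitLim_of_mem Z Λ hx])
  by_cases hx' : x ∈ Λ
  · exact Or.inl (sum_netCond_mul_sub_hitLim hq Z S hS hx hx')
  · exact Or.inr (by rw [hg0 x hx hx', hitLim_of_notMem Z hx hx'])

theorem sum_netCond_le (hq : ∀ e, 0 < q e) (hq1 : ∑ e, q e = 1) (Z : (latticeGraph d).Subgraph)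
    (S : Finset (Site d)) (x : Site d) (hS : ∀ e, x + unitVec e ∈ S) :
    ∑ y ∈ S, netCond q Z x y ≤ Real.exp (height q x) := by
  classical
  have := sum_netCond_mul hq Z S x hS fun _ => 1
  simp only [mul_one] at this
  rw [this]
  refine mul_le_of_le_one_right (Real.exp_pos _).le ?_
  rw [← hq1]
  refine Finset.sum_le_sum fun e' _ => ?_
  split_ifs; exacts [le_rfl, (hq e').le]

/-- A walk that starts far out on an infinite path of small resistance is unlikely to hit `B`. -/
theorem hitProb_univ_sq_le (hq : ∀ e, 0 < q e) (hq1 : ∑ e, q e = 1)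
    (Z : (latticeGraph d).Subgraph) (B : Finset (Site d)) (w : ℕ → Site d)
    (hw : Function.Injective w) (hwZ : ∀ k, Z.Adj (w k) (w (k + 1))) (η : ℝ)
    (hη : ∀ N, ∑ k ∈ Finset.range N, (conductance q (w k) (w (k + 1)))⁻¹ ≤ η) (t : ℕ) :
    hitProb q Z B Set.univ t (w 0) ^ 2 ≤ η * (2 * ∑ x ∈ B, Real.exp (height q x)) := by
  classical
  obtain ⟨Λ₀, hΛ₀⟩ := exists_finset_hitProb_univ_le hq Z B t (w 0)
  set Λ := Λ₀ ∪ B with hΛ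
  have h1 : hitProb q Z B Set.univ t (w 0) ≤ hitLim q Z B Λ (w 0) :=
    (hΛ₀.trans (hitProb_mono_set hq Z B (by simp [hΛ]) t _)).trans (hitProb_le_hitLim hq Z _ _ t _)
  obtain ⟨N, hN⟩ : ∃ N, w N ∉ Λ := by
    by_contra! h
    exact Set.infinite_of_injective_forall_mem hw h Λ.finite_toSet
  set S := Λ ∪ Λ.biUnion (fun x => Finset.univ.image fun e => x + unitVec e) ∪
    (Finset.range (N + 1)).image w with hS
  have hSΛ : ∀ x ∈ (Λ : Set (Site d)), ∀ e, x + unitVec e ∈ S := by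
    intro x hx e
    refine Finset.mem_union_left _ (Finset.mem_union_right _ (Finset.mem_biUnion.2 ⟨x, hx, ?_⟩))
    exact Finset.mem_image_of_mem _ (Finset.mem_univ e)
  have hBΛ : ∀ x ∈ B, x ∈ Λ := fun x hx => Finset.mem_union_right _ hx
  -- The indicator of B competes in the Dirichlet principle; its energy is at most twice the total
  -- conductance at the sites of B. On the path, the hitting function drops to 0 at w N, which lies
  -- outside Λ.
  set g : Site d → ℝ := fun x => if x ∈ B then 1 else 0 with hg
  have h2 := energy_hitLim_le hq Z (B := B) (Λ := Λ) S hSΛ g (fun x hx => by simpa [hg] using hx)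
    (fun x hx _ => by simpa [hg] using hx)
  have h3 : energy S (netCond q Z) g ≤ 2 * ∑ x ∈ B, Real.exp (height q x) := by
    rw [energy_eq _ _ (netCond_comm q Z)]
    refine mul_le_mul_of_nonneg_left ?_ zero_le_two
    rw [← Finset.sum_subset (s₁ := B)
      (fun x hx => Finset.mem_union_left _ (Finset.mem_union_left _ (hBΛ x hx)))
      (fun x _ hx => by simp [hg, hx])]
    refine Finset.sum_le_sum fun x hx => ?_
    refine le_trans ?_ (sum_netCond_le hq hq1 Z S x (hSΛ x (hBΛ x hx)))
    simp only [hg, hx, if_true, one_mul]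
    refine Finset.sum_le_sum fun y _ => mul_le_of_le_one_right (netCond_nonneg hq Z x y) ?_
    split_ifs <;> simp
  have hcond : ∀ k, netCond q Z (w k) (w (k + 1)) = conductance q (w k) (w (k + 1)) :=
    fun k => if_pos (hwZ k)
  have h4 := sq_sub_le_resistance_mul_energy S (netCond q Z) (netCond_nonneg hq Z)
    (hitLim q Z B Λ) w hw N
    (fun k hk => Finset.mem_union_right _
      (Finset.mem_image_of_mem _ (Finset.mem_range.2 (Nat.lt_succ_of_le hk))))
    (fun k _ => by rw [hcond]; exact conductance_pos hq _ _)
  simp only [hcond] at h4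
  rw [hitLim_of_notMem Z (fun h => hN (hBΛ _ h)) hN, sub_zero] at h4
  have hη0 : 0 ≤ η := by simpa using hη 0
  calc hitProb q Z B Set.univ t (w 0) ^ 2 ≤ hitLim q Z B Λ (w 0) ^ 2 :=
        pow_le_pow_left₀ (hitProb_mem_Icc hq Z _ _ t _).1 h1 2
    _ ≤ _ := h4
    _ ≤ η * energy S (netCond q Z) (hitLim q Z B Λ) :=
        mul_le_mul_of_nonneg_right (hη N) (Finset.sum_nonneg fun x _ => Finset.sum_nonneg fun y _ =>
          mul_nonneg (netCond_nonneg hq Z x y) (sq_nonneg _))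
    _ ≤ _ := mul_le_mul_of_nonneg_left (h2.trans h3) hη0

/-- The probability to leave `Λ` before the end `w` of the dangling edge `{w, v}` is hit is at most
the energy of a potential that is one at `w`, divided by the conductance of the edge. -/
theorem conductance_mul_one_sub_hitLim_le (hq : ∀ e, 0 < q e)
    (Z : (latticeGraph d).Subgraph) (Λ S : Finset (Site d)) (hΛS : Λ ⊆ S)
    (hS : ∀ x ∈ Λ, ∀ e, x + unitVec e ∈ S) (v w : Site d) (hw : w ∈ Λ) (hwv : Z.Adj w v)
    (huniq : ∀ y, Z.Adj w y → y = v)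
    (g : Site d → ℝ) (hg1 : g w = 1) (hg0 : ∀ x ∉ Λ, g x = 0) :
    2 * (conductance q w v * (1 - hitLim q Z {w} Λ v)) ≤ energy S (netCond q Z) g := by
  classical
  have hvS : v ∈ S := by
    obtain ⟨e, rfl⟩ := Z.adj_sub hwv
    exact hS w hw e
  refine le_trans (le_of_eq ?_) (energy_hitLim_le hq Z (B := {w}) (Λ := Λ) S hS g
    (by rintro x rfl; exact hg1) fun x _ hx => hg0 x hx)
  -- Summation by parts leaves only the term of w: the hitting function is harmonic on the rest of Λ
  -- and zero outside. As w is a leaf, that term is the current through {w, v}.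
  rw [energy_eq _ _ (netCond_comm q Z)]
  congr 1
  rw [Finset.sum_eq_single_of_mem w (hΛS hw)]
  · rw [Finset.sum_eq_single_of_mem v hvS]
    · rw [hitLim_of_mem Z _ (Set.mem_singleton w), one_mul, netCond, if_pos hwv]
    · intro y _ hy
      rw [netCond, if_neg fun h => hy (huniq y h), zero_mul]
  · intro x _ hxw
    by_cases hx : x ∈ Λ
    · rw [sum_netCond_mul_sub_hitLim hq Z S hS (by simpa using hxw) hx, mul_zero]
    · rw [hitLim_of_notMem Z (by simpa using hxw) hx, zero_mul]

end Hitting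

/-! ### The Markov property of the walks in their random environments. -/

section Markov

theorem measurable_eval_of_countable {α β γ : Type*} [MeasurableSpace α] [MeasurableSpace β]
    [Countable β] [MeasurableSingletonClass β] [MeasurableSpace γ] {F : α → β → γ}
    (hF : ∀ x, Measurable fun a => F a x) {Y : α → β} (hY : Measurable Y) :
    Measurable fun a => F a (Y a) := by
  have : Measurable fun p : β × α => F p.2 p.1 := measurable_from_prod_countable_right fun x => hF x
  exact this.comp (hY.prodMk measurable_id)

variable {d : ℕ} {Ω : Type*} {X : ℕ → ℕ → Ω → Site d}

theorem measurable_history_of_lt {i j : ℕ} (h : j < i) (n m : ℕ) :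
    Measurable[history X i n] (X j m) :=
  Measurable.mono (comap_measurable (X j m))
    (le_sup_of_le_left (le_iSup₂_of_le j h (le_iSup_of_le m le_rfl))) le_rfl

theorem measurable_history_of_le (i : ℕ) {n m : ℕ} (h : m ≤ n) :
    Measurable[history X i n] (X i m) :=
  Measurable.mono (comap_measurable (X i m))
    (le_sup_of_le_right (le_iSup₂_of_le m h le_rfl)) le_rfl

theorem history_mono (i : ℕ) : Monotone (history X i) := by
  intro n m h
  refine sup_le ?_ ?_
  · exact iSup₂_le fun j hj => iSup_le fun l => (measurable_history_of_lt (X := X) hj m l).comap_le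
  · exact iSup₂_le fun l hl => (measurable_history_of_le (X := X) i (hl.trans h)).comap_le

theorem history_zero_mono : Monotone fun i => history X i 0 := by
  refine monotone_nat_of_le_succ fun i => sup_le ?_ ?_
  · exact iSup₂_le fun j hj => iSup_le fun m =>
      (measurable_history_of_lt (X := X) (hj.trans (Nat.lt_succ_self i)) 0 m).comap_le
  · exact iSup₂_le fun m _ => (measurable_history_of_lt (X := X) (Nat.lt_succ_self i) 0 m).comap_le

theorem measurableSet_graph_adj (i : ℕ) (x y : Site d) :
    MeasurableSet[history X i 0] {ω | (graph X i ω).Adj x y} := by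
  rcases i with _ | i
  · exact @MeasurableSet.const Ω (history X 0 0) _
  · have : {ω | (graph X (i + 1) ω).Adj x y} = ⋃ n, {ω | (latticeGraph d).Adj x y ∧
        ((X i n ω = x ∧ X i (n + 1) ω = y) ∨ (X i n ω = y ∧ X i (n + 1) ω = x))} := by
      ext ω
      simp [graph, trace]
    rw [this]
    have hm : ∀ n z, MeasurableSet[history X (i + 1) 0] {ω | X i n ω = z} := fun n z =>
      measurable_history_of_lt (X := X) (Nat.lt_succ_self i) 0 n (measurableSet_singleton z)
    refine @MeasurableSet.iUnion Ω ℕ (history X (i + 1) 0) _ _ fun n => ?_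
    exact @MeasurableSet.inter Ω (history X (i + 1) 0) _ _ (@MeasurableSet.const Ω (history X _ 0) _)
      (@MeasurableSet.union Ω (history X (i + 1) 0) _ _
        (@MeasurableSet.inter Ω (history X (i + 1) 0) _ _ (hm _ _) (hm _ _))
        (@MeasurableSet.inter Ω (history X (i + 1) 0) _ _ (hm _ _) (hm _ _)))

theorem measurable_stepProb (q : Dir d → ℝ) (i n : ℕ) (x : Site d) (e : Dir d) :
    Measurable[history X i n] fun ω => stepProb q (graph X i ω) x e := by
  classical
  refine Measurable.mono (?_ : Measurable[history X i 0] _) (history_mono i (Nat.zero_le n)) le_rfl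
  let _ := history X i 0
  have h : ∀ e, MeasurableSet {ω | (graph X i ω).Adj x (x + unitVec e)} :=
    fun e => measurableSet_graph_adj i _ _
  unfold stepProb
  exact Measurable.ite (h e) (measurable_const.div
    (Finset.measurable_sum _ fun e' _ => Measurable.ite (h e') measurable_const measurable_const))
    measurable_const

open Classical in
/-- The probability that the first `t + 1` positions of the `q`-walk on `Z` from `x` belong to
`S 0, …, S t`. -/
noncomputable def stayProb (q : Dir d → ℝ) (Z : (latticeGraph d).Subgraph) :
    ℕ → (ℕ → Set (Site d)) → Site d → ℝ
  | 0, S, x => if x ∈ S 0 then 1 else 0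
  | t + 1, S, x => if x ∈ S 0 then
      ∑ e, stepProb q Z x e * stayProb q Z t (fun k => S (k + 1)) (x + unitVec e) else 0

theorem stayProb_mem_Icc {q : Dir d → ℝ} (hq : ∀ e, 0 < q e) (Z : (latticeGraph d).Subgraph)
    (t : ℕ) (S : ℕ → Set (Site d)) (x : Site d) : stayProb q Z t S x ∈ Set.Icc (0 : ℝ) 1 := by
  induction t generalizing x S with
  | zero => rw [stayProb]; split_ifs <;> simp
  | succ t ih =>
    rw [stayProb]
    split_ifs
    · refine ⟨Finset.sum_nonneg fun e _ => mul_nonneg (stepProb_nonneg hq Z x e) (ih _ _).1, ?_⟩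
      refine le_trans (Finset.sum_le_sum fun e _ => ?_) (sum_stepProb_le_one hq Z x)
      exact mul_le_of_le_one_right (stepProb_nonneg hq Z x e) (ih _ _).2
    · simp

theorem measurable_stayProb (q : Dir d → ℝ) (i n t : ℕ) (S : ℕ → Set (Site d)) (x : Site d) :
    Measurable[history X i n] fun ω => stayProb q (graph X i ω) t S x := by
  let _ := history X i n
  induction t generalizing x S with
  | zero => simp only [stayProb]; exact measurable_const
  | succ t ih =>
    simp only [stayProb]
    split_ifs
    · exact Finset.measurable_sum _ fun e _ => (measurable_stepProb q i n x e).mul (ih _ _)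
    · exact measurable_const

variable [mΩ : MeasurableSpace Ω] {μ : Measure Ω} {p : ℕ → Dir d → ℝ}

theorem history_le (hX : IsWalkSequence μ p X) (i n : ℕ) : history X i n ≤ mΩ :=
  sup_le (iSup₂_le fun j _ => iSup_le fun m => (hX.measurable j m).comap_le)
    (iSup₂_le fun m _ => (hX.measurable i m).comap_le)

theorem measurableSet_step (hX : IsWalkSequence μ p X) (i n : ℕ) (e : Dir d) :
    MeasurableSet {ω | X i (n + 1) ω = X i n ω + unitVec e} :=
  measurableSet_eq_fun (hX.measurable i _) ((hX.measurable i n).add_const _)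

variable [IsProbabilityMeasure μ]

/-- The definition of a walk prescribes only the conditional probability of each unit step. These
add up to one when the current site has a neighbour, so almost surely some unit step is made, and
one of probability zero is not. -/
theorem ae_adj_step (hpos : ∀ i e, 0 < p i e)
    (hX : IsWalkSequence μ p X) (i n : ℕ)
    (hn : ∀ᵐ ω ∂μ, ∃ y, (graph X i ω).Adj (X i n ω) y) :
    ∀ᵐ ω ∂μ, (graph X i ω).Adj (X i n ω) (X i (n + 1) ω) := by
  set E : Dir d → Set Ω := fun e => {ω | X i (n + 1) ω = X i n ω + unitVec e} with hE
  have hEm : ∀ e, MeasurableSet (E e) := fun e => measurableSet_step hX i n e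
  have hint : ∀ e, Integrable ((E e).indicator fun _ => (1 : ℝ)) μ :=
    fun e => (integrable_const 1).indicator (hEm e)
  have hle := history_le hX i n
  have h1 : ∫ ω, ∑ e, (E e).indicator (fun _ => (1 : ℝ)) ω ∂μ = 1 := by
    rw [integral_finsetSum _ fun e _ => hint e]
    have : ∀ e, ∫ ω, (E e).indicator (fun _ => (1 : ℝ)) ω ∂μ =
        ∫ ω, stepProb (p i) (graph X i ω) (X i n ω) e ∂μ := fun e => by
      rw [← integral_condExp hle]; exact integral_congr_ae (hX.step i n e)
    simp only [this]
    rw [← integral_finsetSum _ fun e _ => (integrable_congr (hX.step i n e)).1 integrable_condExp]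
    have h2 : (fun ω => ∑ e, stepProb (p i) (graph X i ω) (X i n ω) e) =ᵐ[μ] fun _ => (1 : ℝ) := by
      filter_upwards [hn] with ω hω
      exact sum_stepProb_eq_one (hpos i) hω.choose_spec
    rw [integral_congr_ae h2]; simp
  have h2 : ∀ ω, ∑ e, (E e).indicator (fun _ => (1 : ℝ)) ω ≤ 1 := by
    intro ω
    by_cases h : ∃ e, ω ∈ E e
    · obtain ⟨e, he⟩ := h
      rw [Finset.sum_eq_single e]
      · simp [he]
      · intro e' _ hne
        refine Set.indicator_of_notMem (fun he' => hne ?_) _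
        exact unitVec_injective (add_left_cancel ((Eq.symm he').trans he))
      · simp
    · push Not at h
      simp [h]
  have h3 : ∀ᵐ ω ∂μ, 1 - ∑ e, (E e).indicator (fun _ => (1 : ℝ)) ω = 0 := by
    refine (integral_eq_zero_iff_of_nonneg (fun ω => sub_nonneg.2 (h2 ω))
      ((integrable_const 1).sub (integrable_finsetSum _ fun e _ => hint e))).1 ?_
    rw [integral_sub (integrable_const 1) (integrable_finsetSum _ fun e _ => hint e), h1]
    simp
  have h4 : ∀ e, ∀ᵐ ω ∂μ, ω ∈ E e → stepProb (p i) (graph X i ω) (X i n ω) e ≠ 0 := by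
    intro e
    set G : Set Ω := {ω | stepProb (p i) (graph X i ω) (X i n ω) e = 0} with hG
    have hGm : MeasurableSet[history X i n] G := by
      have : Measurable[history X i n] fun ω => stepProb (p i) (graph X i ω) (X i n ω) e :=
        @measurable_eval_of_countable Ω (Site d) ℝ (history X i n) _ _ _ _
          (fun ω x => stepProb (p i) (graph X i ω) x e) (fun x => measurable_stepProb _ _ _ _ _) _
          (measurable_history_of_le i le_rfl)
      exact this (measurableSet_singleton 0)
    have h5 : ∫ ω in G, (E e).indicator (fun _ => (1 : ℝ)) ω ∂μ = 0 := by
      rw [← setIntegral_condExp hle (hint e) hGm,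
        setIntegral_congr_ae (hle _ hGm) ((hX.step i n e).mono fun ω h _ => h)]
      exact setIntegral_eq_zero_of_forall_eq_zero fun ω hω => hω
    rw [setIntegral_indicator (hEm e)] at h5
    simp only [integral_const, smul_eq_mul, mul_one, measureReal_restrict_apply_univ] at h5
    rw [measureReal_eq_zero_iff] at h5
    filter_upwards [measure_eq_zero_iff_ae_notMem.1 h5] with ω hω h h'
    exact hω ⟨h', h⟩
  filter_upwards [h3, ae_all_iff.2 h4] with ω h5 h6
  by_cases h : ∃ e, ω ∈ E e
  · obtain ⟨e, he⟩ := h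
    have h7 := h6 e he
    have he' : X i (n + 1) ω = X i n ω + unitVec e := he
    rw [he']
    by_contra hna
    exact h7 (stepProb_eq_zero hna)
  · push Not at h
    simp [h] at h5

theorem ae_walk (hpos : ∀ i e, 0 < p i e)
    (hX : IsWalkSequence μ p X) (hd : 0 < d) (i : ℕ) :
    ∀ᵐ ω ∂μ, X i 0 ω = 0 ∧ ∀ n, (graph X i ω).Adj (X i n ω) (X i (n + 1) ω) := by
  induction i with
  | zero =>
    have h : ∀ n, ∀ᵐ ω ∂μ, (graph X 0 ω).Adj (X 0 n ω) (X 0 (n + 1) ω) := fun n =>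
      ae_adj_step hpos hX 0 n (Filter.Eventually.of_forall fun ω =>
        ⟨X 0 n ω + unitVec (⟨0, hd⟩, 1), _, rfl⟩)
    filter_upwards [hX.start 0, ae_all_iff.2 h] with ω h1 h2 using ⟨h1, h2⟩
  | succ i ih =>
    have h : ∀ n, ∀ᵐ ω ∂μ, (graph X (i + 1) ω).Adj (X (i + 1) n ω) (X (i + 1) (n + 1) ω) := by
      intro n
      induction n with
      | zero =>
        refine ae_adj_step hpos hX _ _ ?_
        filter_upwards [ih, hX.start (i + 1)] with ω h1 h2
        refine ⟨X i 1 ω, (graph X i ω).adj_sub ?_, 0, ?_⟩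
        · rw [h2, ← h1.1]; exact h1.2 0
        · simp [h2, h1.1]
      | succ n ihn =>
        refine ae_adj_step hpos hX _ _ ?_
        -- The edge just crossed can be crossed back, so the new site is not isolated.
        filter_upwards [ihn] with ω hω using ⟨_, hω.symm⟩
    filter_upwards [hX.start (i + 1), ae_all_iff.2 h] with ω h1 h2 using ⟨h1, h2⟩

/-- The Markov property for one step. -/
theorem condExp_eval_succ (hpos : ∀ i e, 0 < p i e)
    (hX : IsWalkSequence μ p X) (hd : 0 < d) (i n : ℕ) (f : Ω → Site d → ℝ) (C : ℝ)
    (hfC : ∀ ω x, |f ω x| ≤ C) (hf : ∀ x, Measurable[history X i n] fun ω => f ω x) :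
    μ[fun ω => f ω (X i (n + 1) ω) | history X i n] =ᵐ[μ] fun ω =>
      ∑ e, stepProb (p i) (graph X i ω) (X i n ω) e * f ω (X i n ω + unitVec e) := by
  set E : Dir d → Set Ω := fun e => {ω | X i (n + 1) ω = X i n ω + unitVec e} with hE
  have hEm : ∀ e, MeasurableSet (E e) := fun e => measurableSet_step hX i n e
  have hint : ∀ e, Integrable ((E e).indicator fun _ => (1 : ℝ)) μ :=
    fun e => (integrable_const 1).indicator (hEm e)
  have hle := history_le hX i n
  have hfm : ∀ e, Measurable[history X i n] fun ω => f ω (X i n ω + unitVec e) := fun e =>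
    @measurable_eval_of_countable Ω (Site d) ℝ (history X i n) _ _ _ _
      (fun ω x => f ω (x + unitVec e)) (fun x => hf _) _ (measurable_history_of_le i le_rfl)
  have hint2 : ∀ e, Integrable (fun ω => f ω (X i n ω + unitVec e) *
      (E e).indicator (fun _ => (1 : ℝ)) ω) μ := fun e =>
    (hint e).bdd_mul ((hfm e).mono hle le_rfl).aestronglyMeasurable
      (Filter.Eventually.of_forall fun ω => hfC ω _)
  have h1 : (fun ω => f ω (X i (n + 1) ω)) =ᵐ[μ] ∑ e, fun ω => f ω (X i n ω + unitVec e) *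
      (E e).indicator (fun _ => (1 : ℝ)) ω := by
    filter_upwards [ae_walk hpos hX hd i] with ω hω
    obtain ⟨e, he⟩ := (graph X i ω).adj_sub (hω.2 n)
    rw [Finset.sum_apply, Finset.sum_eq_single e]
    · rw [Set.indicator_of_mem (show ω ∈ E e from he), mul_one, he]
    · intro e' _ hne
      rw [Set.indicator_of_notMem, mul_zero]
      exact fun he' => hne (unitVec_injective (add_left_cancel ((Eq.symm he').trans he)))
    · simp
  refine (condExp_congr_ae h1).trans ((condExp_finsetSum (fun e _ => hint2 e) _).trans ?_)
  have h2 : ∀ e, μ[fun ω => f ω (X i n ω + unitVec e) *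
      (E e).indicator (fun _ => (1 : ℝ)) ω | history X i n] =ᵐ[μ]
        fun ω => f ω (X i n ω + unitVec e) * stepProb (p i) (graph X i ω) (X i n ω) e := by
    intro e
    refine (condExp_mul_of_stronglyMeasurable_left (hfm e).stronglyMeasurable (hint2 e)
      (hint e)).trans ?_
    filter_upwards [hX.step i n e] with ω hω
    rw [Pi.mul_apply, hω]
  filter_upwards [ae_all_iff.2 h2] with ω hω
  rw [Finset.sum_apply]
  exact Finset.sum_congr rfl fun e _ => (hω e).trans (mul_comm _ _)

/-- The conditional probability that a walk remains in a sequence of sets. -/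
theorem condExp_stay (hpos : ∀ i e, 0 < p i e)
    (hX : IsWalkSequence μ p X) (hd : 0 < d) (i n t : ℕ) (S : ℕ → Set (Site d)) :
    μ[Set.indicator {ω | ∀ k ≤ t, X i (n + k) ω ∈ S k} (fun _ => (1 : ℝ)) | history X i n] =ᵐ[μ]
      fun ω => stayProb (p i) (graph X i ω) t S (X i n ω) := by
  classical
  have hle := fun n => history_le hX i n
  induction t generalizing n S with
  | zero =>
    have h1 : Set.indicator {ω | ∀ k ≤ 0, X i (n + k) ω ∈ S k} (fun _ => (1 : ℝ)) =
        fun ω => stayProb (p i) (graph X i ω) 0 S (X i n ω) := by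
      ext ω
      simp [Set.indicator_apply, stayProb]
    rw [h1, condExp_of_stronglyMeasurable (hle n)]
    · refine Measurable.stronglyMeasurable ?_
      exact @measurable_eval_of_countable Ω (Site d) ℝ (history X i n) _ _ _ _
        (fun ω x => stayProb (p i) (graph X i ω) 0 S x) (fun x => measurable_stayProb _ _ _ _ _ _) _
        (measurable_history_of_le i le_rfl)
    · rw [← h1]
      have h2 : {ω | ∀ k ≤ 0, X i (n + k) ω ∈ S k} = X i n ⁻¹' S 0 := by ext ω; simp
      rw [h2]
      exact (integrable_const 1).indicator (hX.measurable i n (Set.to_countable (S 0)).measurableSet)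
  | succ t ih =>
    set A : Set Ω := {ω | X i n ω ∈ S 0} with hA
    set E : Set Ω := {ω | ∀ k ≤ t, X i (n + 1 + k) ω ∈ S (k + 1)} with hE
    have hAm : MeasurableSet[history X i n] A :=
      measurable_history_of_le i le_rfl (Set.to_countable (S 0)).measurableSet
    have hEm : MeasurableSet E := by
      have : E = ⋂ k, ⋂ (_ : k ≤ t), {ω | X i (n + 1 + k) ω ∈ S (k + 1)} := by
        ext ω; simp [hE]
      rw [this]
      exact MeasurableSet.iInter fun k => MeasurableSet.iInter fun _ =>
        hX.measurable i _ (Set.to_countable (S (k + 1))).measurableSet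
    have hintE : Integrable (E.indicator fun _ => (1 : ℝ)) μ := (integrable_const 1).indicator hEm
    have h1 : Set.indicator {ω | ∀ k ≤ t + 1, X i (n + k) ω ∈ S k} (fun _ => (1 : ℝ)) =
        A.indicator (fun _ => (1 : ℝ)) * E.indicator fun _ => (1 : ℝ) := by
      have h0 : {ω | ∀ k ≤ t + 1, X i (n + k) ω ∈ S k} = A ∩ E := ?_
      · rw [h0]
        ext ω
        by_cases h1 : ω ∈ A <;> by_cases h2 : ω ∈ E <;> simp [h1, h2]
      ext ω
      simp only [Set.mem_ofPred_eq, Set.mem_inter_iff, hA, hE]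
      constructor
      · intro h
        refine ⟨h 0 (Nat.zero_le _), fun k hk => ?_⟩
        have := h (k + 1) (by omega)
        rwa [show n + (k + 1) = n + 1 + k by omega] at this
      · rintro ⟨h0, h⟩ (_ | k) hk
        · exact h0
        · have := h k (by omega)
          rwa [show n + (k + 1) = n + 1 + k by omega]
    rw [h1]
    refine (condExp_mul_of_stronglyMeasurable_left
      ((@measurable_const _ _ _ (history X i n) (1 : ℝ)).indicator hAm).stronglyMeasurable
      ?_ hintE).trans ?_
    · refine hintE.bdd_mul (c := 1) (measurable_const.indicator (hle n _ hAm)).aestronglyMeasurable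
        (Filter.Eventually.of_forall fun ω => ?_)
      by_cases h : ω ∈ A <;> simp [h]
    have h2 : μ[E.indicator fun _ => (1 : ℝ) | history X i n] =ᵐ[μ] fun ω =>
        ∑ e, stepProb (p i) (graph X i ω) (X i n ω) e *
          stayProb (p i) (graph X i ω) t (fun k => S (k + 1)) (X i n ω + unitVec e) := by
      -- Tower property: condition on the history up to n + 1, apply the induction hypothesis to the
      -- shifted sets, then use the one-step Markov property.
      refine (condExp_condExp_of_le (history_mono i (Nat.le_succ n)) (hle (n + 1))).symm.trans ?_
      refine (condExp_congr_ae (ih (n + 1) fun k => S (k + 1))).trans ?_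
      refine condExp_eval_succ hpos hX hd i n
        (fun ω x => stayProb (p i) (graph X i ω) t (fun k => S (k + 1)) x) 1 (fun ω x => ?_)
        fun x => measurable_stayProb _ _ _ _ _ _
      have := stayProb_mem_Icc (hpos i) (graph X i ω) t (fun k => S (k + 1)) x
      exact abs_le.2 ⟨by linarith [this.1], this.2⟩
    filter_upwards [h2] with ω hω
    rw [Pi.mul_apply, hω, stayProb]
    by_cases h : X i n ω ∈ S 0
    · rw [if_pos h, Set.indicator_of_mem (show ω ∈ A from h), one_mul]
    · rw [if_neg h, Set.indicator_of_notMem (show ω ∉ A from h), zero_mul]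

end Markov

/-! ### Conditional Borel–Cantelli arguments and infinite range of the walks. -/

section Traces

theorem tendsto_sum_atTop_of_frequently_le {a : ℕ → ℝ} (h0 : ∀ k, 0 ≤ a k) {ε : ℝ} (hε : 0 < ε)
    (h : ∃ᶠ k in Filter.atTop, ε ≤ a k) :
    Filter.Tendsto (fun n => ∑ k ∈ Finset.range n, a k) Filter.atTop Filter.atTop := by
  rw [← not_summable_iff_tendsto_nat_atTop_of_nonneg h0]
  intro hs
  exact h ((hs.tendsto_atTop_zero.eventually_lt_const hε).mono fun k hk => not_le.2 hk)

/-- Continuity from above of conditional probabilities, which passes from finite horizons in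
`condExp_stay` to infinite time. On the event A where the limiting bound fails, c - g is positive
but its integral is not, so A is null. -/
theorem ae_le_condExp_iInter {Ω : Type*} {m mΩ : MeasurableSpace Ω} {μ : Measure Ω}
    [IsProbabilityMeasure μ] (hm : m ≤ mΩ) {E : ℕ → Set Ω} (hE : ∀ t, MeasurableSet (E t))
    (hanti : Antitone E) (c : ℝ) :
    ∀ᵐ ω ∂μ, (∀ t, c ≤ (μ[(E t).indicator (fun _ => (1 : ℝ)) | m]) ω) →
      c ≤ (μ[(⋂ t, E t).indicator (fun _ => (1 : ℝ)) | m]) ω := by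
  set g := μ[(⋂ t, E t).indicator (fun _ => (1 : ℝ)) | m] with hg
  set A : Set Ω := {ω | (∀ t, c ≤ (μ[(E t).indicator (fun _ => (1 : ℝ)) | m]) ω) ∧ g ω < c} with hA
  have hAm : MeasurableSet[m] A := by
    have : A = (⋂ t, {ω | c ≤ (μ[(E t).indicator (fun _ => (1 : ℝ)) | m]) ω}) ∩ {ω | g ω < c} := by
      ext ω; simp [hA]
    rw [this]
    refine @MeasurableSet.inter Ω m _ _ (@MeasurableSet.iInter Ω ℕ m _ _ fun t => ?_) ?_
    · exact stronglyMeasurable_condExp.measurable (measurableSet_Ici (a := c))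
    · exact stronglyMeasurable_condExp.measurable (measurableSet_Iio (a := c))
  have hAm' := hm _ hAm
  have hint : ∀ B : Set Ω, MeasurableSet B → Integrable (B.indicator fun _ => (1 : ℝ)) μ :=
    fun B hB => (integrable_const 1).indicator hB
  have hreal : ∀ B : Set Ω, MeasurableSet B →
      ∫ ω in A, (μ[B.indicator (fun _ => (1 : ℝ)) | m]) ω ∂μ = μ.real (A ∩ B) := by
    intro B hB
    rw [setIntegral_condExp hm (hint B hB) hAm, setIntegral_indicator hB]
    simp
  have h1 : ∀ t, c * μ.real A ≤ μ.real (A ∩ E t) := by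
    intro t
    rw [← hreal _ (hE t)]
    have : ∫ _ in A, c ∂μ = c * μ.real A := by simp [mul_comm]
    rw [← this]
    exact setIntegral_mono_on (integrable_const c).integrableOn integrable_condExp.integrableOn
      hAm' fun ω hω => hω.1 t
  have h2 : c * μ.real A ≤ μ.real (A ∩ ⋂ t, E t) := by
    have ht : Filter.Tendsto (fun t => μ (A ∩ E t)) Filter.atTop (nhds (μ (⋂ t, A ∩ E t))) :=
      tendsto_measure_iInter_atTop (fun t => (hAm'.inter (hE t)).nullMeasurableSet)
        (fun s t hst => Set.inter_subset_inter_right _ (hanti hst)) ⟨0, measure_ne_top _ _⟩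
    rw [← Set.inter_iInter] at ht
    exact ge_of_tendsto' ((ENNReal.tendsto_toReal (measure_ne_top _ _)).comp ht) h1
  rw [← hreal _ (MeasurableSet.iInter hE)] at h2
  have h3 : ∫ ω in A, (c - g ω) ∂μ ≤ 0 := by
    rw [integral_sub (integrable_const c).integrableOn integrable_condExp.integrableOn]
    have : ∫ _ in A, c ∂μ = c * μ.real A := by simp [mul_comm]
    rw [this]; linarith
  have h4 : 0 ≤ᵐ[μ.restrict A] fun ω => c - g ω :=
    (ae_restrict_iff' hAm').2 (Filter.Eventually.of_forall fun ω hω => (sub_pos.2 hω.2).le)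
  have h5 := (setIntegral_eq_zero_iff_of_nonneg_ae h4
    ((integrable_const c).sub integrable_condExp).integrableOn).1
      (le_antisymm h3 (integral_nonneg_of_ae h4))
  have h6 := (ae_restrict_iff' hAm').1 h5
  filter_upwards [h6] with ω hω h
  by_contra hc
  have hωA : ω ∈ A := ⟨h, not_le.1 hc⟩
  have : c - g ω = 0 := hω hωA
  exact hc (by linarith)

variable {d : ℕ} {Ω : Type*} {X : ℕ → ℕ → Ω → Site d}

theorem graph_succ_le {i : ℕ} {ω : Ω}
    (h : ∀ n, (graph X i ω).Adj (X i n ω) (X i (n + 1) ω)) : graph X (i + 1) ω ≤ graph X i ω := by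
  constructor
  · rintro _ ⟨n, rfl⟩
    exact (graph X i ω).edge_vert (h n)
  · rintro x y ⟨-, n, hn⟩
    rcases Sym2.eq_iff.1 hn with ⟨h1, h2⟩ | ⟨h1, h2⟩
    · rw [← h1, ← h2]; exact h n
    · rw [← h1, ← h2]; exact (h n).symm

theorem graph_antitone {ω : Ω}
    (h : ∀ i n, (graph X i ω).Adj (X i n ω) (X i (n + 1) ω)) : Antitone fun i => graph X i ω :=
  antitone_nat_of_succ_le fun i => graph_succ_le (h i)

/-- If the range were finite, the set V of sites visited infinitely often would be nonempty and
closed under adjacency; going back along the walk, it would contain 0 and hence the range of the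
preceding walk (for i = 0, all multiples of a unit vector), which is infinite. -/
theorem infinite_range_of_recurrent_closed (hd : 0 < d) {ω : Ω}
    (hw : ∀ i, X i 0 ω = 0 ∧ ∀ n, (graph X i ω).Adj (X i n ω) (X i (n + 1) ω))
    (hr : ∀ i x e, (graph X i ω).Adj x (x + unitVec e) →
      (∃ᶠ n in Filter.atTop, X i n ω = x) → ∃ᶠ n in Filter.atTop, X i n ω = x + unitVec e)
    (i : ℕ) : (Set.range fun n => X i n ω).Infinite := by
  have key : ∀ i, (Set.range fun n => X i n ω).Finite →
      ∃ V : Set (Site d), 0 ∈ V ∧ V ⊆ (Set.range fun n => X i n ω) ∧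
        ∀ x ∈ V, ∀ y, (graph X i ω).Adj x y → y ∈ V := by
    intro i hfin
    set V : Set (Site d) := {x | ∃ᶠ n in Filter.atTop, X i n ω = x} with hV
    have hcl : ∀ x ∈ V, ∀ y, (graph X i ω).Adj x y → y ∈ V := by
      intro x hx y hy
      obtain ⟨e, rfl⟩ := (graph X i ω).adj_sub hy
      exact hr i x e hy hx
    refine ⟨V, ?_, fun x hx => hx.exists, hcl⟩
    obtain ⟨x, ⟨n, rfl⟩, hx⟩ : ∃ x ∈ Set.range fun n => X i n ω, x ∈ V := by
      by_contra! h
      have h1 : ∀ᶠ n in Filter.atTop, ∀ x ∈ Set.range fun n => X i n ω, X i n ω ≠ x :=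
        (Filter.eventually_all_finite hfin).2 fun x hx => Filter.not_frequently.1 (h x hx)
      obtain ⟨n, hn⟩ := h1.exists
      exact hn _ ⟨n, rfl⟩ rfl
    induction n with
    | zero => rwa [← (hw i).1]
    | succ n ih => exact ih (hcl _ hx _ ((hw i).2 n).symm)
  induction i with
  | zero =>
    intro hfin
    obtain ⟨V, h0, hV, hcl⟩ := key 0 hfin
    have h1 : ∀ k : ℕ, k • unitVec ((⟨0, hd⟩, 1) : Dir d) ∈ V := by
      intro k
      induction k with
      | zero => simpa using h0
      | succ k ih => exact hcl _ ih _ ⟨(⟨0, hd⟩, 1), by rw [succ_nsmul]⟩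
    refine Set.infinite_of_injective_forall_mem (fun a b hab => ?_) (fun k => hV (h1 k)) hfin
    have := congr_fun hab ⟨0, hd⟩
    simpa [unitVec] using this
  | succ i ih =>
    intro hfin
    obtain ⟨V, h0, hV, hcl⟩ := key (i + 1) hfin
    refine ih (hfin.subset (Set.Subset.trans ?_ hV))
    rintro _ ⟨n, rfl⟩
    induction n with
    | zero => simpa [(hw i).1] using h0
    | succ n ihn => exact hcl _ ihn _ ⟨(graph X i ω).adj_sub ((hw i).2 n), n, rfl⟩

theorem stayProb_le_one_sub_hitProb {q : Dir d → ℝ} (hq : ∀ e, 0 < q e)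
    (Z : (latticeGraph d).Subgraph) (B : Set (Site d)) (t : ℕ) (x : Site d) :
    stayProb q Z t (fun _ => Bᶜ) x ≤ 1 - hitProb q Z B Set.univ t x := by
  induction t generalizing x with
  | zero => by_cases h : x ∈ B <;> simp [stayProb, hitProb, h]
  | succ t ih =>
    by_cases h : x ∈ B
    · simp [stayProb, hitProb, h]
    · simp only [stayProb, hitProb, h, Set.mem_compl_iff, not_false_eq_true, if_true, if_false,
        Set.mem_univ]
      calc _ ≤ ∑ e, stepProb q Z x e * (1 - hitProb q Z B Set.univ t (x + unitVec e)) :=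
            Finset.sum_le_sum fun e _ => mul_le_mul_of_nonneg_left (ih _) (stepProb_nonneg hq Z x e)
        _ ≤ _ := by
            simp only [mul_sub, mul_one, Finset.sum_sub_distrib]
            exact sub_le_sub_right (sum_stepProb_le_one hq Z x) _

/-- At an isolated vertex all step probabilities vanish and mass is lost from both quantities, hence
the assumption on Z. -/
theorem one_sub_hitProb_le_stayProb {q : Dir d → ℝ} (hq : ∀ e, 0 < q e)
    (Z : (latticeGraph d).Subgraph) (hZ : ∀ x ∈ Z.verts, ∃ y, Z.Adj x y) (B : Set (Site d)) (t : ℕ)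
    (x : Site d) (hx : x ∈ Z.verts) :
    1 - hitProb q Z B Set.univ t x ≤ stayProb q Z t (fun _ => Bᶜ) x := by
  induction t generalizing x with
  | zero => by_cases h : x ∈ B <;> simp [stayProb, hitProb, h]
  | succ t ih =>
    by_cases h : x ∈ B
    · simp [stayProb, hitProb, h]
    · simp only [stayProb, hitProb, h, Set.mem_compl_iff, not_false_eq_true, if_true, if_false,
        Set.mem_univ]
      obtain ⟨y, hy⟩ := hZ x hx
      calc _ = ∑ e, stepProb q Z x e * (1 - hitProb q Z B Set.univ t (x + unitVec e)) := by
            simp only [mul_sub, mul_one, Finset.sum_sub_distrib]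
            rw [sum_stepProb_eq_one hq hy]
        _ ≤ _ := by
            refine Finset.sum_le_sum fun e _ => ?_
            by_cases he : Z.Adj x (x + unitVec e)
            · exact mul_le_mul_of_nonneg_left (ih _ (Z.edge_vert he.symm)) (stepProb_nonneg hq Z x e)
            · simp [stepProb_eq_zero he]

theorem stayProb_congr (q : Dir d → ℝ) (Z : (latticeGraph d).Subgraph) (t : ℕ)
    {S S' : ℕ → Set (Site d)} {x : Site d} (hx : x ∈ S 0) (hx' : x ∈ S' 0)
    (h : ∀ k, S (k + 1) = S' (k + 1)) : stayProb q Z t S x = stayProb q Z t S' x := by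
  rcases t with _ | t
  · simp [stayProb, hx, hx']
  · simp [stayProb, hx, hx', h]

/-- Restricting a walk to a subgraph only increases the probabilities of the steps that remain
(`le_stepProb`), so each prescribed step costs at most a factor ε. -/
theorem pow_mul_le_stayProb {q : Dir d → ℝ} (hq : ∀ e, 0 < q e) (hq1 : ∑ e, q e = 1)
    {ε : ℝ} (hε : 0 ≤ ε) (hεq : ∀ e, ε ≤ q e) (Z : (latticeGraph d).Subgraph) (B : Set (Site d))
    (n t : ℕ) (γ : ℕ → Site d) (hγ : ∀ k < n, Z.Adj (γ k) (γ (k + 1))) (hγB : γ n ∉ B) :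
    ε ^ n * stayProb q Z t (fun _ => Bᶜ) (γ n) ≤
      stayProb q Z (n + t) (fun k => if k ≤ n then {γ k} else Bᶜ) (γ 0) := by
  induction n generalizing γ with
  | zero =>
    rw [pow_zero, one_mul, zero_add]
    exact le_of_eq (stayProb_congr q Z t hγB (by simp) fun k => by simp)
  | succ n ih =>
    have h1 := ih (fun k => γ (k + 1)) (fun k hk => hγ (k + 1) (by omega)) hγB
    rw [show n + 1 + t = n + t + 1 by omega, stayProb, if_pos (by simp)]
    obtain ⟨e, he⟩ := Z.adj_sub (hγ 0 (Nat.succ_pos n))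
    have hadj := hγ 0 (Nat.succ_pos n)
    rw [he] at hadj
    refine le_trans ?_ (Finset.single_le_sum (fun e' _ => mul_nonneg (stepProb_nonneg hq Z _ e')
      (stayProb_mem_Icc hq Z _ _ _).1) (Finset.mem_univ e))
    rw [← he, pow_succ', mul_assoc]
    refine mul_le_mul ((hεq e).trans (le_stepProb hq hq1 hadj)) ?_
      (mul_nonneg (pow_nonneg hε n) (stayProb_mem_Icc hq Z _ _ _).1) (stepProb_nonneg hq Z _ e)
    simpa using h1

variable [mΩ : MeasurableSpace Ω] {μ : Measure Ω} {p : ℕ → Dir d → ℝ}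

theorem measurableSet_stay (hX : IsWalkSequence μ p X) (i n t : ℕ) (S : ℕ → Set (Site d)) :
    MeasurableSet {ω | ∀ k ≤ t, X i (n + k) ω ∈ S k} := by
  have : {ω | ∀ k ≤ t, X i (n + k) ω ∈ S k} = ⋂ k, ⋂ (_ : k ≤ t), X i (n + k) ⁻¹' S k := by
    ext ω; simp
  rw [this]
  exact MeasurableSet.iInter fun k => MeasurableSet.iInter fun _ =>
    hX.measurable i _ (Set.to_countable (S k)).measurableSet

variable [IsProbabilityMeasure μ]

theorem ae_frequently_step (hpos : ∀ i e, 0 < p i e) (hp1 : ∀ i, ∑ e, p i e = 1)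
    (hX : IsWalkSequence μ p X) (hd : 0 < d) (i : ℕ) (x : Site d) (e : Dir d) :
    ∀ᵐ ω ∂μ, (graph X i ω).Adj x (x + unitVec e) → (∃ᶠ n in Filter.atTop, X i n ω = x) →
      ∃ᶠ n in Filter.atTop, X i n ω = x + unitVec e := by
  let ℱ : Filtration ℕ mΩ := ⟨history X i, history_mono i, fun n => history_le hX i n⟩
  set S : ℕ → Set (Site d) := fun k => if k = 0 then {x} else {x + unitVec e} with hS
  -- Indexed by the time at which the step from x to x + e ends, so that `s n` is known at time n.
  -- Each visit to x gives conditional probability at least p(e), and Lévy's Borel–Cantelli lemma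
  -- applies.
  set s : ℕ → Set Ω := fun n => {ω | 0 < n ∧ X i (n - 1) ω = x ∧ X i n ω = x + unitVec e} with hs
  have hsm : ∀ n, MeasurableSet[ℱ n] (s n) := by
    intro n
    refine @MeasurableSet.inter Ω (history X i n) _ _ (@MeasurableSet.const Ω (history X i n) _)
      (@MeasurableSet.inter Ω (history X i n) _ _ ?_ ?_)
    · exact measurable_history_of_le (X := X) i (Nat.sub_le n 1) (measurableSet_singleton x)
    · exact measurable_history_of_le (X := X) i le_rfl (measurableSet_singleton (x + unitVec e))
  have hss : ∀ n, (s (n + 1)).indicator (1 : Ω → ℝ) =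
      Set.indicator {ω | ∀ k ≤ 1, X i (n + k) ω ∈ S k} (fun _ => (1 : ℝ)) := by
    intro n
    have : s (n + 1) = {ω | ∀ k ≤ 1, X i (n + k) ω ∈ S k} := by
      ext ω
      simp only [hs, hS, Set.mem_ofPred_eq, Nat.succ_pos, true_and, Nat.add_sub_cancel]
      constructor
      · rintro ⟨h0, h1⟩ k hk
        interval_cases k <;> simp [h0, h1]
      · intro h
        exact ⟨by simpa using h 0 (by simp), by simpa using h 1 (by simp)⟩
    rw [this]; rfl
  have hc : ∀ n, μ[(s (n + 1)).indicator (1 : Ω → ℝ) | ℱ n] =ᵐ[μ]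
      fun ω => stayProb (p i) (graph X i ω) 1 S (X i n ω) := by
    intro n
    rw [hss]
    exact condExp_stay hpos hX hd i n 1 S
  filter_upwards [ae_mem_limsup_atTop_iff μ hsm, ae_all_iff.2 hc] with ω h1 h2 hadj hfreq
  have h3 : ω ∈ Filter.limsup s Filter.atTop := by
    rw [h1]
    simp only [h2]
    refine tendsto_sum_atTop_of_frequently_le (fun k => (stayProb_mem_Icc (hpos i) _ _ _ _).1)
      (hpos i e) (hfreq.mono fun n hn => ?_)
    rw [hn]
    simp only [stayProb, hS, if_true, Set.mem_singleton_iff, one_ne_zero, if_false, zero_add]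
    refine le_trans (le_stepProb (hpos i) (hp1 i) hadj) ?_
    refine le_of_eq_of_le ?_ (Finset.single_le_sum (fun e' _ => ?_) (Finset.mem_univ e))
    · simp
    · refine mul_nonneg (stepProb_nonneg (hpos i) _ _ e') ?_
      split_ifs <;> simp
  rw [Filter.mem_limsup_iff_frequently_mem] at h3
  exact h3.mono fun n hn => hn.2.2

/-- Almost surely, all walks are nearest-neighbour paths on their graphs and have infinite range. -/
theorem ae_regular (hpos : ∀ i e, 0 < p i e) (hp1 : ∀ i, ∑ e, p i e = 1)
    (hX : IsWalkSequence μ p X) (hd : 0 < d) :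
    ∀ᵐ ω ∂μ, (∀ i, X i 0 ω = 0) ∧ (∀ i n, (graph X i ω).Adj (X i n ω) (X i (n + 1) ω)) ∧
      ∀ i, (Set.range fun n => X i n ω).Infinite := by
  have h2 : ∀ᵐ ω ∂μ, ∀ i x e, (graph X i ω).Adj x (x + unitVec e) →
      (∃ᶠ n in Filter.atTop, X i n ω = x) → ∃ᶠ n in Filter.atTop, X i n ω = x + unitVec e :=
    ae_all_iff.2 fun i => ae_all_iff.2 fun x => ae_all_iff.2 fun e =>
      ae_frequently_step hpos hp1 hX hd i x e
  filter_upwards [ae_all_iff.2 fun i => ae_walk hpos hX hd i, h2] with ω h1 h2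
  exact ⟨fun i => (h1 i).1, fun i => (h1 i).2, infinite_range_of_recurrent_closed hd h1 h2⟩

end Traces

/-! ### Independent steps: product law, independence of past and future, exponential moments. -/

section StepSequences

instance discreteMeasurableSpace_intUnits : DiscreteMeasurableSpace ℤˣ :=
  ⟨fun s => ⟨Units.val '' s, MeasurableSet.of_discrete,
    Set.preimage_image_eq s Units.val_injective⟩⟩

variable {d : ℕ}

/-- The sequence that starts with `e` and continues with `s`. -/
def consSeq {α : Type*} (e : α) (s : ℕ → α) : ℕ → α
  | 0 => e
  | n + 1 => s n

/-- The sequence `s` without its first `n` terms. -/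
def shift {α : Type*} (n : ℕ) (s : ℕ → α) : ℕ → α := fun k => s (n + k)

theorem measurable_consSeq {α : Type*} [MeasurableSpace α] (e : α) : Measurable (consSeq e) := by
  refine measurable_pi_lambda _ fun n => ?_
  rcases n with _ | n
  · exact measurable_const
  · exact measurable_pi_apply n

theorem measurable_shift {α : Type*} [MeasurableSpace α] (n : ℕ) :
    Measurable (shift n : (ℕ → α) → ℕ → α) :=
  measurable_pi_lambda _ fun k => measurable_pi_apply (n + k)

theorem shift_shift {α : Type*} (m n : ℕ) (s : ℕ → α) : shift n (shift m s) = shift (m + n) s := by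
  ext k; simp [shift, add_assoc]

/-- The position after `n` steps of the path from the origin with step sequence `s`. -/
def pos (s : ℕ → Dir d) (n : ℕ) : Site d := ∑ k ∈ Finset.range n, unitVec (s k)

theorem pos_zero (s : ℕ → Dir d) : pos s 0 = 0 := by simp [pos]

theorem pos_succ (s : ℕ → Dir d) (n : ℕ) : pos s (n + 1) = pos s n + unitVec (s n) := by
  simp [pos, Finset.sum_range_succ]

theorem pos_add (s : ℕ → Dir d) (n k : ℕ) : pos s (n + k) = pos s n + pos (shift n s) k := by
  simp [pos, Finset.sum_range_add, shift]

theorem pos_congr {s s' : ℕ → Dir d} {n : ℕ} (h : ∀ k < n, s k = s' k) : pos s n = pos s' n :=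
  Finset.sum_congr rfl fun k hk => by rw [h k (Finset.mem_range.1 hk)]

theorem pos_consSeq (e : Dir d) (s : ℕ → Dir d) (n : ℕ) :
    pos (consSeq e s) (n + 1) = unitVec e + pos s n := by
  rw [add_comm n, pos_add]
  congr 1
  · simp [pos, consSeq]
  · congr 1; ext k : 1; simp [shift, consSeq, add_comm 1 k]

theorem measurable_pos (n : ℕ) : Measurable fun s : ℕ → Dir d => pos s n := by
  unfold pos
  exact Finset.measurable_sum _ fun k _ =>
    (measurable_of_countable (unitVec : Dir d → Site d)).comp (measurable_pi_apply k)

/-- The law of one step. -/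
noncomputable def stepLaw (q : Dir d → ℝ) : Measure (Dir d) :=
  ∑ e, ENNReal.ofReal (q e) • Measure.dirac e

theorem stepLaw_apply (q : Dir d → ℝ) (t : Set (Dir d)) :
    stepLaw q t = ∑ e, ENNReal.ofReal (q e) * t.indicator 1 e := by
  simp [stepLaw]

theorem isProbabilityMeasure_stepLaw {q : Dir d → ℝ} (hq : ∀ e, 0 < q e) (hq1 : ∑ e, q e = 1) :
    IsProbabilityMeasure (stepLaw q) := by
  refine ⟨?_⟩
  rw [stepLaw_apply]
  simp [← ENNReal.ofReal_sum_of_nonneg fun e _ => (hq e).le, hq1]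

theorem eq_infinitePi_of_forall_lt {α : Type*} [MeasurableSpace α] {ν : Measure α}
    [IsProbabilityMeasure ν] {P : Measure (ℕ → α)}
    (h : ∀ (N : ℕ) (t : ℕ → Set α), (∀ k, MeasurableSet (t k)) →
      P {s | ∀ k < N, s k ∈ t k} = ∏ k ∈ Finset.range N, ν (t k)) :
    P = Measure.infinitePi fun _ => ν := by
  classical
  refine Measure.eq_infinitePi _ fun s t ht => ?_
  obtain ⟨N, hN⟩ : ∃ N, s ⊆ Finset.range N := s.exists_nat_subset_range
  have h1 := h N (fun k => if k ∈ s then t k else Set.univ)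
    (fun k => by split_ifs; exacts [ht k, MeasurableSet.univ])
  have h2 : {u : ℕ → α | ∀ k < N, u k ∈ (if k ∈ s then t k else Set.univ)} =
      Set.pi s t := by
    ext u
    simp only [Set.mem_ofPred_eq, Set.mem_pi, Finset.mem_coe]
    constructor
    · intro hu k hk
      simpa [hk] using hu k (Finset.mem_range.1 (hN hk))
    · intro hu k _
      split_ifs with hk
      · exact hu k hk
      · trivial
  rw [h2] at h1
  rw [h1, ← Finset.prod_subset hN]
  · exact Finset.prod_congr rfl fun k hk => by rw [if_pos hk]
  · intro k _ hk
    rw [if_neg hk, measure_univ]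

theorem measurableSet_forall_lt {α : Type*} [MeasurableSpace α] (N : ℕ) {t : ℕ → Set α}
    (ht : ∀ k, MeasurableSet (t k)) : MeasurableSet {s : ℕ → α | ∀ k < N, s k ∈ t k} := by
  have : {s : ℕ → α | ∀ k < N, s k ∈ t k} = ⋂ k, ⋂ (_ : k < N), {s | s k ∈ t k} := by
    ext s; simp
  rw [this]
  exact MeasurableSet.iInter fun k => MeasurableSet.iInter fun _ => measurable_pi_apply k (ht k)

/-- The law of a sequence of independent steps. -/
noncomputable def seqLaw (q : Dir d → ℝ) : Measure (ℕ → Dir d) :=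
  Measure.infinitePi fun _ => stepLaw q

theorem isProbabilityMeasure_seqLaw {q : Dir d → ℝ} (hq : ∀ e, 0 < q e) (hq1 : ∑ e, q e = 1) :
    IsProbabilityMeasure (seqLaw q) := by
  have := isProbabilityMeasure_stepLaw hq hq1
  unfold seqLaw
  infer_instance

theorem seqLaw_forall_lt {q : Dir d → ℝ} (hq : ∀ e, 0 < q e) (hq1 : ∑ e, q e = 1) (N : ℕ)
    (t : ℕ → Set (Dir d)) :
    seqLaw q {s | ∀ k < N, s k ∈ t k} = ∏ k ∈ Finset.range N, stepLaw q (t k) := by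
  have := isProbabilityMeasure_stepLaw hq hq1
  rw [seqLaw, ← Measure.infinitePi_pi (fun _ : ℕ => stepLaw q) (t := t)
    fun _ _ => MeasurableSet.of_discrete]
  congr 1
  ext s
  simp [Set.mem_pi]

theorem seqLaw_eq_sum_map_consSeq {q : Dir d → ℝ} (hq : ∀ e, 0 < q e) (hq1 : ∑ e, q e = 1) :
    ∑ e, ENNReal.ofReal (q e) • (seqLaw q).map (consSeq e) = seqLaw q := by
  have h0 := isProbabilityMeasure_stepLaw hq hq1
  have h1 := isProbabilityMeasure_seqLaw hq hq1
  refine eq_infinitePi_of_forall_lt fun N t ht => ?_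
  have hm := measurableSet_forall_lt N ht
  simp only [Measure.finsetSum_apply, Measure.smul_apply, smul_eq_mul,
    Measure.map_apply (measurable_consSeq _) hm]
  rcases N with _ | N
  · simp [← ENNReal.ofReal_sum_of_nonneg fun e _ => (hq e).le, hq1]
  · rw [Finset.prod_range_succ', ← seqLaw_forall_lt hq hq1 N fun k => t (k + 1), stepLaw_apply,
      Finset.mul_sum]
    refine Finset.sum_congr rfl fun e _ => ?_
    rw [mul_left_comm]
    congr 1
    by_cases he : e ∈ t 0
    · rw [Set.indicator_of_mem he, Pi.one_apply, mul_one]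
      congr 1
      ext s
      simp only [Set.mem_preimage, Set.mem_ofPred_eq]
      constructor
      · intro h k hk
        exact h (k + 1) (by omega)
      · rintro h (_ | k) hk
        · exact he
        · exact h k (by omega)
    · rw [Set.indicator_of_notMem he, mul_zero]
      have : consSeq e ⁻¹' {s | ∀ k < N + 1, s k ∈ t k} = ∅ :=
        Set.eq_empty_of_forall_notMem fun s hs => he (hs 0 (Nat.succ_pos N))
      rw [this, measure_empty]

theorem lintegral_seqLaw {q : Dir d → ℝ} (hq : ∀ e, 0 < q e) (hq1 : ∑ e, q e = 1)
    {f : (ℕ → Dir d) → ENNReal} (hf : Measurable f) :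
    ∫⁻ s, f s ∂seqLaw q = ∑ e, ENNReal.ofReal (q e) * ∫⁻ s, f (consSeq e s) ∂seqLaw q := by
  conv_lhs => rw [← seqLaw_eq_sum_map_consSeq hq hq1]
  rw [lintegral_finsetSum_measure]
  refine Finset.sum_congr rfl fun e _ => ?_
  rw [lintegral_smul_measure, lintegral_map hf (measurable_consSeq e), smul_eq_mul]

/-- Independence of the first n steps from the later ones, obtained by splitting off one step at a
time. -/
theorem lintegral_mul_shift {q : Dir d → ℝ} (hq : ∀ e, 0 < q e) (hq1 : ∑ e, q e = 1) (n : ℕ)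
    {F G : (ℕ → Dir d) → ENNReal} (hF : Measurable F) (hG : Measurable G)
    (hFn : ∀ s s', (∀ k < n, s k = s' k) → F s = F s') :
    ∫⁻ s, F s * G (shift n s) ∂seqLaw q = (∫⁻ s, F s ∂seqLaw q) * ∫⁻ s, G s ∂seqLaw q := by
  induction n generalizing F with
  | zero =>
    have h1 := isProbabilityMeasure_seqLaw hq hq1
    rcases isEmpty_or_nonempty (Dir d) with h | ⟨⟨e⟩⟩
    · simp at hq1
    have h2 : ∀ s, F s = F fun _ => e := fun s => hFn _ _ fun k hk => absurd hk (Nat.not_lt_zero k)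
    have h3 : ∀ s : ℕ → Dir d, shift 0 s = s := fun s => by ext k : 1; simp [shift]
    simp only [h2, h3]
    rw [lintegral_const_mul _ hG]
    simp
  | succ n ih =>
    have h4 : ∀ e (s : ℕ → Dir d), shift (n + 1) (consSeq e s) = shift n s := fun e s => by
      ext k : 1; rw [shift, shift, show n + 1 + k = n + k + 1 by omega]; rfl
    rw [lintegral_seqLaw hq hq1 (f := fun s => F s * G (shift (n + 1) s))
      (hF.mul (hG.comp (measurable_shift _))), lintegral_seqLaw hq hq1 hF,
      Finset.sum_mul]
    refine Finset.sum_congr rfl fun e _ => ?_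
    simp only [h4]
    rw [ih (F := fun s => F (consSeq e s)) (hF.comp (measurable_consSeq e)), mul_assoc]
    refine fun s s' h => hFn _ _ ?_
    rintro (_ | k) hk
    · rfl
    · exact h k (by omega)

theorem lintegral_shift {q : Dir d → ℝ} (hq : ∀ e, 0 < q e) (hq1 : ∑ e, q e = 1) (n : ℕ)
    {G : (ℕ → Dir d) → ENNReal} (hG : Measurable G) :
    ∫⁻ s, G (shift n s) ∂seqLaw q = ∫⁻ s, G s ∂seqLaw q := by
  have h1 := isProbabilityMeasure_seqLaw hq hq1
  simpa using lintegral_mul_shift hq hq1 n (F := fun _ => 1) measurable_const hG fun _ _ _ => rfl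

/-- The mean of an additive function of a step. -/
def stepMean (q : Dir d → ℝ) (φ : Site d →+ ℝ) : ℝ := ∑ e, q e * φ (unitVec e)

/-- The Laplace transform of an additive function of a step. -/
noncomputable def laplace (q : Dir d → ℝ) (φ : Site d →+ ℝ) (r : ℝ) : ℝ :=
  ∑ e, q e * Real.exp (-(r * φ (unitVec e)))

theorem laplace_pos {q : Dir d → ℝ} (hq : ∀ e, 0 < q e) (hq1 : ∑ e, q e = 1) (φ : Site d →+ ℝ)
    (r : ℝ) : 0 < laplace q φ r := by
  refine Finset.sum_pos (fun e _ => mul_pos (hq e) (Real.exp_pos _)) ?_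
  by_contra h
  rw [Finset.not_nonempty_iff_eq_empty] at h
  simp [h] at hq1

theorem exists_laplace_lt_one {q : Dir d → ℝ} (hq : ∀ e, 0 < q e) (hq1 : ∑ e, q e = 1)
    {φ : Site d →+ ℝ} (hφ : 0 < stepMean q φ) : ∃ r, 0 < r ∧ r ≤ 1 ∧ laplace q φ r < 1 := by
  set C := 1 + ∑ e, |φ (unitVec e)| with hC
  set m := stepMean q φ with hm
  have hφC : ∀ e, |φ (unitVec e)| ≤ C := fun e => by
    have := Finset.single_le_sum (fun e _ => abs_nonneg (φ (unitVec e))) (Finset.mem_univ e)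
    linarith
  have hC1 : 1 ≤ C := by
    have := Finset.sum_nonneg fun e (_ : e ∈ Finset.univ) => abs_nonneg (φ (unitVec e))
    linarith
  have hmC : m ≤ C := by
    calc m ≤ ∑ e, q e * C := Finset.sum_le_sum fun e _ =>
          mul_le_mul_of_nonneg_left ((le_abs_self _).trans (hφC e)) (hq e).le
      _ = C := by rw [← Finset.sum_mul, hq1, one_mul]
  have hCC : C ≤ C ^ 2 := by nlinarith
  have hC2 : 0 < 2 * C ^ 2 := by positivity
  -- From exp(-x) ≤ 1 - x + x² for |x| ≤ 1, the transform is at most 1 - rm + r²C². This choice of r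
  -- gives rm = 2r²C², hence the value 1 - r²C².
  set r := m / (2 * C ^ 2) with hr
  have hr0 : 0 < r := div_pos hφ hC2
  have hrm : r * (2 * C ^ 2) = m := div_mul_cancel₀ _ hC2.ne'
  have hrC : r * C ≤ 1 := by
    rw [hr, div_mul_eq_mul_div, div_le_one hC2]
    nlinarith
  refine ⟨r, hr0, by nlinarith, ?_⟩
  have h1 : ∀ e, Real.exp (-(r * φ (unitVec e))) ≤ 1 - r * φ (unitVec e) + (r * C) ^ 2 := by
    intro e
    have h2 : |-(r * φ (unitVec e))| ≤ r * C := by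
      rw [abs_neg, abs_mul, abs_of_pos hr0]
      exact mul_le_mul_of_nonneg_left (hφC e) hr0.le
    have h3 := (abs_le.1 (Real.abs_exp_sub_one_sub_id_le (h2.trans hrC))).2
    have h4 : (-(r * φ (unitVec e))) ^ 2 ≤ (r * C) ^ 2 := sq_le_sq.2 (h2.trans (le_abs_self _))
    linarith
  calc laplace q φ r ≤ ∑ e, q e * (1 - r * φ (unitVec e) + (r * C) ^ 2) :=
        Finset.sum_le_sum fun e _ => mul_le_mul_of_nonneg_left (h1 e) (hq e).le
    _ = (∑ e, q e) * (1 + (r * C) ^ 2) - r * m := by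
        rw [hm, stepMean, Finset.mul_sum, Finset.sum_mul, ← Finset.sum_sub_distrib]
        exact Finset.sum_congr rfl fun e _ => by ring
    _ < 1 := by
        rw [hq1, ← hrm]
        have : 0 < r ^ 2 * C ^ 2 := by positivity
        nlinarith

theorem measurable_comp_pos {β : Type*} [MeasurableSpace β] (f : Site d → β) (n : ℕ) :
    Measurable fun s : ℕ → Dir d => f (pos s n) :=
  (measurable_of_countable f).comp (measurable_pos n)

theorem lintegral_exp_neg_pos {q : Dir d → ℝ} (hq : ∀ e, 0 < q e) (hq1 : ∑ e, q e = 1)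
    (φ : Site d →+ ℝ) (r : ℝ) (n : ℕ) :
    ∫⁻ s, ENNReal.ofReal (Real.exp (-(r * φ (pos s n)))) ∂seqLaw q =
      ENNReal.ofReal (laplace q φ r ^ n) := by
  have h1 := isProbabilityMeasure_seqLaw hq hq1
  induction n with
  | zero => simp [pos_zero]
  | succ n ih =>
    rw [lintegral_seqLaw hq hq1
      (measurable_comp_pos (fun x => ENNReal.ofReal (Real.exp (-(r * φ x)))) _)]
    have h2 : ∀ e, ∫⁻ s, ENNReal.ofReal (Real.exp (-(r * φ (pos (consSeq e s) (n + 1))))) ∂seqLaw q =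
        ENNReal.ofReal (Real.exp (-(r * φ (unitVec e)))) * ENNReal.ofReal (laplace q φ r ^ n) := by
      intro e
      rw [← ih, ← lintegral_const_mul _
        (measurable_comp_pos (fun x => ENNReal.ofReal (Real.exp (-(r * φ x)))) _)]
      refine lintegral_congr fun s => ?_
      rw [← ENNReal.ofReal_mul (Real.exp_pos _).le, ← Real.exp_add, pos_consSeq, map_add]
      congr 2; ring
    simp only [h2]
    rw [pow_succ', ENNReal.ofReal_mul (laplace_pos hq hq1 φ r).le, laplace,
      ENNReal.ofReal_sum_of_nonneg fun e _ => mul_nonneg (hq e).le (Real.exp_pos _).le,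
      Finset.sum_mul]
    refine Finset.sum_congr rfl fun e _ => ?_
    rw [ENNReal.ofReal_mul (hq e).le, mul_assoc]

theorem ae_summable_exp_neg_pos {q : Dir d → ℝ} (hq : ∀ e, 0 < q e) (hq1 : ∑ e, q e = 1)
    {φ : Site d →+ ℝ} (hφ : 0 < stepMean q φ) :
    ∀ᵐ s ∂seqLaw q, Summable fun n => Real.exp (-φ (pos s n)) := by
  obtain ⟨r, hr0, hr1, hρ⟩ := exists_laplace_lt_one hq hq1 hφ
  have hm : ∀ n, Measurable fun s : ℕ → Dir d => ENNReal.ofReal (Real.exp (-(r * φ (pos s n)))) :=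
    fun n => measurable_comp_pos (fun x => ENNReal.ofReal (Real.exp (-(r * φ x)))) n
  have h1 : ∫⁻ s, ∑' n, ENNReal.ofReal (Real.exp (-(r * φ (pos s n)))) ∂seqLaw q ≠ ⊤ := by
    rw [lintegral_tsum fun n => (hm n).aemeasurable]
    simp only [lintegral_exp_neg_pos hq hq1]
    rw [← ENNReal.ofReal_tsum_of_nonneg fun n => pow_nonneg (laplace_pos hq hq1 φ r).le n]
    · exact ENNReal.ofReal_ne_top
    · exact summable_geometric_of_lt_one (laplace_pos hq hq1 φ r).le hρ
  filter_upwards [ae_lt_top (Measurable.tsum hm) h1] with s hs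
  have h2 : Summable fun n => Real.exp (-(r * φ (pos s n))) := by
    have := ENNReal.summable_toReal hs.ne
    refine this.congr fun n => ?_
    rw [ENNReal.toReal_ofReal (Real.exp_pos _).le]
  -- Summability with exponent r forces φ(pos s n) > 0 eventually, and then r ≤ 1 gives exp(-φ) ≤
  -- exp(-rφ).
  refine h2.of_norm_bounded_eventually_nat ?_
  filter_upwards [h2.tendsto_atTop_zero.eventually_lt_const zero_lt_one] with n hn
  rw [Real.norm_of_nonneg (Real.exp_pos _).le, Real.exp_le_exp]
  rw [Real.exp_lt_one_iff] at hn
  have : 0 < φ (pos s n) := by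
    by_contra h
    nlinarith
  nlinarith

theorem stepProb_top {q : Dir d → ℝ} (hq1 : ∑ e, q e = 1) (x : Site d) (e : Dir d) :
    stepProb q ⊤ x e = q e := by
  have h : ∀ e, (⊤ : (latticeGraph d).Subgraph).Adj x (x + unitVec e) := fun e => ⟨e, rfl⟩
  simp [stepProb, h, hq1]

end StepSequences

/-! ### The first walk has independent steps. -/

section FirstWalk

variable {d : ℕ} [NeZero d] {Ω : Type*} {X : ℕ → ℕ → Ω → Site d}

instance nonempty_dir : Nonempty (Dir d) := ⟨dirOne d⟩

/-- The step sequence of the first walk. -/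
noncomputable def firstSteps (X : ℕ → ℕ → Ω → Site d) (ω : Ω) (n : ℕ) : Dir d :=
  Function.invFun unitVec (X 0 (n + 1) ω - X 0 n ω)

theorem pos_firstSteps {ω : Ω} (h0 : X 0 0 ω = 0)
    (h : ∀ n, (latticeGraph d).Adj (X 0 n ω) (X 0 (n + 1) ω)) (n : ℕ) :
    pos (firstSteps X ω) n = X 0 n ω := by
  induction n with
  | zero => rw [pos_zero, h0]
  | succ n ih =>
    obtain ⟨e, he⟩ := h n
    rw [pos_succ, ih, firstSteps, Function.invFun_eq ⟨e, (sub_eq_iff_eq_add'.2 he).symm⟩]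
    abel

theorem measurable_firstSteps_of_lt {n m : ℕ} (h : n < m) :
    Measurable[history X 0 m] fun ω => firstSteps X ω n := by
  let _ := history X 0 m
  have h1 : Measurable fun ω => X 0 (n + 1) ω - X 0 n ω :=
    (measurable_history_of_le (X := X) 0 h).sub (measurable_history_of_le (X := X) 0 h.le)
  exact (measurable_of_countable _).comp h1

theorem measurable_firstSteps {i : ℕ} (hi : 0 < i) :
    Measurable[history X i 0] (firstSteps X) := by
  let _ := history X i 0
  refine measurable_pi_lambda _ fun n => ?_
  have h1 : Measurable fun ω => X 0 (n + 1) ω - X 0 n ω :=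
    (measurable_history_of_lt (X := X) hi 0 _).sub (measurable_history_of_lt (X := X) hi 0 _)
  exact (measurable_of_countable _).comp h1

variable [mΩ : MeasurableSpace Ω] {μ : Measure Ω} [IsProbabilityMeasure μ] {p : ℕ → Dir d → ℝ}

theorem map_firstSteps (hpos : ∀ i e, 0 < p i e) (hp1 : ∀ i, ∑ e, p i e = 1)
    (hX : IsWalkSequence μ p X) : μ.map (firstSteps X) = seqLaw (p 0) := by
  have h0 := isProbabilityMeasure_stepLaw (hpos 0) (hp1 0)
  have hm : Measurable (firstSteps X) :=
    (measurable_firstSteps (X := X) Nat.zero_lt_one).mono (history_le hX 1 0) le_rfl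
  refine eq_infinitePi_of_forall_lt fun N t ht => ?_
  have hAm : ∀ N, MeasurableSet[history X 0 N] {ω | ∀ k < N, firstSteps X ω k ∈ t k} := by
    intro N
    have : {ω | ∀ k < N, firstSteps X ω k ∈ t k} =
        ⋂ k, ⋂ (_ : k < N), {ω | firstSteps X ω k ∈ t k} := by
      ext s; simp
    rw [this]
    exact @MeasurableSet.iInter Ω ℕ (history X 0 N) _ _ fun k =>
      @MeasurableSet.iInter Ω _ (history X 0 N) _ _ fun hk => measurable_firstSteps_of_lt hk (ht k)
  have hpre : ∀ N, firstSteps X ⁻¹' {s | ∀ k < N, s k ∈ t k} =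
      {ω | ∀ k < N, firstSteps X ω k ∈ t k} := fun N => rfl
  rw [Measure.map_apply hm (measurableSet_forall_lt N ht), hpre]
  induction N with
  | zero => simp
  | succ N ih =>
    rw [Finset.prod_range_succ, ← ih]
    set A := {ω | ∀ k < N, firstSteps X ω k ∈ t k} with hA
    have hle := history_le hX 0 N
    have hstep : ∀ e, μ (A ∩ {ω | firstSteps X ω N = e}) = μ A * ENNReal.ofReal (p 0 e) := by
      intro e
      have hE := measurableSet_step hX 0 N e
      have h1 : (A ∩ {ω | firstSteps X ω N = e} : Set Ω) =ᵐ[μ]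
          (A ∩ {ω | X 0 (N + 1) ω = X 0 N ω + unitVec e} : Set Ω) := by
        filter_upwards [ae_walk hpos hX (NeZero.pos d) 0] with ω hω
        refine propext (and_congr_right fun _ => ?_)
        obtain ⟨e', he'⟩ := hω.2 N
        have h2 : firstSteps X ω N = e' := by
          rw [firstSteps, sub_eq_iff_eq_add'.2 he']
          exact Function.leftInverse_invFun unitVec_injective e'
        change firstSteps X ω N = e ↔ X 0 (N + 1) ω = X 0 N ω + unitVec e
        rw [h2, he', add_right_inj, unitVec_injective.eq_iff]
      rw [measure_congr h1]
      have hint : Integrable (Set.indicator {ω | X 0 (N + 1) ω = X 0 N ω + unitVec e}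
        fun _ => (1 : ℝ)) μ := (integrable_const 1).indicator hE
      have h3 := setIntegral_condExp hle hint (hAm N)
      rw [setIntegral_indicator hE] at h3
      have h4 : ∫ ω in A, (μ[Set.indicator {ω | X 0 (N + 1) ω = X 0 N ω + unitVec e}
          (fun _ => (1 : ℝ)) | history X 0 N]) ω ∂μ = ∫ ω in A, p 0 e ∂μ := by
        refine integral_congr_ae (ae_restrict_of_ae ?_)
        filter_upwards [hX.step 0 N e] with ω hω
        rw [hω]
        exact stepProb_top (hp1 0) _ _
      rw [h4] at h3
      simp only [integral_const, smul_eq_mul, mul_one, measureReal_restrict_apply_univ] at h3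
      rw [← ENNReal.ofReal_toReal (measure_ne_top μ (A ∩ _)), ← measureReal_def, ← h3,
        ENNReal.ofReal_mul measureReal_nonneg, measureReal_def,
        ENNReal.ofReal_toReal (measure_ne_top μ _)]
    have h5 : {ω | ∀ k < N + 1, firstSteps X ω k ∈ t k} =
        ⋃ e ∈ (Set.toFinite (t N)).toFinset, A ∩ {ω | firstSteps X ω N = e} := by
      ext ω
      simp only [Set.mem_ofPred_eq, Set.mem_iUnion, Set.Finite.mem_toFinset, hA, Set.mem_inter_iff,
        exists_prop]
      constructor
      · intro h
        exact ⟨_, h N (Nat.lt_succ_self N), fun k hk => h k (by omega), rfl⟩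
      · rintro ⟨e, he, h1, h2⟩ k hk
        rcases Nat.lt_succ_iff_lt_or_eq.1 hk with hk | rfl
        · exact h1 k hk
        · rwa [h2]
    rw [h5, measure_biUnion_finset]
    · simp only [hstep]
      rw [← Finset.mul_sum, stepLaw_apply]
      congr 1
      rw [← Finset.sum_subset (Finset.subset_univ (Set.toFinite (t N)).toFinset)]
      · refine Finset.sum_congr rfl fun e he => ?_
        rw [Set.indicator_of_mem ((Set.Finite.mem_toFinset _).1 he), Pi.one_apply, mul_one]
      · intro e _ he
        rw [Set.indicator_of_notMem fun h => he ((Set.Finite.mem_toFinset _).2 h), mul_zero]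
    · intro e _ e' _ hee
      exact Set.disjoint_left.2 fun ω h1 h2 => hee (h1.2.symm.trans h2.2)
    · intro e _
      exact (hle _ (hAm N)).inter
        ((measurable_pi_apply N).comp hm (measurableSet_singleton e))

end FirstWalk

/-! ### A common infinite simple path, and edges missed by the walks. -/

section SimplePath

variable {d : ℕ}

/-- The sites all of whose coordinates are at most `k` in absolute value. -/
def box (d k : ℕ) : Set (Site d) := Set.univ.pi fun _ => Set.Icc (-(k : ℤ)) k

theorem finite_box (k : ℕ) : (box d k).Finite := Set.Finite.pi fun _ => Set.finite_Icc _ _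

theorem add_unitVec_mem_box {k : ℕ} {x : Site d} (hx : x ∈ box d k) (e : Dir d) :
    x + unitVec e ∈ box d (k + 1) := by
  obtain ⟨j, s⟩ := e
  intro l _
  have h1 := hx l trivial
  simp only [Set.mem_Icc, Pi.add_apply, unitVec, Nat.cast_add, Nat.cast_one] at h1 ⊢
  by_cases hl : l = j
  · subst hl
    rcases Int.units_eq_one_or s with rfl | rfl <;> simp <;> omega
  · simp [hl]; omega

theorem box_subset_succ (k : ℕ) : box d k ⊆ box d (k + 1) := by
  intro x hx l _
  have h1 := hx l trivial
  simp only [Set.mem_Icc, Nat.cast_add, Nat.cast_one] at h1 ⊢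
  omega

/-- An infinite range leaves every box, and a simple path from 0 to a site outside `box d n` has at
least n edges. -/
theorem exists_injOn_path {Z : (latticeGraph d).Subgraph} {w : ℕ → Site d} (h0 : w 0 = 0)
    (hw : ∀ n, Z.Adj (w n) (w (n + 1))) (hinf : (Set.range w).Infinite) (n : ℕ) :
    ∃ f : ℕ → Site d, f 0 = 0 ∧ (∀ k, f k ∈ box d k) ∧ Set.InjOn f {k | k ≤ n} ∧
      ∀ k < n, Z.Adj (f k) (f (k + 1)) := by
  obtain ⟨_, ⟨m, rfl⟩, hm⟩ := hinf.exists_notMem_finite (finite_box (d := d) n)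
  have hreach : ∀ m, Z.spanningCoe.Reachable 0 (w m) := by
    intro m
    induction m with
    | zero => rw [h0]
    | succ m ih =>
      have : Z.spanningCoe.Adj (w m) (w (m + 1)) := hw m
      exact ih.trans this.reachable
  obtain ⟨P, hP⟩ := (hreach m).exists_isPath
  have hbox : ∀ k, P.getVert k ∈ box d k := by
    intro k
    induction k with
    | zero => rw [P.getVert_zero]; intro j _; simp
    | succ k ih =>
      by_cases hk : k < P.length
      · obtain ⟨e, he⟩ := Z.adj_sub (P.adj_getVert_succ hk)
        rw [he]
        exact add_unitVec_mem_box ih e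
      · rw [P.getVert_of_length_le (by omega : P.length ≤ k + 1),
          ← P.getVert_of_length_le (not_lt.1 hk)]
        exact box_subset_succ k ih
  have hlen : n ≤ P.length := by
    by_contra h
    refine hm ?_
    rw [← P.getVert_of_length_le (not_le.1 h).le]
    exact hbox n
  exact ⟨P.getVert, P.getVert_zero, hbox,
    hP.getVert_injOn.mono fun k hk => le_trans hk hlen,
    fun k hk => P.adj_getVert_succ (lt_of_lt_of_le hk hlen)⟩

/-- A decreasing sequence of connected infinite subgraphs of the lattice has a common infinite
simple path. -/
theorem exists_injective_path {Z : ℕ → (latticeGraph d).Subgraph} (hZ : Antitone Z)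
    {w : ℕ → ℕ → Site d} (h0 : ∀ i, w i 0 = 0) (hw : ∀ i n, (Z i).Adj (w i n) (w i (n + 1)))
    (hinf : ∀ i, (Set.range (w i)).Infinite) :
    ∃ γ : ℕ → Site d, γ 0 = 0 ∧ Function.Injective γ ∧ ∀ i k, (Z i).Adj (γ k) (γ (k + 1)) := by
  choose f hf0 hfbox hfinj hfadj using fun i => exists_injOn_path (h0 i) (hw i) (hinf i) i
  -- The k-th vertices lie in a finite box that does not depend on i, so a subsequence of paths
  -- converges coordinatewise; in a discrete space each coordinate is eventually constant.
  obtain ⟨γ, -, φ, hφ, hlim⟩ := (isCompact_univ_pi fun k =>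
    (finite_box (d := d) k).isCompact).tendsto_subseq fun i k _ => hfbox i k
  rw [tendsto_pi_nhds] at hlim
  have hev : ∀ k, ∀ᶠ i in Filter.atTop, f (φ i) k = γ k := by
    intro k
    have := hlim k
    rw [nhds_discrete, Filter.tendsto_pure] at this
    exact this
  refine ⟨γ, ?_, fun k l hkl => ?_, fun i k => ?_⟩
  · obtain ⟨i, hi⟩ := (hev 0).exists
    rw [← hi, hf0]
  · obtain ⟨i, hi1, hi2, hi3⟩ :=
      ((hev k).and ((hev l).and (Filter.eventually_ge_atTop (max k l)))).exists
    have h := hi3.trans (hφ.id_le i)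
    exact hfinj (φ i) ((le_max_left k l).trans h) ((le_max_right k l).trans h)
      (by rw [hi1, hi2, hkl])
  · obtain ⟨m, hm1, hm2, hm3⟩ :=
      ((hev k).and ((hev (k + 1)).and (Filter.eventually_ge_atTop (max i (k + 1))))).exists
    have h := hm3.trans (hφ.id_le m)
    rw [← hm1, ← hm2]
    exact (hZ ((le_max_left i (k + 1)).trans h)).2
      (hfadj (φ m) k (lt_of_lt_of_le (Nat.lt_succ_self k) ((le_max_right _ _).trans h)))

/-- The function `height q` as a homomorphism. -/
noncomputable def heightHom (q : Dir d → ℝ) : Site d →+ ℝ where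
  toFun := height q
  map_zero' := height_zero q
  map_add' := height_add q

theorem sum_dir {β : Type*} [AddCommMonoid β] (f : Dir d → β) :
    ∑ e, f e = ∑ j, (f (j, 1) + f (j, -1)) := by
  rw [Fintype.sum_prod_type]
  refine Finset.sum_congr rfl fun j _ => ?_
  rw [Fintype.sum_eq_add (1 : ℤˣ) (-1) (by decide)]
  intro s hs
  rcases Int.units_eq_one_or s with h | h
  · exact absurd h hs.1
  · exact absurd h hs.2

theorem stepMean_heightHom (p₀ q : Dir d → ℝ) :
    stepMean p₀ (heightHom q) = ‖logBias q‖ * inner ℝ (drift p₀) (ell q) := by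
  rw [norm_logBias_mul_inner, stepMean, sum_dir]
  refine Finset.sum_congr rfl fun j _ => ?_
  simp only [heightHom, AddMonoidHom.coe_mk, ZeroHom.coe_mk, height_unitVec, drift]
  simp
  ring

theorem stepMean_heightHom_pos {p₀ q : Dir d → ℝ} (h : 0 < inner ℝ (drift p₀) (ell q)) :
    0 < stepMean p₀ (heightHom q) := by
  rw [stepMean_heightHom]
  refine mul_pos (norm_pos_iff.2 fun h0 => ?_) h
  simp [ell, h0] at h

variable {Ω : Type*} {X : ℕ → ℕ → Ω → Site d}

theorem exists_adj_of_mem_verts (hd : 0 < d) {ω : Ω}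
    (hw : ∀ i n, (graph X i ω).Adj (X i n ω) (X i (n + 1) ω)) (i : ℕ) :
    ∀ x ∈ (graph X i ω).verts, ∃ y, (graph X i ω).Adj x y := by
  rcases i with _ | i
  · exact fun x _ => ⟨x + unitVec (⟨0, hd⟩, 1), _, rfl⟩
  · rintro _ ⟨n, rfl⟩
    exact ⟨X i (n + 1) ω, (graph X i ω).adj_sub (hw i n), n, rfl⟩

theorem measurableSet_not_cross (i : ℕ) (a b : Site d) :
    MeasurableSet[history X (i + 1) 0] {ω | ∀ k, s(X i k ω, X i (k + 1) ω) ≠ s(a, b)} := by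
  have h1 : {ω | ∀ k, s(X i k ω, X i (k + 1) ω) ≠ s(a, b)} = ⋂ k,
      ((X i k ⁻¹' {a} ∩ X i (k + 1) ⁻¹' {b}) ∪ (X i k ⁻¹' {b} ∩ X i (k + 1) ⁻¹' {a}))ᶜ := by
    ext ω; simp
  have hm : ∀ k z, MeasurableSet[history X (i + 1) 0] (X i k ⁻¹' {z}) := fun n z =>
    measurable_history_of_lt (X := X) (Nat.lt_succ_self i) 0 n (measurableSet_singleton z)
  rw [h1]
  let _ := history X (i + 1) 0
  exact MeasurableSet.iInter fun k =>
    (((hm k a).inter (hm (k + 1) b)).union ((hm k b).inter (hm (k + 1) a))).compl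

variable [mΩ : MeasurableSpace Ω] {μ : Measure Ω} [IsProbabilityMeasure μ] {p : ℕ → Dir d → ℝ}

/-- Given the past, a walk avoids the edge `{a, b}` with a probability that is bounded below, if
there is an infinite path that avoids this edge and has a small resistance from some point on. -/
theorem ae_le_condExp_not_cross (hpos : ∀ i e, 0 < p i e) (hp1 : ∀ i, ∑ e, p i e = 1)
    (hX : IsWalkSequence μ p X) (hd : 0 < d) (i : ℕ) (a b : Site d) (n : ℕ) (γ : ℕ → Site d)
    (hγ0 : γ 0 = 0) (hγe : ∀ k < n, s(γ k, γ (k + 1)) ≠ s(a, b)) (hγa : γ n ≠ a) (hγb : γ n ≠ b)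
    {ε : ℝ} (hε : 0 ≤ ε) (hεp : ∀ e, ε ≤ p i e) :
    ∀ᵐ ω ∂μ, (∀ k < n, (graph X i ω).Adj (γ k) (γ (k + 1))) →
      (∃ w : ℕ → Site d, w 0 = γ n ∧ Function.Injective w ∧
        (∀ k, (graph X i ω).Adj (w k) (w (k + 1))) ∧
        ∀ N, (∑ k ∈ Finset.range N, (conductance (p i) (w k) (w (k + 1)))⁻¹) *
          (2 * ∑ x ∈ {a, b}, Real.exp (height (p i) x)) ≤ 1 / 4) →
      ε ^ n * (1 / 2) ≤
        (μ[Set.indicator {ω | ∀ k, s(X i k ω, X i (k + 1) ω) ≠ s(a, b)}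
          (fun _ => (1 : ℝ)) | history X i 0]) ω := by
  set B : Finset (Site d) := {a, b} with hB
  -- The favourable event: follow γ for n steps, then avoid both ends of the edge for ever.
  set S : ℕ → Set (Site d) := fun k => if k ≤ n then {γ k} else (B : Set (Site d))ᶜ with hS
  set E : ℕ → Set Ω := fun t => {ω | ∀ k ≤ n + t, X i (0 + k) ω ∈ S k} with hE
  have hEm : ∀ t, MeasurableSet (E t) := fun t => measurableSet_stay hX i 0 (n + t) S
  have hanti : Antitone E := fun t t' h ω hω k hk => hω k (hk.trans (by omega))
  have hle := history_le hX i 0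
  have hsub : (⋂ t, E t) ⊆ {ω | ∀ k, s(X i k ω, X i (k + 1) ω) ≠ s(a, b)} := by
    intro ω hω k
    rw [Set.mem_iInter] at hω
    have hk : ∀ k, X i k ω ∈ S k := fun k => by
      have := hω k k (by omega)
      rwa [zero_add] at this
    rcases lt_or_ge k n with hkn | hkn
    · have h1 := hk k
      have h2 := hk (k + 1)
      simp only [hS, hkn.le, Nat.succ_le_of_lt hkn, if_true, Set.mem_singleton_iff] at h1 h2
      rw [h1, h2]
      exact hγe k hkn
    · have h1 : X i k ω ≠ a ∧ X i k ω ≠ b := by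
        have h1 := hk k
        rcases hkn.eq_or_lt with rfl | hkn
        · simp only [hS, le_refl, if_true, Set.mem_singleton_iff] at h1
          rw [h1]
          exact ⟨hγa, hγb⟩
        · simp only [hS, not_le.2 hkn, if_false, hB] at h1
          simpa using h1
      intro h
      rcases Sym2.eq_iff.1 h with ⟨h, -⟩ | ⟨h, -⟩
      · exact h1.1 h
      · exact h1.2 h
  have hmono : μ[(⋂ t, E t).indicator (fun _ => (1 : ℝ)) | history X i 0] ≤ᵐ[μ]
      μ[Set.indicator {ω | ∀ k, s(X i k ω, X i (k + 1) ω) ≠ s(a, b)}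
          (fun _ => (1 : ℝ)) | history X i 0] := by
    refine condExp_mono ((integrable_const 1).indicator (MeasurableSet.iInter hEm))
      ((integrable_const 1).indicator (history_le hX (i + 1) 0 _ (measurableSet_not_cross i a b)))
      (Filter.Eventually.of_forall fun ω => ?_)
    exact Set.indicator_le_indicator_of_subset hsub (fun _ => zero_le_one) ω
  filter_upwards [hmono, ae_le_condExp_iInter hle hEm hanti (ε ^ n * (1 / 2)),
    ae_all_iff.2 fun t => condExp_stay hpos hX hd i 0 (n + t) S,
    ae_all_iff.2 fun i => ae_walk hpos hX hd i] with ω h1 h2 h3 hw hadj hpath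
  obtain ⟨w, hw0, hwinj, hwadj, hwN⟩ := hpath
  refine (h2 fun t => ?_).trans h1
  rw [h3 t, (hw i).1, ← hγ0]
  have hγB : γ n ∉ (B : Set (Site d)) := by simp [hB, hγa, hγb]
  refine le_trans ?_ (pow_mul_le_stayProb (hpos i) (hp1 i) hε hεp (graph X i ω) B n t γ hadj hγB)
  refine mul_le_mul_of_nonneg_left ?_ (pow_nonneg hε n)
  refine le_trans ?_ (one_sub_hitProb_le_stayProb (hpos i) _
    (exists_adj_of_mem_verts hd (fun i => (hw i).2) i) B t (γ n)
    (hw0 ▸ (graph X i ω).edge_vert (hwadj 0)))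
  set σ := 2 * ∑ x ∈ B, Real.exp (height (p i) x) with hσ
  have hσ0 : 0 < σ := by
    refine mul_pos two_pos (Finset.sum_pos (fun _ _ => Real.exp_pos _) ⟨a, by simp [hB]⟩)
  -- With this resistance the squared hitting probability is at most 1/4, so B is avoided with
  -- probability at least 1/2.
  have h4 := hitProb_univ_sq_le (hpos i) (hp1 i) (graph X i ω) B w hwinj hwadj (1 / 4 / σ)
    (fun N => (le_div_iff₀ hσ0).2 (hwN N)) t
  rw [← hσ, div_mul_cancel₀ _ hσ0.ne', hw0] at h4
  have h5 := (hitProb_mem_Icc (hpos i) (graph X i ω) B Set.univ t (γ n)).1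
  nlinarith

/-- An edge is almost surely not crossed by all walks, if infinitely many walks avoid it with a
conditional probability that is bounded below. -/
theorem ae_exists_not_cross (hX : IsWalkSequence μ p X) (a b : Site d) (I : Set ℕ)
    {ε : ℝ} (hε : 0 < ε) :
    ∀ᵐ ω ∂μ, (∃ᶠ i in Filter.atTop, i ∈ I ∧ ε ≤
      (μ[Set.indicator {ω | ∀ k, s(X i k ω, X i (k + 1) ω) ≠ s(a, b)}
          (fun _ => (1 : ℝ)) | history X i 0]) ω) →
      ∃ i, ∀ k, s(X i k ω, X i (k + 1) ω) ≠ s(a, b) := by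
  classical
  let ℱ : Filtration ℕ mΩ := ⟨fun i => history X i 0, history_zero_mono, fun i => history_le hX i 0⟩
  -- Shifted by one, since an event about the whole walk i is known only at the history of walk i +
  -- 1.
  set s : ℕ → Set Ω := fun
    | 0 => ∅
    | i + 1 => {ω | ∀ k, s(X i k ω, X i (k + 1) ω) ≠ s(a, b)} with hs
  have hsm : ∀ i, MeasurableSet[ℱ i] (s i) := by
    rintro (_ | i)
    · exact @MeasurableSet.empty Ω (ℱ 0)
    · exact measurableSet_not_cross i a b
  have hnonneg : ∀ i, 0 ≤ᵐ[μ] μ[(s (i + 1)).indicator (1 : Ω → ℝ) | ℱ i] := fun i =>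
    condExp_nonneg (Filter.Eventually.of_forall fun ω =>
      Set.indicator_nonneg (fun _ _ => zero_le_one) ω)
  filter_upwards [ae_mem_limsup_atTop_iff μ hsm, ae_all_iff.2 hnonneg] with ω h1 h2 hfreq
  have h3 : ω ∈ Filter.limsup s Filter.atTop := by
    rw [h1]
    exact tendsto_sum_atTop_of_frequently_le h2 hε (hfreq.mono fun i hi => hi.2)
  rw [Filter.mem_limsup_iff_frequently_mem] at h3
  obtain ⟨i, hi⟩ := h3.exists
  rcases i with _ | i
  · exact absurd hi (Set.notMem_empty ω)
  · exact ⟨i, hi⟩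

end SimplePath

/-! ### Recurring step laws: the limit is a simple path. -/

section LimitIsPath

variable {d : ℕ}

theorem inv_conductance_le {q : Dir d → ℝ} (hq : ∀ e, 0 < q e) {ε : ℝ} (hε : 0 < ε)
    (hεq : ∀ e, ε ≤ q e) {x y : Site d} (h : (latticeGraph d).Adj x y) :
    (conductance q x y)⁻¹ ≤ Real.exp (-height q x) / ε := by
  obtain ⟨e, rfl⟩ := h
  rw [conductance_add_unitVec q hq, mul_inv, ← Real.exp_neg, div_eq_mul_inv]
  exact mul_le_mul_of_nonneg_left (inv_anti₀ hε (hεq e)) (Real.exp_pos _).le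

theorem exists_pos_le {q : Dir d → ℝ} (hq : ∀ e, 0 < q e) : ∃ ε > 0, ∀ e, ε ≤ q e := by
  rcases isEmpty_or_nonempty (Dir d) with h | h
  · exact ⟨1, one_pos, fun e => h.elim e⟩
  · obtain ⟨e, he⟩ := Finite.exists_min q
    exact ⟨q e, hq e, he⟩

/-- Far out, an injective path in the trace of `u` has a small resistance. -/
theorem exists_forall_resistance_le {q : Dir d → ℝ} (hq : ∀ e, 0 < q e) {u γ : ℕ → Site d}
    (hu : ∀ n, (latticeGraph d).Adj (u n) (u (n + 1)))
    (hsum : Summable fun n => Real.exp (-height q (u n)))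
    (hγ : Function.Injective γ) (hγu : ∀ k, (trace u).Adj (γ k) (γ (k + 1))) {η : ℝ} (hη : 0 < η)
    (B : Finset (Site d)) :
    ∃ n, γ n ∉ B ∧ ∀ N, ∑ k ∈ Finset.range N,
      (conductance q (γ (n + k)) (γ (n + k + 1)))⁻¹ ≤ η := by
  classical
  obtain ⟨ε, hε, hεq⟩ := exists_pos_le hq
  have hsum' : Summable fun n => Real.exp (-height q (u n)) / ε := hsum.div_const ε
  -- Times outside the finite set T contribute at most η in total. The k-th edge of γ is crossed by
  -- u at a time m k. These times are distinct because the edges of γ are, and far out they avoid T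
  -- because γ has left the sites that u visits at times in T.
  obtain ⟨T, hT⟩ := summable_iff_vanishing_norm.1 hsum' η hη
  choose m hm using fun k => (hγu k).2
  have hfin : ∀ᶠ n in Filter.atTop, γ n ∉ T.image u ∪ B := by
    have := hγ.tendsto_cofinite.eventually ((T.image u ∪ B).finite_toSet.compl_mem_cofinite)
    rwa [Nat.cofinite_eq_atTop] at this
  obtain ⟨n, hn⟩ := Filter.eventually_atTop.1 hfin
  refine ⟨n, fun h => hn n le_rfl (Finset.mem_union_right _ h), fun N => ?_⟩
  have hmT : ∀ k, m (n + k) ∉ T := by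
    intro k hk
    have h1 : u (m (n + k)) ∈ T.image u := Finset.mem_image_of_mem _ hk
    rcases Sym2.eq_iff.1 (hm (n + k)) with ⟨h, -⟩ | ⟨h, -⟩
    · exact hn (n + k) (by omega) (Finset.mem_union_left _ (h ▸ h1))
    · exact hn (n + k + 1) (by omega) (Finset.mem_union_left _ (h ▸ h1))
  have hinj : Function.Injective fun k => m (n + k) := by
    intro k l hkl
    have h1 : s(γ (n + k), γ (n + k + 1)) = s(γ (n + l), γ (n + l + 1)) := by
      rw [← hm, ← hm]
      simp only at hkl
      rw [hkl]
    rcases Sym2.eq_iff.1 h1 with ⟨h, -⟩ | ⟨h, h'⟩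
    · have := hγ h; omega
    · have := hγ h; have := hγ h'; omega
  calc ∑ k ∈ Finset.range N, (conductance q (γ (n + k)) (γ (n + k + 1)))⁻¹
      ≤ ∑ k ∈ Finset.range N, Real.exp (-height q (u (m (n + k)))) / ε := by
        refine Finset.sum_le_sum fun k _ => ?_
        have h2 := inv_conductance_le hq hε hεq (hu (m (n + k)))
        rcases Sym2.eq_iff.1 (hm (n + k)) with ⟨h, h'⟩ | ⟨h, h'⟩
        · rwa [← h, ← h']
        · rwa [← h, ← h', conductance_comm]
    _ = ∑ l ∈ (Finset.range N).image fun k => m (n + k), Real.exp (-height q (u l)) / ε :=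
        (Finset.sum_image (f := fun l => Real.exp (-height q (u l)) / ε) hinj.injOn).symm
    _ ≤ η := by
        refine (le_abs_self _).trans (hT _ ?_).le
        rw [Finset.disjoint_left]
        intro l hl
        obtain ⟨k, -, rfl⟩ := Finset.mem_image.1 hl
        exact hmT k

/-- Pigeonhole over the finitely many directions: one edge at x lies in infinitely many, hence in
all, of the decreasing graphs. So the limit has no isolated vertex, and its edges determine it. -/
theorem exists_adj_iInf {Z : ℕ → (latticeGraph d).Subgraph} (hZ : Antitone Z)
    (hv : ∀ i, ∀ x ∈ (Z i).verts, ∃ y, (Z i).Adj x y) {x : Site d} (hx : ∀ i, x ∈ (Z i).verts) :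
    ∃ y, (⨅ i, Z i).Adj x y := by
  choose y hy using fun i => hv i x (hx i)
  choose e he using fun i => (Z i).adj_sub (hy i)
  obtain ⟨e₀, h⟩ := Finite.exists_infinite_fiber e
  rw [Set.infinite_coe_iff] at h
  refine ⟨x + unitVec e₀, SimpleGraph.Subgraph.iInf_adj.2 ⟨fun i => ?_, e₀, rfl⟩⟩
  obtain ⟨j, hj, hij⟩ := h.exists_gt i
  have : e j = e₀ := hj
  have h1 := hy j
  rw [he j, this] at h1
  exact (hZ hij.le).2 h1

variable {Ω : Type*} {X : ℕ → ℕ → Ω → Site d} [mΩ : MeasurableSpace Ω] {μ : Measure Ω}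
  [IsProbabilityMeasure μ] {p : ℕ → Dir d → ℝ}

theorem ae_summable_exp_neg_height [NeZero d] (hpos : ∀ i e, 0 < p i e)
    (hp1 : ∀ i, ∑ e, p i e = 1) (hX : IsWalkSequence μ p X) {q : Dir d → ℝ}
    (hδ : 0 < inner ℝ (drift (p 0)) (ell q)) :
    ∀ᵐ ω ∂μ, Summable fun n => Real.exp (-height q (X 0 n ω)) := by
  have h1 := ae_summable_exp_neg_pos (hpos 0) (hp1 0) (stepMean_heightHom_pos hδ)
  have hm : Measurable (firstSteps X) :=
    (measurable_firstSteps (X := X) Nat.zero_lt_one).mono (history_le hX 1 0) le_rfl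
  rw [← map_firstSteps hpos hp1 hX] at h1
  filter_upwards [ae_of_ae_map hm.aemeasurable h1, ae_walk hpos hX (NeZero.pos d) 0] with ω h2 h3
  refine h2.congr fun n => ?_
  rw [pos_firstSteps h3.1 fun n => (graph X 0 ω).adj_sub (h3.2 n)]
  rfl

theorem ae_isSimplePathFrom_limitGraph [NeZero d] (hpos : ∀ i e, 0 < p i e)
    (hp1 : ∀ i, ∑ e, p i e = 1) (hX : IsWalkSequence μ p X) (q : Dir d → ℝ)
    (hq : {i | p i = q}.Infinite) (hδ : 0 < inner ℝ (drift (p 0)) (ell q)) :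
    ∀ᵐ ω ∂μ, IsSimplePathFrom (limitGraph X ω) 0 := by
  have hd := NeZero.pos d
  obtain ⟨i₀, hi₀⟩ := hq.nonempty
  have hi₀ : p i₀ = q := hi₀
  have hqpos : ∀ e, 0 < q e := hi₀ ▸ hpos i₀
  obtain ⟨ε, hε, hεq⟩ := exists_pos_le hqpos
  -- The path γ is random, so the exceptional null set must be fixed before it. Only its initial
  -- segment enters the event, and finite lists (read with default value 0) are countable in number.
  have hA : ∀ᵐ ω ∂μ, ∀ (i : ℕ) (a b : Site d) (n : ℕ) (l : List (Site d)),
      p i = q → l.getD 0 0 = 0 → (∀ k < n, s(l.getD k 0, l.getD (k + 1) 0) ≠ s(a, b)) →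
      l.getD n 0 ≠ a → l.getD n 0 ≠ b →
      (∀ k < n, (graph X i ω).Adj (l.getD k 0) (l.getD (k + 1) 0)) →
      (∃ w : ℕ → Site d, w 0 = l.getD n 0 ∧ Function.Injective w ∧
        (∀ k, (graph X i ω).Adj (w k) (w (k + 1))) ∧
        ∀ N, (∑ k ∈ Finset.range N, (conductance (p i) (w k) (w (k + 1)))⁻¹) *
          (2 * ∑ x ∈ {a, b}, Real.exp (height (p i) x)) ≤ 1 / 4) →
      ε ^ n * (1 / 2) ≤
        (μ[Set.indicator {ω | ∀ k, s(X i k ω, X i (k + 1) ω) ≠ s(a, b)}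
          (fun _ => (1 : ℝ)) | history X i 0]) ω := by
    refine ae_all_iff.2 fun i => ae_all_iff.2 fun a => ae_all_iff.2 fun b => ae_all_iff.2 fun n =>
      ae_all_iff.2 fun l => ?_
    simp only [Filter.eventually_imp_distrib_left]
    intro h1 h2 h3 h4 h5
    exact ae_le_condExp_not_cross hpos hp1 hX hd i a b n (fun k => l.getD k 0) h2 h3 h4 h5 hε.le
      (h1 ▸ hεq)
  have hB : ∀ᵐ ω ∂μ, ∀ (a b : Site d) (n : ℕ),
      (∃ᶠ i in Filter.atTop, i ∈ {i | p i = q} ∧ ε ^ n * (1 / 2) ≤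
      (μ[Set.indicator {ω | ∀ k, s(X i k ω, X i (k + 1) ω) ≠ s(a, b)}
          (fun _ => (1 : ℝ)) | history X i 0]) ω) →
      ∃ i, ∀ k, s(X i k ω, X i (k + 1) ω) ≠ s(a, b) :=
    ae_all_iff.2 fun a => ae_all_iff.2 fun b => ae_all_iff.2 fun n =>
      ae_exists_not_cross hX a b _ (mul_pos (pow_pos hε n) one_half_pos)
  filter_upwards [hA, hB, ae_regular hpos hp1 hX hd, ae_summable_exp_neg_height hpos hp1 hX hδ]
    with ω hA hB hreg hsum
  obtain ⟨h0, hw, hinf⟩ := hreg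
  have hanti := graph_antitone hw
  obtain ⟨γ, hγ0, hγinj, hγ⟩ := exists_injective_path hanti h0 hw hinf
  have hγadj : ∀ k, (latticeGraph d).Adj (γ k) (γ (k + 1)) := fun k => (graph X 0 ω).adj_sub (hγ 0 k)
  have hlim : ∀ x y, (limitGraph X ω).Adj x y ↔ ∀ i, (graph X i ω).Adj x y := fun x y =>
    SimpleGraph.Subgraph.iInf_adj_of_nonempty
  have key : ∀ a b, (limitGraph X ω).Adj a b → ∃ n, s(γ n, γ (n + 1)) = s(a, b) := by
    intro a b hab
    by_contra! hne
    have hσ0 : 0 < 2 * ∑ x ∈ {a, b}, Real.exp (height q x) :=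
      mul_pos two_pos (Finset.sum_pos (fun _ _ => Real.exp_pos _) ⟨a, by simp⟩)
    obtain ⟨n, hnB, hn⟩ := exists_forall_resistance_le hqpos
      (fun n => (graph X 0 ω).adj_sub (hw 0 n)) hsum hγinj (hγ 1)
      (η := 1 / 4 / (2 * ∑ x ∈ {a, b}, Real.exp (height q x))) (div_pos (by norm_num) hσ0) {a, b}
    simp only [Finset.mem_insert, Finset.mem_singleton, not_or] at hnB
    set l : List (Site d) := (List.range (n + 1)).map γ with hl
    have hlk : ∀ k ≤ n, l.getD k 0 = γ k := by
      intro k hk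
      rw [List.getD_eq_getElem _ _ (by simp [hl]; omega)]
      simp [hl]
    have hge : ∀ i, p i = q → ε ^ n * (1 / 2) ≤
        (μ[Set.indicator {ω | ∀ k, s(X i k ω, X i (k + 1) ω) ≠ s(a, b)}
          (fun _ => (1 : ℝ)) | history X i 0]) ω := by
      intro i hi
      refine hA i a b n l hi ?_ ?_ ?_ ?_ ?_ ⟨fun k => γ (n + k), ?_, ?_, fun k => hγ i _, fun N => ?_⟩
      · rw [hlk 0 (Nat.zero_le n), hγ0]
      · intro k hk
        rw [hlk k hk.le, hlk (k + 1) hk]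
        exact hne k
      · rw [hlk n le_rfl]; exact hnB.1
      · rw [hlk n le_rfl]; exact hnB.2
      · intro k hk
        rw [hlk k hk.le, hlk (k + 1) hk]
        exact hγ i k
      · rw [hlk n le_rfl]; rfl
      · exact fun k l h => by have := hγinj h; omega
      · rw [hi]
        exact (le_div_iff₀ hσ0).1 (hn N)
    obtain ⟨i, hi⟩ := hB a b n
      ((Nat.frequently_atTop_iff_infinite.2 hq).mono fun i hi => ⟨hi, hge i hi⟩)
    obtain ⟨-, k, hk⟩ := (hlim a b).1 hab (i + 1)
    exact hi k hk
  refine ⟨γ, hγ0, hγadj, hγinj, SimpleGraph.Subgraph.ext ?_ ?_⟩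
  · ext x
    constructor
    · intro hx
      rw [limitGraph, SimpleGraph.Subgraph.verts_iInf, Set.mem_iInter] at hx
      obtain ⟨y, hy⟩ := exists_adj_iInf hanti (exists_adj_of_mem_verts hd hw) hx
      obtain ⟨n, hn⟩ := key x y hy
      rcases Sym2.eq_iff.1 hn with ⟨h, -⟩ | ⟨-, h⟩
      · exact ⟨n, h⟩
      · exact ⟨n + 1, h⟩
    · rintro ⟨n, rfl⟩
      exact (limitGraph X ω).edge_vert ((hlim _ _).2 fun i => hγ i n)
  · ext x y
    constructor
    · intro h
      exact ⟨(limitGraph X ω).adj_sub h, key x y h⟩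
    · rintro ⟨-, n, hn⟩
      rcases Sym2.eq_iff.1 hn with ⟨h1, h2⟩ | ⟨h1, h2⟩
      · rw [← h1, ← h2]
        exact (hlim _ _).2 fun i => hγ i n
      · rw [← h1, ← h2]
        exact ((hlim _ _).2 fun i => hγ i n).symm

end LimitIsPath

/-! ### Cut times of the first walk and the mean conductance of the cut edges. -/

section CutTimes

/-- With tail sums Q_n, the inequality b_n/Q_n ≤ log Q_n - log Q_(n+1) telescopes; the last nonzero
term contributes 1. The induction runs downwards from M, and zero terms, including 0/0, add nothing.
-/
theorem sum_div_tail_le (b : ℕ → ℝ) (M : ℕ) {β : ℝ} (hβ : 0 < β)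
    (hb : ∀ n < M, b n = 0 ∨ β ≤ b n) (j : ℕ) (hj : j ≤ M) :
    (∑ k ∈ Finset.Ico (M - j) M, b k = 0 ∧
      ∑ n ∈ Finset.Ico (M - j) M, b n / ∑ k ∈ Finset.Ico n M, b k = 0) ∨
    (β ≤ ∑ k ∈ Finset.Ico (M - j) M, b k ∧
      ∑ n ∈ Finset.Ico (M - j) M, b n / ∑ k ∈ Finset.Ico n M, b k ≤
        1 + Real.log ((∑ k ∈ Finset.Ico (M - j) M, b k) / β)) := by
  induction j with
  | zero => simp
  | succ j ih =>
    obtain ⟨T, hT⟩ : ∃ T, T = M - (j + 1) := ⟨_, rfl⟩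
    have hT1 : M - j = T + 1 := by omega
    have hTM : T < M := by omega
    have ih := ih (by omega)
    rw [hT1] at ih
    rw [← hT, Finset.sum_eq_sum_Ico_succ_bot hTM, Finset.sum_eq_sum_Ico_succ_bot hTM,
      Finset.sum_eq_sum_Ico_succ_bot hTM]
    set Q := ∑ k ∈ Finset.Ico (T + 1) M, b k
    rcases hb T hTM with h0 | h0
    · simpa [h0] using ih
    · have hbT : 0 < b T := hβ.trans_le h0
      rcases ih with ⟨hQ, hS⟩ | ⟨hQ, hS⟩
      · right
        rw [hQ, hS, add_zero, add_zero, div_self hbT.ne']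
        refine ⟨h0, ?_⟩
        have := Real.log_nonneg ((one_le_div hβ).2 h0)
        linarith
      · right
        have hQ0 : 0 < Q := hβ.trans_le hQ
        have hs : 0 < b T + Q := add_pos hbT hQ0
        refine ⟨by linarith, ?_⟩
        have h1 := Real.log_le_sub_one_of_pos (div_pos hQ0 hs)
        rw [Real.log_div hQ0.ne' hs.ne'] at h1
        have h2 : b T / (b T + Q) = 1 - Q / (b T + Q) := by field_simp; ring
        rw [Real.log_div hQ0.ne' hβ.ne'] at hS
        rw [Real.log_div hs.ne' hβ.ne', h2]
        linarith

variable {d : ℕ} {q : Dir d → ℝ}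

theorem integral_comp_pos (hq : ∀ e, 0 < q e) (hq1 : ∑ e, q e = 1) (φ : Site d →+ ℝ) (n : ℕ) :
    Integrable (fun s => φ (pos s n)) (seqLaw q) ∧
      ∫ s, φ (pos s n) ∂seqLaw q = n * stepMean q φ := by
  have h0 := isProbabilityMeasure_stepLaw hq hq1
  have h1 : ∀ k, MeasurePreserving (fun s : ℕ → Dir d => s k) (seqLaw q) (stepLaw q) := fun k =>
    measurePreserving_eval_infinitePi (fun _ : ℕ => stepLaw q) k
  have h2 : Integrable (fun e : Dir d => φ (unitVec e)) (stepLaw q) := Integrable.of_finite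
  have h3 : ∀ k, Integrable (fun s => φ (unitVec (s k))) (seqLaw q) := fun k =>
    (h1 k).integrable_comp_of_integrable h2
  have h4 : ∀ k, ∫ s, φ (unitVec (s k)) ∂seqLaw q = stepMean q φ := by
    intro k
    rw [← (h1 k).map_eq] at h2
    have h5 := integral_map (h1 k).measurable.aemeasurable h2.aestronglyMeasurable
    rw [(h1 k).map_eq] at h5
    have : ∀ e, IsFiniteMeasure (ENNReal.ofReal (q e) • Measure.dirac e) :=
      fun e => Measure.smul_finite _ ENNReal.ofReal_ne_top
    rw [← h5, stepLaw, integral_finsetSum_measure fun e _ => Integrable.of_finite]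
    refine Finset.sum_congr rfl fun e _ => ?_
    rw [integral_smul_measure, integral_dirac, ENNReal.toReal_ofReal (hq e).le, smul_eq_mul]
  simp only [pos, map_sum]
  refine ⟨integrable_finsetSum _ fun k _ => h3 k, ?_⟩
  rw [integral_finsetSum _ fun k _ => h3 k]
  simp [h4]

theorem integral_exp_neg_pos_shift (hq : ∀ e, 0 < q e) (hq1 : ∑ e, q e = 1) (φ : Site d →+ ℝ)
    (r : ℝ) (k n : ℕ) :
    Integrable (fun s => Real.exp (-(r * φ (pos (shift k s) n)))) (seqLaw q) ∧
      ∫ s, Real.exp (-(r * φ (pos (shift k s) n))) ∂seqLaw q = laplace q φ r ^ n := by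
  have hm : Measurable fun s : ℕ → Dir d => Real.exp (-(r * φ (pos (shift k s) n))) :=
    (measurable_comp_pos (fun x => Real.exp (-(r * φ x))) n).comp (measurable_shift k)
  have h1 : ∫⁻ s, ENNReal.ofReal (Real.exp (-(r * φ (pos (shift k s) n)))) ∂seqLaw q =
      ENNReal.ofReal (laplace q φ r ^ n) := by
    rw [lintegral_shift hq hq1 k (G := fun s => ENNReal.ofReal (Real.exp (-(r * φ (pos s n)))))
      (measurable_comp_pos (fun x => ENNReal.ofReal (Real.exp (-(r * φ x)))) n)]
    exact lintegral_exp_neg_pos hq hq1 φ r n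
  constructor
  · rw [← lintegral_ofReal_ne_top_iff_integrable hm.aestronglyMeasurable
      (Filter.Eventually.of_forall fun s => (Real.exp_pos _).le), h1]
    exact ENNReal.ofReal_ne_top
  · rw [integral_eq_lintegral_of_nonneg_ae (Filter.Eventually.of_forall fun s => (Real.exp_pos _).le)
      hm.aestronglyMeasurable, h1, ENNReal.toReal_ofReal (pow_nonneg (laplace_pos hq hq1 φ r).le n)]

theorem sum_laplace_pow_le (hq : ∀ e, 0 < q e) (hq1 : ∑ e, q e = 1) (φ : Site d →+ ℝ) {r : ℝ}
    (hρ : laplace q φ r < 1) (N : ℕ) :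
    ∑ k ∈ Finset.range N, laplace q φ r ^ k ≤ (1 - laplace q φ r)⁻¹ := by
  have h0 := (laplace_pos hq hq1 φ r).le
  rw [← tsum_geometric_of_lt_one h0 hρ]
  exact (summable_geometric_of_lt_one h0 hρ).sum_le_tsum _ fun k _ => pow_nonneg h0 k

theorem seqLaw_prefix_shift (hq : ∀ e, 0 < q e) (hq1 : ∑ e, q e = 1) (n : ℕ) (f : ℕ → Dir d)
    {G : Set (ℕ → Dir d)} (hG : MeasurableSet G) (hG0 : seqLaw q G ≠ 0) :
    seqLaw q {s | (∀ k < n, s k = f k) ∧ shift n s ∈ G} ≠ 0 := by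
  have hA : MeasurableSet {s : ℕ → Dir d | ∀ k < n, s k = f k} :=
    measurableSet_forall_lt n (t := fun k => {f k}) fun _ => MeasurableSet.of_discrete
  have h1 := lintegral_mul_shift hq hq1 n
    (F := Set.indicator {s : ℕ → Dir d | ∀ k < n, s k = f k} 1) (G := G.indicator 1)
    (measurable_one.indicator hA) (measurable_one.indicator hG) (fun s s' h => by
      have : (∀ k < n, s k = f k) ↔ ∀ k < n, s' k = f k :=
        forall₂_congr fun k hk => by rw [h k hk]
      simp only [Set.indicator_apply, Set.mem_ofPred_eq, this, Pi.one_apply])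
  have h2 : seqLaw q {s | (∀ k < n, s k = f k) ∧ shift n s ∈ G} =
      seqLaw q {s | ∀ k < n, s k = f k} * seqLaw q G := by
    change seqLaw q ({s | ∀ k < n, s k = f k} ∩ shift n ⁻¹' G) = _
    rw [← lintegral_indicator_one hA, ← lintegral_indicator_one hG, ← h1,
      ← lintegral_indicator_one (hA.inter (measurable_shift n hG))]
    refine lintegral_congr fun s => ?_
    by_cases ha : s ∈ {s : ℕ → Dir d | ∀ k < n, s k = f k}
    · by_cases hb : shift n s ∈ G
      · rw [Set.indicator_of_mem ha, Set.indicator_of_mem hb,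
          Set.indicator_of_mem (Set.mem_inter ha hb)]
        simp
      · rw [Set.indicator_of_notMem hb, mul_zero, Set.indicator_of_notMem fun h => hb h.2]
    · rw [Set.indicator_of_notMem ha, zero_mul, Set.indicator_of_notMem fun h => ha h.1]
  rw [h2]
  refine mul_ne_zero ?_ hG0
  have h3 := seqLaw_forall_lt hq hq1 n fun k => {f k}
  simp only [Set.mem_singleton_iff] at h3
  rw [h3, Finset.prod_ne_zero_iff]
  intro k _
  rw [stepLaw_apply, Finset.sum_eq_single (f k)]
  · simpa using hq (f k)
  · intro e _ he; simp [he]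
  · simp

variable [NeZero d]

/-- The first coordinate of the position after `n` steps. -/
def level (s : ℕ → Dir d) (n : ℕ) : ℤ := pos s n 0

theorem level_add (s : ℕ → Dir d) (n k : ℕ) : level s (n + k) = level s n + level (shift n s) k := by
  simp [level, pos_add]

theorem level_zero (s : ℕ → Dir d) : level s 0 = 0 := by simp [level, pos_zero]

/-- The paths that start with the step `e_1` and then remain in the half-space `1 ≤ x_1`. -/
def escapeSet (d : ℕ) [NeZero d] : Set (ℕ → Dir d) :=
  {s | s 0 = dirOne d ∧ ∀ n, 1 ≤ level s (n + 1)}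

/-- The level at time `n` is a maximum of the levels until time `n`. -/
def IsRecord (s : ℕ → Dir d) (n : ℕ) : Prop := ∀ m ≤ n, level s m ≤ level s n

/-- At time `n`, the path crosses an edge that separates its past from its future. -/
def IsCut (s : ℕ → Dir d) (n : ℕ) : Prop := IsRecord s n ∧ shift n s ∈ escapeSet d

theorem shift_zero {α : Type*} (s : ℕ → α) : shift 0 s = s := by
  ext k : 1; simp [shift]

theorem isCut_zero {s : ℕ → Dir d} (hs : s ∈ escapeSet d) : IsCut s 0 :=
  ⟨fun m hm => by rw [Nat.le_zero.1 hm], by rwa [shift_zero]⟩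

theorem IsCut.shift {s : ℕ → Dir d} {n j : ℕ} (h : IsCut s (n + j)) :
    IsCut (IteratedTrace.shift n s) j := by
  refine ⟨fun m hm => ?_, by rw [shift_shift]; exact h.2⟩
  have := h.1 (n + m) (by omega)
  rw [level_add, level_add] at this
  omega

open Classical in
/-- The resistances of the cut edges, summed over all cut times. -/
noncomputable def cutSum (φ : Site d →+ ℝ) (s : ℕ → Dir d) : ENNReal :=
  ∑' k, if IsCut s k then ENNReal.ofReal (Real.exp (-φ (pos s k))) else 0

open Classical in
/-- The conductance of the series of the cut edges, on the event that time zero is a cut time. -/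
noncomputable def cutCond (φ : Site d →+ ℝ) (s : ℕ → Dir d) : ENNReal :=
  if s ∈ escapeSet d then (cutSum φ s)⁻¹ else 0

theorem cutCond_le_one (φ : Site d →+ ℝ) (s : ℕ → Dir d) : cutCond φ s ≤ 1 := by
  classical
  rw [cutCond]
  split_ifs with h
  · rw [ENNReal.inv_le_one]
    refine le_trans ?_ (ENNReal.le_tsum 0)
    simp [isCut_zero h, pos_zero]
  · exact zero_le_one

theorem measurable_level (n : ℕ) : Measurable fun s : ℕ → Dir d => level s n :=
  measurable_comp_pos (fun x => x 0) n

theorem measurableSet_escapeSet : MeasurableSet (escapeSet d) := by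
  have : escapeSet d = {s | s 0 = dirOne d} ∩ ⋂ n, {s | 1 ≤ level s (n + 1)} := by
    ext s; simp [escapeSet]
  rw [this]
  exact (measurable_pi_apply 0 (measurableSet_singleton (dirOne d))).inter
    (MeasurableSet.iInter fun n => measurable_level (n + 1) measurableSet_Ici)

theorem measurableSet_isRecord (n : ℕ) : MeasurableSet {s : ℕ → Dir d | IsRecord s n} := by
  have : {s : ℕ → Dir d | IsRecord s n} = ⋂ m, ⋂ (_ : m ≤ n), {s | level s m ≤ level s n} := by
    ext s; simp [IsRecord]
  rw [this]
  exact MeasurableSet.iInter fun m => MeasurableSet.iInter fun _ =>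
    measurableSet_le (measurable_level m) (measurable_level n)

theorem measurableSet_isCut (n : ℕ) : MeasurableSet {s : ℕ → Dir d | IsCut s n} :=
  (measurableSet_isRecord n).inter (measurable_shift n measurableSet_escapeSet)

theorem measurable_cutCond (φ : Site d →+ ℝ) : Measurable (cutCond φ) := by
  classical
  unfold cutCond cutSum
  exact Measurable.ite measurableSet_escapeSet (Measurable.tsum fun k =>
    Measurable.ite (measurableSet_isCut k)
      (measurable_comp_pos (fun x => ENNReal.ofReal (Real.exp (-φ x))) k) measurable_const).inv
    measurable_const

open Classical in
-- A summand is nonzero only at a cut time n of s. Later cut times of s are cut times of the shifted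
-- path (`IsCut.shift`), so the summand is at most c_n divided by the tail sum of c over [n, M).
-- Then `sum_div_tail_le` applies: nonzero terms are at least exp(-b), and the total is at most M
-- exp(a).
theorem sum_isRecord_mul_cutCond_le (φ : Site d →+ ℝ) (s : ℕ → Dir d) (M : ℕ) (hM : 0 < M)
    {a b : ℝ} (hab : ∀ k < M, -a ≤ φ (pos s k) ∧ φ (pos s k) ≤ b) :
    ∑ n ∈ Finset.range M, (if IsRecord s n then 1 else 0) * cutCond φ (shift n s) ≤
      ENNReal.ofReal (1 + Real.log M + (a + b)) := by
  set c : ℕ → ℝ := fun k => if IsCut s k then Real.exp (-φ (pos s k)) else 0 with hc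
  have hc0 : ∀ k, 0 ≤ c k := fun k => by
    simp only [hc]; split_ifs; exacts [(Real.exp_pos _).le, le_rfl]
  have hM' : (1 : ℝ) ≤ M := by exact_mod_cast hM
  have h1 : ∀ n ∈ Finset.range M, (if IsRecord s n then 1 else 0) * cutCond φ (shift n s) ≤
      ENNReal.ofReal (c n / ∑ k ∈ Finset.Ico n M, c k) := by
    intro n hn
    rw [Finset.mem_range] at hn
    by_cases hcut : IsCut s n
    · have hcn : 0 < c n := by simp only [hc, hcut, if_true]; exact Real.exp_pos _
      have hQ : 0 < ∑ k ∈ Finset.Ico n M, c k :=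
        Finset.sum_pos' (fun k _ => hc0 k) ⟨n, Finset.mem_Ico.2 ⟨le_rfl, hn⟩, hcn⟩
      rw [if_pos hcut.1, one_mul, cutCond, if_pos hcut.2, ← inv_div,
        ENNReal.ofReal_inv_of_pos (div_pos hQ hcn), ENNReal.inv_le_inv, cutSum]
      refine le_trans ?_ (ENNReal.sum_le_tsum (Finset.range (M - n)))
      rw [Finset.sum_Ico_eq_sum_range, Finset.sum_div,
        ENNReal.ofReal_sum_of_nonneg fun j _ => div_nonneg (hc0 _) (hc0 _)]
      refine Finset.sum_le_sum fun j _ => ?_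
      by_cases hj : IsCut s (n + j)
      · rw [if_pos hj.shift]
        refine ENNReal.ofReal_le_ofReal (le_of_eq ?_)
        simp only [hc, hcut, hj, if_true]
        rw [← Real.exp_sub, pos_add, map_add]
        congr 1; ring
      · simp [hc, hj]
    · have : (if IsRecord s n then 1 else 0) * cutCond φ (shift n s) = 0 := by
        rw [cutCond]
        by_cases hr : IsRecord s n
        · rw [if_neg fun h => hcut ⟨hr, h⟩, mul_zero]
        · rw [if_neg hr, zero_mul]
      rw [this]
      exact zero_le
  refine (Finset.sum_le_sum h1).trans ?_
  rw [← ENNReal.ofReal_sum_of_nonneg fun n _ => div_nonneg (hc0 n) (Finset.sum_nonneg fun k _ => hc0 k)]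
  refine ENNReal.ofReal_le_ofReal ?_
  have hab0 : 0 ≤ a + b := by have := hab 0 hM; linarith
  have hlogM := Real.log_nonneg hM'
  have h2 := sum_div_tail_le c M (Real.exp_pos (-b)) (fun n hn => by
    simp only [hc]
    split_ifs
    · exact Or.inr (Real.exp_le_exp.2 (neg_le_neg (hab n hn).2))
    · exact Or.inl rfl) M le_rfl
  rw [Nat.sub_self, ← Finset.range_eq_Ico] at h2
  rcases h2 with ⟨-, h2⟩ | ⟨h3, h2⟩
  · rw [h2]; linarith
  · refine h2.trans ?_
    have h4 : ∑ k ∈ Finset.range M, c k ≤ M * Real.exp a := by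
      refine (Finset.sum_le_card_nsmul _ _ (Real.exp a) fun k hk => ?_).trans (by simp)
      simp only [hc]
      split_ifs
      · exact Real.exp_le_exp.2 (by linarith [(hab k (Finset.mem_range.1 hk)).1])
      · exact (Real.exp_pos _).le
    have h5 : Real.log ((∑ k ∈ Finset.range M, c k) / Real.exp (-b)) ≤ Real.log M + (a + b) := by
      have h6 := (Real.exp_pos (-b)).trans_le h3
      rw [Real.log_div h6.ne' (Real.exp_pos _).ne', Real.log_exp]
      have := Real.log_le_log h6 h4
      rw [Real.log_mul (by positivity) (Real.exp_pos _).ne', Real.log_exp] at this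
      linarith
    linarith

open Classical in
-- The level rises by at most one per step, and each new maximum is a record; the additional 1 is
-- the record at time 0.
theorem level_lt_sum_isRecord (s : ℕ → Dir d) (M : ℕ) :
    ∀ m ≤ M, level s m + 1 ≤ ∑ n ∈ Finset.range (M + 1), if IsRecord s n then (1 : ℤ) else 0 := by
  induction M with
  | zero =>
    intro m hm
    have h0 : IsRecord s 0 := fun m hm => by rw [Nat.le_zero.1 hm]
    rw [Nat.le_zero.1 hm]
    rw [Finset.sum_range_succ, Finset.sum_range_zero, if_pos h0, level_zero]
  | succ M ih =>
    have hstep : level s (M + 1) ≤ level s M + 1 := by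
      rw [level_add]
      have : level (shift M s) 1 ≤ 1 := by
        rw [level, pos_succ, pos_zero, zero_add, unitVec]
        by_cases h : (0 : Fin d) = (shift M s 0).1
        · rw [h, Pi.single_eq_same]
          rcases Int.units_eq_one_or (shift M s 0).2 with h | h <;> simp [h]
        · simp [h]
      omega
    intro m hm
    rw [Finset.sum_range_succ]
    by_cases hr : IsRecord s (M + 1)
    · rw [if_pos hr]
      have h1 := hr m hm
      have h2 := ih M le_rfl
      omega
    · rw [if_neg hr, add_zero]
      rcases (by omega : m ≤ M ∨ m = M + 1) with hm | rfl
      · exact ih m hm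
      · simp only [IsRecord, not_forall, not_le] at hr
        obtain ⟨l, hl, hl'⟩ := hr
        rcases (by omega : l ≤ M ∨ l = M + 1) with hl | rfl
        · have := ih l hl
          omega
        · omega

theorem isRecord_congr {s s' : ℕ → Dir d} {n : ℕ} (h : ∀ k < n, s k = s' k) :
    IsRecord s n ↔ IsRecord s' n := by
  have h1 : ∀ m ≤ n, level s m = level s' m := fun m hm => by
    rw [level, level, pos_congr fun k hk => h k (hk.trans_le hm)]
  exact forall₂_congr fun m hm => by rw [h1 m hm, h1 n le_rfl]

/-- The first coordinate as a homomorphism. -/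
def firstCoord (d : ℕ) [NeZero d] : Site d →+ ℝ where
  toFun x := (x 0 : ℝ)
  map_zero' := by simp
  map_add' := by simp

theorem stepMean_firstCoord (q : Dir d → ℝ) : stepMean q (firstCoord d) = drift q 0 := by
  rw [stepMean, sum_dir, Finset.sum_eq_single (0 : Fin d)]
  · simp [firstCoord, unitVec, drift]; ring
  · intro j _ hj
    simp [firstCoord, unitVec, hj.symm]
  · simp

open Classical in
-- Integrates `sum_isRecord_mul_cutCond_le`. The number of records is bounded below in mean by the
-- mean level, that is, by M times the drift.
theorem mul_lintegral_cutCond_le (hq : ∀ e, 0 < q e) (hq1 : ∑ e, q e = 1) (φ : Site d →+ ℝ)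
    {r : ℝ} (hr : 0 < r) (hρ : laplace q φ r < 1) (M : ℕ) :
    M * drift q 0 * (∫⁻ s, cutCond φ s ∂seqLaw q).toReal ≤
      1 + Real.log ((M + 1 : ℕ) : ℝ) + ((M + 1 : ℕ) * stepMean q φ +
        2 * (r⁻¹ * (1 - laplace q φ r)⁻¹)) := by
  have hprob := isProbabilityMeasure_seqLaw hq hq1
  set P := seqLaw q with hP
  set N := M + 1 with hN
  -- Integrable bounds for the range of φ along the path, from -y ≤ exp(-ry)/r. The function a
  -- controls the minimum; b controls the maximum through the increments of φ from time k to N.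
  -- Summed over k their means are geometric series, so only the mean of φ(pos s N) grows with N.
  set a : (ℕ → Dir d) → ℝ := fun s =>
    ∑ k ∈ Finset.range N, r⁻¹ * Real.exp (-(r * φ (pos (shift 0 s) k))) with ha
  set b : (ℕ → Dir d) → ℝ := fun s => φ (pos s N) +
    ∑ k ∈ Finset.range N, r⁻¹ * Real.exp (-(r * φ (pos (shift k s) (N - k)))) with hb
  have hexp : ∀ y : ℝ, -y ≤ r⁻¹ * Real.exp (-(r * y)) := by
    intro y
    have := Real.add_one_le_exp (-(r * y))
    rw [inv_mul_eq_div, le_div_iff₀ hr]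
    linarith
  have hab : ∀ s, ∀ k < N, -a s ≤ φ (pos s k) ∧ φ (pos s k) ≤ b s := by
    intro s k hk
    constructor
    · have h1 := Finset.single_le_sum (f := fun k => r⁻¹ * Real.exp (-(r * φ (pos (shift 0 s) k))))
        (fun k _ => mul_nonneg (inv_pos.2 hr).le (Real.exp_pos _).le) (Finset.mem_range.2 hk)
      have h2 := hexp (φ (pos s k))
      simp only [shift_zero] at h1
      simp only [ha, shift_zero]
      linarith
    · have h1 := Finset.single_le_sum
        (f := fun k => r⁻¹ * Real.exp (-(r * φ (pos (shift k s) (N - k)))))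
        (fun k _ => mul_nonneg (inv_pos.2 hr).le (Real.exp_pos _).le) (Finset.mem_range.2 hk)
      have h2 := hexp (φ (pos (shift k s) (N - k)))
      have h3 : φ (pos s N) = φ (pos s k) + φ (pos (shift k s) (N - k)) := by
        rw [← map_add, ← pos_add, Nat.add_sub_cancel' hk.le]
      simp only [hb]
      linarith
  have hinta : ∀ k n, Integrable (fun s => r⁻¹ * Real.exp (-(r * φ (pos (shift k s) n)))) P :=
    fun k n => (integral_exp_neg_pos_shift hq hq1 φ r k n).1.const_mul _
  have hia : Integrable a P := integrable_finsetSum _ fun k _ => hinta 0 k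
  have hib2 : Integrable (fun s => ∑ k ∈ Finset.range N,
      r⁻¹ * Real.exp (-(r * φ (pos (shift k s) (N - k))))) P :=
    integrable_finsetSum _ fun k _ => hinta k (N - k)
  have hib : Integrable b P := (integral_comp_pos hq hq1 φ N).1.add hib2
  have hEa : ∫ s, a s ∂P ≤ r⁻¹ * (1 - laplace q φ r)⁻¹ := by
    simp only [ha]
    rw [integral_finsetSum _ fun k _ => hinta 0 k]
    simp only [integral_const_mul, hP, (integral_exp_neg_pos_shift hq hq1 φ r _ _).2]
    rw [← Finset.mul_sum]
    exact mul_le_mul_of_nonneg_left (sum_laplace_pow_le hq hq1 φ hρ N) (inv_pos.2 hr).le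
  have hEb : ∫ s, b s ∂P ≤ N * stepMean q φ + r⁻¹ * (1 - laplace q φ r)⁻¹ := by
    simp only [hb]
    rw [integral_add (integral_comp_pos hq hq1 φ N).1 hib2, (integral_comp_pos hq hq1 φ N).2,
      integral_finsetSum _ fun k _ => hinta k (N - k)]
    simp only [integral_const_mul, hP, (integral_exp_neg_pos_shift hq hq1 φ r _ _).2]
    rw [← Finset.mul_sum]
    refine add_le_add_right (mul_le_mul_of_nonneg_left ?_ (inv_pos.2 hr).le) _
    refine le_trans ?_ (sum_laplace_pow_le hq hq1 φ hρ N)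
    rw [← Finset.sum_range_reflect]
    refine Finset.sum_le_sum fun k hk => ?_
    rw [Finset.mem_range] at hk
    refine pow_le_pow_of_le_one (laplace_pos hq hq1 φ r).le hρ.le ?_
    omega
  have hnn : ∀ s, 0 ≤ 1 + Real.log (N : ℝ) + (a s + b s) := by
    intro s
    have h1 := hab s 0 (Nat.succ_pos M)
    have h2 : 0 ≤ Real.log (N : ℝ) := Real.log_natCast_nonneg N
    linarith
  have hint : Integrable (fun s => 1 + Real.log (N : ℝ) + (a s + b s)) P :=
    (integrable_const _).add (hia.add hib)
  have hJm := measurable_cutCond φ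
  -- Being a record depends on the first n steps and `cutCond φ (shift n s)` on the later ones, so
  -- the integral of the product factorises.
  have h1 : (∑ n ∈ Finset.range N, P {s | IsRecord s n}) * ∫⁻ s, cutCond φ s ∂P ≤
      ENNReal.ofReal (∫ s, (1 + Real.log (N : ℝ) + (a s + b s)) ∂P) := by
    rw [ofReal_integral_eq_lintegral_ofReal hint (Filter.Eventually.of_forall hnn)]
    refine le_trans (le_of_eq ?_) (lintegral_mono fun s =>
      sum_isRecord_mul_cutCond_le φ s N (Nat.succ_pos M) (hab s))
    have hF : ∀ n, Measurable fun s : ℕ → Dir d => if IsRecord s n then (1 : ENNReal) else 0 :=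
      fun n => Measurable.ite (measurableSet_isRecord n) measurable_const measurable_const
    rw [lintegral_finsetSum (μ := P) (Finset.range N)
      (f := fun n s => (if IsRecord s n then 1 else 0) * cutCond φ (shift n s))
      fun n _ => (hF n).mul (hJm.comp (measurable_shift n)), Finset.sum_mul]
    refine Finset.sum_congr rfl fun n _ => ?_
    rw [lintegral_mul_shift hq hq1 n (hF n) hJm fun s s' h => by simp only [isRecord_congr h]]
    congr 1
    rw [← lintegral_indicator_one (measurableSet_isRecord n)]
    refine lintegral_congr fun s => ?_
    by_cases h : IsRecord s n <;> simp [h]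
  have h2 : (M : ℝ) * drift q 0 ≤ ∑ n ∈ Finset.range N, P.real {s | IsRecord s n} := by
    rw [← stepMean_firstCoord, ← (integral_comp_pos hq hq1 (firstCoord d) M).2]
    have hI : ∀ n, Integrable (Set.indicator {s : ℕ → Dir d | IsRecord s n} fun _ => (1 : ℝ)) P :=
      fun n => (integrable_const 1).indicator (measurableSet_isRecord n)
    have h3 : ∑ n ∈ Finset.range N, P.real {s | IsRecord s n} =
        ∫ s, ∑ n ∈ Finset.range N, Set.indicator {s : ℕ → Dir d | IsRecord s n} (fun _ => (1 : ℝ)) s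
          ∂P := by
      rw [integral_finsetSum _ fun n _ => hI n]
      refine Finset.sum_congr rfl fun n _ => ?_
      rw [integral_indicator (measurableSet_isRecord n)]
      simp
    rw [h3]
    refine integral_mono (integral_comp_pos hq hq1 (firstCoord d) M).1
      (integrable_finsetSum _ fun n _ => hI n) fun s => ?_
    have h4 : ((level s M : ℤ) : ℝ) ≤
        ((∑ n ∈ Finset.range N, if IsRecord s n then (1 : ℤ) else 0 : ℤ) : ℝ) := by
      have := level_lt_sum_isRecord s M M le_rfl
      rw [← hN] at this
      exact_mod_cast (by omega : level s M ≤
        ∑ n ∈ Finset.range N, if IsRecord s n then (1 : ℤ) else 0)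
    refine h4.trans (le_of_eq ?_)
    push_cast
    exact Finset.sum_congr rfl fun n _ => by simp [Set.indicator_apply]
  have h5 := ENNReal.toReal_mono ENNReal.ofReal_ne_top h1
  rw [ENNReal.toReal_mul, ENNReal.toReal_sum fun n _ => measure_ne_top P _,
    ENNReal.toReal_ofReal (integral_nonneg hnn),
    integral_add (f := fun _ => 1 + Real.log (N : ℝ)) (g := fun s => a s + b s)
      (integrable_const _) (hia.add hib), integral_add hia hib] at h5
  simp only [integral_const, probReal_univ, one_smul] at h5
  have h6 := mul_le_mul_of_nonneg_right h2
    (ENNReal.toReal_nonneg (a := ∫⁻ s, cutCond φ s ∂P))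
  simp only [measureReal_def] at h6
  linarith

/-- The mean conductance of the series of the cut edges is at most proportional to the drift. -/
theorem lintegral_cutCond_le (hq : ∀ e, 0 < q e) (hq1 : ∑ e, q e = 1) (hδ : 0 < drift q 0)
    {φ : Site d →+ ℝ} (hφ : 0 < stepMean q φ) :
    ∫⁻ s, cutCond φ s ∂seqLaw q ≤ ENNReal.ofReal (stepMean q φ / drift q 0) := by
  have hprob := isProbabilityMeasure_seqLaw hq hq1
  obtain ⟨r, hr, -, hρ⟩ := exists_laplace_lt_one hq hq1 hφ
  have hfin : ∫⁻ s, cutCond φ s ∂seqLaw q ≠ ⊤ := by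
    refine ((lintegral_mono fun s => cutCond_le_one φ s).trans_lt ?_).ne
    simp
  rw [ENNReal.le_ofReal_iff_toReal_le hfin (div_pos hφ hδ).le, le_div_iff₀ hδ, mul_comm]
  set j := (∫⁻ s, cutCond φ s ∂seqLaw q).toReal with hj
  -- A gap η > 0 would make the left side of `mul_lintegral_cutCond_le` exceed the right side by Mη
  -- up to an error of order log M.
  by_contra! hlt
  set η := drift q 0 * j - stepMean q φ with hη
  have hη0 : 0 < η := sub_pos.2 hlt
  set C := 1 + stepMean q φ + 2 * (r⁻¹ * (1 - laplace q φ r)⁻¹) + η with hC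
  have h1 := (Real.isLittleO_log_id_atTop.bound (half_pos hη0)).and
    (Filter.eventually_gt_atTop (C / (η / 2)))
  have h2 := ((tendsto_natCast_atTop_atTop (R := ℝ)).comp
    (Filter.tendsto_add_atTop_nat 1)).eventually h1
  obtain ⟨M, hM1, hM2⟩ := h2.exists
  have h3 := mul_lintegral_cutCond_le hq hq1 φ hr hρ M
  simp only [Function.comp_apply, id] at hM1 hM2
  rw [div_lt_iff₀ (half_pos hη0)] at hM2
  have h4 := (le_abs_self _).trans hM1
  rw [Real.norm_of_nonneg (Nat.cast_nonneg _)] at h4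
  push_cast at h3 h4 hM2
  rw [← hj] at h3
  have h5 : (M : ℝ) * drift q 0 * j = M * (η + stepMean q φ) := by rw [hη]; ring
  rw [h5] at h3
  nlinarith

/-- Positive drift bounds the level below almost surely, so for some K it stays above -K with
positive probability; K + 1 initial steps e_1, independent of the rest, lift such a path to level at
least 1. -/
theorem seqLaw_escapeSet_ne_zero (hq : ∀ e, 0 < q e) (hq1 : ∑ e, q e = 1) (hδ : 0 < drift q 0) :
    seqLaw q (escapeSet d) ≠ 0 := by
  have hprob := isProbabilityMeasure_seqLaw hq hq1
  set G : ℕ → Set (ℕ → Dir d) := fun K => {s | ∀ n, -(K : ℤ) ≤ level s n} with hG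
  have hGm : ∀ K, MeasurableSet (G K) := by
    intro K
    have : G K = ⋂ n, {s | -(K : ℤ) ≤ level s n} := by ext s; simp [hG]
    rw [this]
    exact MeasurableSet.iInter fun n => measurable_level n measurableSet_Ici
  have h1 : ∀ᵐ s ∂seqLaw q, s ∈ ⋃ K, G K := by
    filter_upwards [ae_summable_exp_neg_pos hq hq1 (φ := firstCoord d)
      (by rwa [stepMean_firstCoord])] with s hs
    obtain ⟨C, hC⟩ := hs.tendsto_atTop_zero.bddAbove_range
    obtain ⟨K, hK⟩ := exists_nat_ge C
    refine Set.mem_iUnion.2 ⟨K, fun n => ?_⟩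
    have h2 : Real.exp (-(level s n : ℝ)) ≤ K := (hC ⟨n, rfl⟩).trans hK
    have h3 := Real.add_one_le_exp (-(level s n : ℝ))
    have h4 : (-(K : ℤ) : ℝ) ≤ level s n := by push_cast; linarith
    exact_mod_cast h4
  obtain ⟨K, hK⟩ : ∃ K, seqLaw q (G K) ≠ 0 := by
    by_contra! h
    have h2 : seqLaw q (⋃ K, G K) = 0 := measure_iUnion_null h
    have h3 : seqLaw q (⋃ K, G K)ᶜ = 0 := h1
    have h4 := measure_univ_le_add_compl (μ := seqLaw q) (⋃ K, G K)
    rw [h2, h3, measure_univ] at h4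
    simp at h4
  have h2 := seqLaw_prefix_shift hq hq1 (K + 1) (fun _ => dirOne d) (hGm K) hK
  intro h
  refine h2 (measure_mono_null ?_ h)
  rintro s ⟨hs1, hs2⟩
  have hlev : ∀ m ≤ K + 1, level s m = m := by
    intro m hm
    induction m with
    | zero => simp [level_zero]
    | succ m ih =>
      have h3 := ih (by omega)
      rw [level, pos_succ, Pi.add_apply, hs1 m (by omega)]
      rw [level] at h3
      rw [h3]
      simp [unitVec, dirOne]
  refine ⟨hs1 0 (by omega), fun n => ?_⟩
  rcases le_or_gt (n + 1) (K + 1) with hn | hn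
  · rw [hlev _ hn]; push_cast; omega
  · obtain ⟨m, hm⟩ := Nat.exists_eq_add_of_le hn.le
    rw [hm, level_add, hlev _ le_rfl]
    have := hs2 m
    push_cast
    omega

end CutTimes

/-! ### Avoiding the end of a dangling edge: an upper bound by the series of cut edges. -/

section DanglingEdge

variable {d : ℕ} [NeZero d]

theorem one_le_level_of_mem_escapeSet {s : ℕ → Dir d} (hs : s ∈ escapeSet d) {n : ℕ} (hn : n ≠ 0) :
    1 ≤ level s n := by
  obtain ⟨m, rfl⟩ := Nat.exists_eq_succ_of_ne_zero hn
  exact hs.2 m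

theorem IsCut.level_le_iff {s : ℕ → Dir d} {k : ℕ} (hk : IsCut s k) (m : ℕ) :
    level s m ≤ level s k ↔ m ≤ k := by
  refine ⟨fun h => ?_, hk.1 m⟩
  by_contra! hm
  obtain ⟨j, rfl⟩ := Nat.exists_eq_add_of_le hm.le
  have := one_le_level_of_mem_escapeSet hk.2 (n := j) (by omega)
  rw [level_add] at h
  omega

/-- The probability to leave a large set before the end `w` of the dangling edge `{w, v}` is hit is
bounded in terms of the resistances of the cut edges. -/
theorem conductance_mul_one_sub_hitLim_le_inv {q : Dir d → ℝ} (hq : ∀ e, 0 < q e)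
    {Z : (latticeGraph d).Subgraph} {s : ℕ → Dir d} (hZ : ∀ x y, Z.Adj x y → (trace (pos s)).Adj x y)
    (K : Finset ℕ) (hK : K.Nonempty) (hcut : ∀ k ∈ K, IsCut s k) (j : ℕ) (hj : ∀ k ∈ K, j ≤ k)
    (v : Site d) (hwv : Z.Adj (pos s j) v) (huniq : ∀ y, Z.Adj (pos s j) y → y = v) :
    ∃ L : ℕ, (∀ k ∈ K, k ≤ L) ∧
      conductance q (pos s j) v *
          (1 - hitLim q Z {pos s j} ((Finset.range (L + 1)).image (pos s) : Finset (Site d)) v) ≤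
        (∑ k ∈ K, (conductance q (pos s k) (pos s (k + 1)))⁻¹)⁻¹ := by
  classical
  obtain ⟨L, hLK, hL⟩ : ∃ L ∈ K, ∀ k ∈ K, k ≤ L := ⟨K.max' hK, K.max'_mem hK, fun k hk => K.le_max' k hk⟩
  refine ⟨L, hL, ?_⟩
  set Λ := (Finset.range (L + 1)).image (pos s) with hΛ
  set r : ℕ → ℝ := fun k => (conductance q (pos s k) (pos s (k + 1)))⁻¹ with hr
  have hr0 : ∀ k, 0 < r k := fun k => inv_pos.2 (conductance_pos hq _ _)
  set R := ∑ k ∈ K, r k with hR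
  have hR0 : 0 < R := Finset.sum_pos (fun k _ => hr0 k) hK
  -- The potential of the series circuit: the share of the total cut resistance R that lies ahead of
  -- x. By `IsCut.level_le_iff` the level of x tells which cuts are ahead, so along the path g drops
  -- only across cut edges, by r k / R. The energy is then Σ r k / R² = 1/R, doubled for the two
  -- orientations.
  set g : Site d → ℝ := fun x =>
    if x ∈ Λ then (∑ k ∈ K.filter fun k => x 0 ≤ level s k, r k) / R else 0 with hg
  have hgu : ∀ n, g (pos s n) = (∑ k ∈ K.filter fun k => n ≤ k, r k) / R := by
    intro n
    have h1 : (K.filter fun k => (pos s n) 0 ≤ level s k) = K.filter fun k => n ≤ k :=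
      Finset.filter_congr fun k hk => (hcut k hk).level_le_iff n
    by_cases hn : pos s n ∈ Λ
    · simp only [hg, hn, if_true, h1]
    · have h2 : (K.filter fun k => n ≤ k) = ∅ := by
        refine Finset.filter_eq_empty_iff.2 fun k hk hnk => hn ?_
        exact Finset.mem_image_of_mem _ (Finset.mem_range.2 (by have := hL k hk; omega))
      simp only [hg, hn, if_false, h2, Finset.sum_empty, zero_div]
  have hdiff : ∀ n, g (pos s n) - g (pos s (n + 1)) = if n ∈ K then r n / R else 0 := by
    intro n
    rw [hgu, hgu, ← sub_div]
    have h1 : ∑ k ∈ K.filter (fun k => n ≤ k), r k =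
        (∑ k ∈ K.filter fun k => n + 1 ≤ k, r k) + if n ∈ K then r n else 0 := by
      rw [Finset.sum_filter, Finset.sum_filter, ← Finset.sum_ite_eq' K n, ← Finset.sum_add_distrib]
      refine Finset.sum_congr rfl fun k _ => ?_
      rcases lt_trichotomy n k with h | h | h
      · simp [h.le, Nat.succ_le_of_lt h, h.ne']
      · simp [h]
      · simp [not_le.2 h, not_le.2 (h.trans (Nat.lt_succ_self n)), h.ne]
    rw [h1, add_sub_cancel_left]
    split_ifs <;> simp
  set S := Λ ∪ Λ.biUnion (fun x => Finset.univ.image fun e => x + unitVec e) with hS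
  have hSΛ : ∀ x ∈ Λ, ∀ e, x + unitVec e ∈ S := by
    intro x hx e
    exact Finset.mem_union_right _ (Finset.mem_biUnion.2
      ⟨x, hx, Finset.mem_image_of_mem _ (Finset.mem_univ e)⟩)
  have hpt : ∀ x y, netCond q Z x y * (g x - g y) ^ 2 ≤
      ∑ k ∈ K, ((if x = pos s k then if y = pos s (k + 1) then r k / R ^ 2 else 0 else 0) +
        if x = pos s (k + 1) then if y = pos s k then r k / R ^ 2 else 0 else 0) := by
    intro x y
    have hpos : ∀ k, 0 ≤ r k / R ^ 2 := fun k => div_nonneg (hr0 k).le (sq_nonneg R)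
    have hnn : ∀ k, 0 ≤ (if x = pos s k then if y = pos s (k + 1) then r k / R ^ 2 else 0 else 0) +
        if x = pos s (k + 1) then if y = pos s k then r k / R ^ 2 else 0 else 0 := by
      intro k
      refine add_nonneg ?_ ?_ <;> split_ifs <;> first | exact hpos k | exact le_rfl
    by_cases hadj : Z.Adj x y
    · obtain ⟨-, n, hn⟩ := hZ x y hadj
      rw [netCond, if_pos hadj]
      have hval : conductance q (pos s n) (pos s (n + 1)) *
          (g (pos s n) - g (pos s (n + 1))) ^ 2 = if n ∈ K then r n / R ^ 2 else 0 := by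
        rw [hdiff]
        split_ifs
        · have : conductance q (pos s n) (pos s (n + 1)) = (r n)⁻¹ := by simp [hr]
          rw [this]
          have := (hr0 n).ne'
          field_simp
        · simp
      rcases Sym2.eq_iff.1 hn with ⟨rfl, rfl⟩ | ⟨rfl, rfl⟩
      · rw [hval]
        split_ifs with hnK
        · refine le_trans ?_ (Finset.single_le_sum (fun k _ => hnn k) hnK)
          rw [if_pos rfl, if_pos rfl]
          refine le_add_of_nonneg_right ?_
          split_ifs <;> first | exact hpos n | exact le_rfl
        · exact Finset.sum_nonneg fun k _ => hnn k
      · rw [conductance_comm, ← neg_sub, neg_sq, hval]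
        split_ifs with hnK
        · refine le_trans ?_ (Finset.single_le_sum (fun k _ => hnn k) hnK)
          rw [add_comm, if_pos rfl, if_pos rfl]
          refine le_add_of_nonneg_right ?_
          split_ifs <;> first | exact hpos n | exact le_rfl
        · exact Finset.sum_nonneg fun k _ => hnn k
    · rw [netCond, if_neg hadj, zero_mul]
      exact Finset.sum_nonneg fun k _ => hnn k
  have henergy : energy S (netCond q Z) g ≤ 2 * R⁻¹ := by
    have hsingle : ∀ (a b : Site d) (k : ℕ),
        ∑ x ∈ S, ∑ y ∈ S, (if x = a then if y = b then r k / R ^ 2 else 0 else 0) ≤ r k / R ^ 2 := by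
      intro a b k
      have hpos : 0 ≤ r k / R ^ 2 := div_nonneg (hr0 k).le (sq_nonneg R)
      have h1 : ∀ x, ∑ y ∈ S, (if x = a then if y = b then r k / R ^ 2 else 0 else 0) =
          if x = a then if b ∈ S then r k / R ^ 2 else 0 else 0 := by
        intro x
        by_cases h : x = a
        · simp only [h, if_true, Finset.sum_ite_eq']
        · simp only [h, if_false, Finset.sum_const_zero]
      simp only [h1, Finset.sum_ite_eq']
      split_ifs <;> first | exact le_rfl | exact hpos
    calc energy S (netCond q Z) g ≤ _ :=
          Finset.sum_le_sum fun x _ => Finset.sum_le_sum fun y _ => hpt x y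
      _ = ∑ k ∈ K, (∑ x ∈ S, ∑ y ∈ S,
            (if x = pos s k then if y = pos s (k + 1) then r k / R ^ 2 else 0 else 0) +
          ∑ x ∈ S, ∑ y ∈ S,
            if x = pos s (k + 1) then if y = pos s k then r k / R ^ 2 else 0 else 0) := by
          rw [Finset.sum_congr rfl fun x _ => Finset.sum_comm, Finset.sum_comm]
          simp only [Finset.sum_add_distrib]
      _ ≤ ∑ k ∈ K, (r k / R ^ 2 + r k / R ^ 2) :=
          Finset.sum_le_sum fun k _ => add_le_add (hsingle _ _ k) (hsingle _ _ k)
      _ = 2 * R⁻¹ := by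
          rw [← Finset.sum_add_distrib.symm, ← Finset.sum_div, ← hR]
          field_simp
          ring
  have hmain := conductance_mul_one_sub_hitLim_le hq Z Λ S Finset.subset_union_left hSΛ v (pos s j)
    (Finset.mem_image_of_mem _ (Finset.mem_range.2 (by have := hj L hLK; omega))) hwv huniq g ?_ ?_
  · linarith
  · rw [hgu, Finset.filter_true_of_mem hj, ← hR, div_self hR0.ne']
  · intro x hx
    simp only [hg, hx, if_false]

/-- The step sequences whose path goes from the origin to `a`, crosses the edge `{a, a + e}` back and
forth, and then escapes in the direction `e_1`. -/
structure IsBranching (a e : Dir d) (s : ℕ → Dir d) : Prop where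
  zero : s 0 = a
  one : s 1 = e
  two : s 2 = (e.1, -e.2)
  escape : shift 3 s ∈ escapeSet d

namespace IsBranching

variable {a e : Dir d} {s : ℕ → Dir d}

theorem pos_one (h : IsBranching a e s) : pos s 1 = unitVec a := by
  rw [pos_succ, pos_zero, h.zero, zero_add]

theorem pos_two (h : IsBranching a e s) : pos s 2 = unitVec a + unitVec e := by
  rw [pos_succ, h.pos_one, h.one]

theorem pos_three (h : IsBranching a e s) : pos s 3 = unitVec a := by
  rw [pos_succ, h.pos_two, h.two, unitVec_neg]
  simp

theorem pos_add_three (h : IsBranching a e s) (k : ℕ) :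
    pos s (3 + k) = unitVec a + pos (shift 3 s) k := by
  rw [pos_add, h.pos_three]

theorem isCut (h : IsBranching a e s) (ha : 0 ≤ unitVec a 0) (he : unitVec e 0 ≤ 0) {k : ℕ}
    (hk : IsCut (shift 3 s) k) : IsCut s (3 + k) := by
  refine ⟨fun m hm => ?_, by rw [← shift_shift]; exact hk.2⟩
  have h0 := hk.1 0 (Nat.zero_le k)
  rw [level_zero] at h0
  have h3 : level s (3 + k) = unitVec a 0 + level (shift 3 s) k := by
    rw [level, h.pos_add_three]; rfl
  rcases lt_or_ge m 3 with hm3 | hm3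
  · interval_cases m
    · rw [level_zero]; omega
    · rw [level, h.pos_one]; omega
    · rw [level, h.pos_two, Pi.add_apply]; omega
  · obtain ⟨l, rfl⟩ := Nat.exists_eq_add_of_le hm3
    have h4 := hk.1 l (by omega)
    rw [level_add, level_add]
    omega

/-- Low vertices of the trace other than the branching point are leaves. -/
theorem eq_of_adj (h : IsBranching a e s) {x y : Site d} (hx : x ≠ unitVec a)
    (hx0 : x 0 ≤ unitVec a 0) (hxy : (trace (pos s)).Adj x y) : y = unitVec a := by
  obtain ⟨-, n, hn⟩ := hxy
  have hhigh : ∀ m, 3 ≤ m → x ≠ pos s m := by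
    rintro m hm rfl
    obtain ⟨l, rfl⟩ := Nat.exists_eq_add_of_le hm
    rw [h.pos_add_three] at hx hx0
    rcases eq_or_ne l 0 with rfl | hl
    · exact hx (by rw [pos_zero, add_zero])
    · have := one_le_level_of_mem_escapeSet h.escape hl
      rw [level] at this
      rw [Pi.add_apply] at hx0
      omega
  rcases lt_or_ge n 3 with hn3 | hn3
  · interval_cases n
    · rw [h.pos_one] at hn
      rcases Sym2.eq_iff.1 hn with ⟨-, h2⟩ | ⟨-, h2⟩
      · exact h2.symm
      · exact absurd h2.symm hx
    · rw [h.pos_one] at hn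
      rcases Sym2.eq_iff.1 hn with ⟨h1, -⟩ | ⟨h1, -⟩
      · exact absurd h1.symm hx
      · exact h1.symm
    · rw [h.pos_three] at hn
      rcases Sym2.eq_iff.1 hn with ⟨-, h2⟩ | ⟨-, h2⟩
      · exact h2.symm
      · exact absurd h2.symm hx
  · rcases Sym2.eq_iff.1 hn with ⟨h1, -⟩ | ⟨-, h1⟩
    · exact absurd h1.symm (hhigh n hn3)
    · exact absurd h1.symm (hhigh (n + 1) (by omega))

/-- The probability that a walk on a subgraph of the trace of a branching path never visits the end
of the dangling edge. -/
theorem ofReal_le_mul_cutCond (h : IsBranching a e s) (ha : 0 ≤ unitVec a 0)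
    (he : unitVec e 0 ≤ 0) (hae : unitVec a + unitVec e ≠ 0) {q : Dir d → ℝ} (hq : ∀ e, 0 < q e)
    {Z : (latticeGraph d).Subgraph} (hZ : ∀ x y, Z.Adj x y → (trace (pos s)).Adj x y)
    (hZ0 : ∃ y, Z.Adj 0 y) (hZe : Z.Adj (unitVec a + unitVec e) (unitVec a)) {c : ℝ}
    (hc : ∀ t, c ≤ stayProb q Z t (fun _ => {unitVec a + unitVec e}ᶜ) 0) :
    ENNReal.ofReal c ≤
      ENNReal.ofReal (q (dirOne d) / q e) * cutCond (heightHom q) (shift 3 s) := by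
  classical
  set v := unitVec a with hv
  set w := v + unitVec e with hw
  rcases le_or_gt c 0 with hc0 | hc0
  · rw [ENNReal.ofReal_of_nonpos hc0]; exact zero_le
  set ρ := q (dirOne d) / q e with hρ
  have hρ0 : 0 < ρ := div_pos (hq _) (hq _)
  have hp2 : pos s 2 = w := h.pos_two
  have hwv : w ≠ v := by
    intro h; rw [hw, add_eq_left] at h; exact unitVec_ne_zero e h
  have hw0 : w 0 ≤ v 0 := by rw [hw, Pi.add_apply]; omega
  have key : ∀ N, ∑ k ∈ Finset.range N, (if IsCut (shift 3 s) k then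
      Real.exp (-height q (pos (shift 3 s) k)) else 0) ≤ ρ / c := by
    intro N
    rcases Nat.eq_zero_or_pos N with rfl | hN
    · simpa using (div_pos hρ0 hc0).le
    set K₀ := (Finset.range N).filter fun k => IsCut (shift 3 s) k with hK₀
    set K := K₀.image fun k => 3 + k with hK
    have hKne : K.Nonempty := Finset.Nonempty.image
      ⟨0, Finset.mem_filter.2 ⟨Finset.mem_range.2 hN, isCut_zero h.escape⟩⟩ _
    have hKcut : ∀ k ∈ K, IsCut s k := by
      intro k hk
      obtain ⟨l, hl, rfl⟩ := Finset.mem_image.1 hk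
      exact h.isCut ha he (Finset.mem_filter.1 hl).2
    have hK3 : ∀ k ∈ K, 3 ≤ k := by
      intro k hk
      obtain ⟨l, -, rfl⟩ := Finset.mem_image.1 hk
      omega
    obtain ⟨L, hL, hmain⟩ := conductance_mul_one_sub_hitLim_le_inv hq hZ K hKne hKcut 2
      (fun k hk => (Nat.le_succ 2).trans (hK3 k hk)) v (by rwa [hp2])
      (fun y hy => h.eq_of_adj (by rwa [hp2]) (by rwa [hp2]) (hZ _ _ hy))
    rw [hp2] at hmain
    set Λ : Finset (Site d) := (Finset.range (L + 1)).image (pos s) with hΛ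
    have h0Λ : (0 : Site d) ∈ (Λ : Set (Site d)) := by
      rw [← pos_zero s]
      exact Finset.mem_coe.2 (Finset.mem_image_of_mem _ (Finset.mem_range.2 (Nat.succ_pos L)))
    -- The origin is a leaf attached to v, so the first step leads to v.
    have hlim0 : hitLim q Z {w} Λ 0 = hitLim q Z {w} Λ v := by
      obtain ⟨y, hy⟩ := hZ0
      rw [hitLim_harmonic hq Z (fun h => hae (Set.mem_singleton_iff.1 h).symm) h0Λ]
      have h1 : ∀ e', stepProb q Z 0 e' * hitLim q Z {w} Λ (0 + unitVec e') =
          stepProb q Z 0 e' * hitLim q Z {w} Λ v := by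
        intro e'
        by_cases he' : Z.Adj 0 (0 + unitVec e')
        · rw [h.eq_of_adj (unitVec_ne_zero a).symm ha (hZ _ _ he')]
        · rw [stepProb_eq_zero he', zero_mul, zero_mul]
      simp only [h1]
      rw [← Finset.sum_mul, sum_stepProb_eq_one hq hy, one_mul]
    have hc1 : c ≤ 1 - hitLim q Z {w} Λ v := by
      rw [← hlim0]
      exact ge_of_tendsto' ((tendsto_hitProb hq Z {w} Λ 0).const_sub 1) fun t =>
        (hc t).trans ((stayProb_le_one_sub_hitProb hq Z {w} t 0).trans
          (sub_le_sub_left (hitProb_mono_set hq Z {w} (Set.subset_univ _) t 0) 1))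
    have hwcond : conductance q w v = Real.exp (height q v) * q e := by
      rw [conductance_comm, hw, conductance_add_unitVec q hq]
    -- Every cut edge is a step e_1. The factor exp(height v) is shared with the dangling edge and
    -- cancels, which leaves the ratio q(e_1)/q(e).
    have hsum : ∑ k ∈ K, (conductance q (pos s k) (pos s (k + 1)))⁻¹ =
        (Real.exp (height q v) * q (dirOne d))⁻¹ *
          ∑ k ∈ Finset.range N, (if IsCut (shift 3 s) k then
            Real.exp (-height q (pos (shift 3 s) k)) else 0) := by
      rw [hK, Finset.sum_image fun k _ l _ hkl => Nat.add_left_cancel hkl, ← Finset.sum_filter,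
        Finset.mul_sum]
      refine Finset.sum_congr rfl fun k hk => ?_
      have hstep : s (3 + k) = dirOne d := (Finset.mem_filter.1 hk).2.2.1
      rw [pos_succ, hstep, conductance_add_unitVec q hq, h.pos_add_three, height_add, Real.exp_add,
        Real.exp_neg]
      simp only [mul_inv]
      ring
    set T := ∑ k ∈ Finset.range N, (if IsCut (shift 3 s) k then
            Real.exp (-height q (pos (shift 3 s) k)) else 0) with hT
    have hT0 : 0 < T := by
      refine Finset.sum_pos' (fun k _ => ?_) ⟨0, Finset.mem_range.2 hN, ?_⟩
      · split_ifs; exacts [(Real.exp_pos _).le, le_rfl]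
      · rw [if_pos (isCut_zero h.escape)]; exact Real.exp_pos _
    rw [hwcond, hsum, mul_inv, inv_inv] at hmain
    have hE := Real.exp_pos (height q v)
    have hqe := hq e
    have h2 : q e * c ≤ q (dirOne d) * T⁻¹ := by
      have h3 : Real.exp (height q v) * q e * c ≤ Real.exp (height q v) * q (dirOne d) * T⁻¹ :=
        (mul_le_mul_of_nonneg_left hc1 (by positivity)).trans hmain
      rw [mul_assoc, mul_assoc] at h3
      exact le_of_mul_le_mul_left h3 hE
    rw [le_div_iff₀ hc0, hρ, le_div_iff₀ hqe]
    calc T * c * q e = T * (q e * c) := by ring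
      _ ≤ T * (q (dirOne d) * T⁻¹) := mul_le_mul_of_nonneg_left h2 hT0.le
      _ = q (dirOne d) := by field_simp
  have hsum : cutSum (heightHom q) (shift 3 s) ≤ ENNReal.ofReal (ρ / c) := by
    refine ENNReal.tsum_le_of_sum_range_le fun N => ?_
    refine le_trans (le_of_eq ?_) (ENNReal.ofReal_le_ofReal (key N))
    rw [ENNReal.ofReal_sum_of_nonneg fun k _ => by
      split_ifs; exacts [(Real.exp_pos _).le, le_rfl]]
    refine Finset.sum_congr rfl fun k _ => ?_
    split_ifs
    · rfl
    · simp
  rw [cutCond, if_pos h.escape]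
  calc ENNReal.ofReal c = ENNReal.ofReal ρ * (ENNReal.ofReal (ρ / c))⁻¹ := by
        rw [← ENNReal.ofReal_inv_of_pos (div_pos hρ0 hc0), ← ENNReal.ofReal_mul hρ0.le]
        congr 1
        field_simp
    _ ≤ _ := mul_le_mul_right (ENNReal.inv_le_inv.2 hsum) _

end IsBranching

end DanglingEdge

/-! ### Too rapidly summable avoidance probabilities: a branching point survives. -/

section Branching

/-- Union bound: the total mass lost from A 0 is at most the integral of Σ g over A 0, that is, half
the mass of A 0. -/
theorem measure_iInter_ne_zero {Ω : Type*} [MeasurableSpace Ω] {μ : Measure Ω} [IsFiniteMeasure μ]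
    {A : ℕ → Set Ω} (hA : Antitone A) {g : ℕ → Ω → ENNReal}
    (hg : ∀ k, Measurable (g k)) (hloss : ∀ k, μ (A k \ A (k + 1)) ≤ ∫⁻ ω in A k, g k ω ∂μ)
    (hsum : ∀ ω ∈ A 0, ∑' k, g k ω ≤ 2⁻¹) (h0 : μ (A 0) ≠ 0) : μ (⋂ k, A k) ≠ 0 := by
  intro h
  have h1 : A 0 ⊆ (⋂ k, A k) ∪ ⋃ k, A k \ A (k + 1) := by
    intro ω hω
    by_contra! hn
    simp only [Set.mem_union, Set.mem_iInter, Set.mem_iUnion, Set.mem_sdiff, not_or, not_forall,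
      not_exists, not_and, not_not] at hn
    obtain ⟨⟨k, hk⟩, hn⟩ := hn
    refine hk ?_
    clear hk
    induction k with
    | zero => exact hω
    | succ k ih => exact hn k ih
  have h2 : μ (A 0) ≤ 2⁻¹ * μ (A 0) := by
    calc μ (A 0) ≤ μ (⋂ k, A k) + μ (⋃ k, A k \ A (k + 1)) :=
          (measure_mono h1).trans (measure_union_le _ _)
      _ ≤ ∑' k, ∫⁻ ω in A k, g k ω ∂μ := by
          rw [h, zero_add]
          exact (measure_iUnion_le _).trans (ENNReal.tsum_le_tsum hloss)
      _ ≤ ∑' k, ∫⁻ ω in A 0, g k ω ∂μ := ENNReal.tsum_le_tsum fun k =>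
          lintegral_mono_set (hA (Nat.zero_le k))
      _ = ∫⁻ ω in A 0, ∑' k, g k ω ∂μ := (lintegral_tsum fun k => (hg k).aemeasurable).symm
      _ ≤ ∫⁻ _ in A 0, 2⁻¹ ∂μ := setLIntegral_mono measurable_const hsum
      _ = 2⁻¹ * μ (A 0) := setLIntegral_const _ _
  have h3 : 2⁻¹ * μ (A 0) < 1 * μ (A 0) :=
    ENNReal.mul_lt_mul_left h0 (measure_ne_top μ _) (ENNReal.inv_lt_one.2 ENNReal.one_lt_two)
  rw [one_mul] at h3
  exact h3.not_ge h2

variable {d : ℕ}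

/-- A vertex of an infinite simple path has at most two neighbours. -/
theorem IsSimplePath.eq_or_eq_or_eq {Z : (latticeGraph d).Subgraph} (hZ : IsSimplePath Z)
    {v x y z : Site d} (hx : Z.Adj v x) (hy : Z.Adj v y) (hz : Z.Adj v z) :
    x = y ∨ x = z ∨ y = z := by
  obtain ⟨-, γ, -, -, hγ, rfl⟩ := hZ
  obtain ⟨m, rfl⟩ := (trace γ).edge_vert hx
  have key : ∀ u, (trace γ).Adj (γ m) u → u = γ (m + 1) ∨ u = γ (m - 1) := by
    rintro u ⟨-, n, hn⟩
    rcases Sym2.eq_iff.1 hn with ⟨h, h'⟩ | ⟨h, h'⟩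
    · rw [hγ h] at h'; exact Or.inl h'.symm
    · rw [← hγ h', Nat.add_sub_cancel]; exact Or.inr h.symm
  rcases key x hx with rfl | rfl <;> rcases key y hy with rfl | rfl <;>
    rcases key z hz with rfl | rfl <;> simp

theorem exists_dir_ne (hd : 2 ≤ d) (x y : Dir d) : ∃ f : Dir d, f ≠ x ∧ f ≠ y := by
  have h : ({x, y} : Finset (Dir d)).card < Fintype.card (Dir d) := by
    have h1 := Finset.card_le_two (a := x) (b := y)
    have h2 : Fintype.card (Dir d) = d * 2 := by simp [Dir, Fintype.card_prod]
    omega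
  obtain ⟨f, hf⟩ := Finset.exists_mem_notMem_of_card_lt_card
    (s := ({x, y} : Finset (Dir d))) (t := Finset.univ) (by simpa using h)
  exact ⟨f, by simpa using hf.2⟩

variable [NeZero d]

namespace IsBranching

variable {a e : Dir d} {s : ℕ → Dir d}

theorem pos_mem_of_le (h : IsBranching a e s) {m : ℕ} (hm : (pos s m) 0 ≤ unitVec a 0) :
    pos s m ∈ ({0, unitVec a, unitVec a + unitVec e} : Set (Site d)) := by
  rcases lt_or_ge m 3 with hm3 | hm3
  · interval_cases m
    · simp [pos_zero]
    · simp [h.pos_one]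
    · simp [h.pos_two]
  · obtain ⟨l, rfl⟩ := Nat.exists_eq_add_of_le hm3
    rw [h.pos_add_three] at hm ⊢
    rcases eq_or_ne l 0 with rfl | hl
    · simp [pos_zero]
    · have := one_le_level_of_mem_escapeSet h.escape hl
      rw [level] at this
      rw [Pi.add_apply] at hm
      omega

/-- The only edge of the trace that leaves the half-space below the branching point. -/
theorem eq_of_adj_of_le_of_lt (h : IsBranching a e s) (ha : 0 ≤ unitVec a 0)
    (he : unitVec e 0 ≤ 0) {x y : Site d} (hxy : (trace (pos s)).Adj x y)
    (hx : x 0 ≤ unitVec a 0) (hy : unitVec a 0 < y 0) :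
    x = unitVec a ∧ y = unitVec a + unitVec (dirOne d) := by
  obtain ⟨-, n, hn⟩ := hxy
  have h0 : (pos s 0) 0 ≤ unitVec a 0 := by rw [pos_zero]; exact ha
  have h1 : (pos s 1) 0 ≤ unitVec a 0 := by rw [h.pos_one]
  have h2 : (pos s 2) 0 ≤ unitVec a 0 := by rw [h.pos_two, Pi.add_apply]; omega
  have h3 : (pos s 3) 0 ≤ unitVec a 0 := by rw [h.pos_three]
  have h4 : ∀ l, unitVec a 0 < (pos s (3 + (l + 1))) 0 := by
    intro l
    have := one_le_level_of_mem_escapeSet h.escape (n := l + 1) (Nat.succ_ne_zero l)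
    rw [level] at this
    rw [h.pos_add_three, Pi.add_apply]
    omega
  have hlow : n < 3 → (pos s n) 0 ≤ unitVec a 0 ∧ (pos s (n + 1)) 0 ≤ unitVec a 0 := by
    intro hn3
    interval_cases n
    exacts [⟨h0, h1⟩, ⟨h1, h2⟩, ⟨h2, h3⟩]
  rcases lt_or_ge n 3 with hn3 | hn3
  · have := hlow hn3
    rcases Sym2.eq_iff.1 hn with ⟨-, h'⟩ | ⟨h', -⟩ <;> rw [h'] at this <;> omega
  · obtain ⟨l, rfl⟩ := Nat.exists_eq_add_of_le hn3
    rcases l with _ | l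
    · have hs : s 3 = dirOne d := h.escape.1
      rcases Sym2.eq_iff.1 hn with ⟨h', h''⟩ | ⟨h', -⟩
      · rw [add_zero] at h' h''
        refine ⟨by rw [← h', h.pos_three], ?_⟩
        rw [← h'', pos_succ s 3, h.pos_three, hs]
      · rw [add_zero] at h'; rw [h'] at h3; omega
    · have h5 := h4 l
      have h6 := h4 (l + 1)
      rcases Sym2.eq_iff.1 hn with ⟨h', -⟩ | ⟨-, h'⟩
      · rw [h'] at h5; omega
      · rw [← add_assoc 3, h'] at h6; omega

end IsBranching

theorem measurableSet_isBranching (a e : Dir d) : MeasurableSet {s | IsBranching a e s} := by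
  have : {s : ℕ → Dir d | IsBranching a e s} = (fun s => s 0) ⁻¹' {a} ∩ ((fun s => s 1) ⁻¹' {e} ∩
      ((fun s => s 2) ⁻¹' {(e.1, -e.2)} ∩ shift 3 ⁻¹' escapeSet d)) := by
    ext s
    exact ⟨fun h => ⟨h.zero, h.one, h.two, h.escape⟩, fun h => ⟨h.1, h.2.1, h.2.2.1, h.2.2.2⟩⟩
  rw [this]
  exact (measurable_pi_apply 0 (MeasurableSet.of_discrete)).inter
    ((measurable_pi_apply 1 (MeasurableSet.of_discrete)).inter
      ((measurable_pi_apply 2 (MeasurableSet.of_discrete)).inter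
        (measurable_shift 3 measurableSet_escapeSet)))

theorem seqLaw_isBranching_ne_zero {q : Dir d → ℝ} (hq : ∀ e, 0 < q e) (hq1 : ∑ e, q e = 1)
    (hδ : 0 < drift q 0) (a e : Dir d) : seqLaw q {s | IsBranching a e s} ≠ 0 := by
  have h1 := seqLaw_prefix_shift hq hq1 3 (fun k => if k = 0 then a else if k = 1 then e else
    (e.1, -e.2)) measurableSet_escapeSet (seqLaw_escapeSet_ne_zero hq hq1 hδ)
  intro h
  refine h1 (measure_mono_null ?_ h)
  rintro s ⟨hs, hs'⟩
  exact ⟨by simpa using hs 0 (by omega), by simpa using hs 1 (by omega),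
    by simpa using hs 2 (by omega), hs'⟩

/-- The bound on the probability that a walk avoids the end of the dangling edge. -/
noncomputable def avoidBound (q : Dir d → ℝ) (e : Dir d) (s : ℕ → Dir d) : ENNReal :=
  ENNReal.ofReal (q (dirOne d) / q e) * cutCond (heightHom q) (shift 3 s)

theorem measurable_avoidBound (q : Dir d → ℝ) (e : Dir d) : Measurable (avoidBound q e) :=
  ((measurable_cutCond _).comp (measurable_shift 3)).const_mul _

/-- Links the cut-edge estimate to the assumed series with c = 1/δ_1. The entry 1 of the minimum is
`cutCond_le_one`; the other follows from `lintegral_cutCond_le`, x ≤ e^x - 1 and β^c ≥ 1. -/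
theorem lintegral_avoidBound_le {q₀ q : Dir d → ℝ} (hq₀ : ∀ e, 0 < q₀ e) (hq₀1 : ∑ e, q₀ e = 1)
    (hδ : 0 < drift q₀ 0) (hq : ∀ e, 0 < q e) (hℓ : 0 < inner ℝ (drift q₀) (ell q)) (e : Dir d) :
    ∫⁻ s, avoidBound q e s ∂seqLaw q₀ ≤
      ENNReal.ofReal (conductance q 0 (unitVec (dirOne d)) / conductance q 0 (unitVec e) *
        min 1 ((beta q ^ ((drift q₀ 0)⁻¹ * inner ℝ (drift q₀) (ell q)) - 1) *
          beta q ^ (drift q₀ 0)⁻¹)) := by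
  have hprob := isProbabilityMeasure_seqLaw hq₀ hq₀1
  have hc : ∀ e, conductance q 0 (unitVec e) = q e := by
    intro e
    have := conductance_add_unitVec q hq 0 e
    rwa [zero_add, height_zero, Real.exp_zero, one_mul] at this
  have hθ := stepMean_heightHom_pos hℓ
  have hJ : ∫⁻ s, cutCond (heightHom q) s ∂seqLaw q₀ ≤ ENNReal.ofReal
      (min 1 ((beta q ^ ((drift q₀ 0)⁻¹ * inner ℝ (drift q₀) (ell q)) - 1) *
          beta q ^ (drift q₀ 0)⁻¹)) := by
    rw [(ENNReal.ofReal_mono).map_min, ENNReal.ofReal_one]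
    refine le_min ?_ ((lintegral_cutCond_le hq₀ hq₀1 hδ hθ).trans (ENNReal.ofReal_le_ofReal ?_))
    · refine (lintegral_mono fun s => cutCond_le_one _ s).trans ?_
      simp
    · have h1 : beta q ^ ((drift q₀ 0)⁻¹ * inner ℝ (drift q₀) (ell q)) =
          Real.exp (stepMean q₀ (heightHom q) / drift q₀ 0) := by
        rw [beta, ← Real.exp_mul, stepMean_heightHom]
        congr 1
        ring
      have h2 : 1 ≤ beta q ^ (drift q₀ 0)⁻¹ :=
        Real.one_le_rpow (Real.one_le_exp (norm_nonneg _)) (inv_pos.2 hδ).le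
      have h3 := Real.add_one_le_exp (stepMean q₀ (heightHom q) / drift q₀ 0)
      have h4 : 0 < stepMean q₀ (heightHom q) / drift q₀ 0 := div_pos hθ hδ
      rw [h1]
      nlinarith
  have h1 := lintegral_shift hq₀ hq₀1 3 (measurable_cutCond (heightHom q))
  have h2 : Measurable fun s : ℕ → Dir d => cutCond (heightHom q) (shift 3 s) :=
    (measurable_cutCond _).comp (measurable_shift 3)
  simp only [avoidBound]
  rw [lintegral_const_mul _ h2, h1, hc, hc,
    ENNReal.ofReal_mul (div_pos (hq _) (hq _)).le]
  exact mul_le_mul_right hJ _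

/-- A finite mean makes the sum almost surely finite, so its tails tend to zero; as branching has
positive probability, one of the countably many N works. -/
theorem exists_branching_tail_le {q : Dir d → ℝ} (hq : ∀ e, 0 < q e) (hq1 : ∑ e, q e = 1)
    (hδ : 0 < drift q 0) (a e : Dir d) {g : ℕ → (ℕ → Dir d) → ENNReal} (hg : ∀ k, Measurable (g k))
    (hsum : ∑' k, ∫⁻ s, g k s ∂seqLaw q ≠ ⊤) :
    ∃ N, seqLaw q {s | IsBranching a e s ∧ ∑' k, g (k + N) s ≤ 2⁻¹} ≠ 0 := by
  by_contra! h
  have h1 : ∀ᵐ s ∂seqLaw q, ∑' k, g k s < ⊤ := by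
    refine ae_lt_top (Measurable.tsum hg) ?_
    rwa [lintegral_tsum fun k => (hg k).aemeasurable]
  have h2 : ∀ᵐ s ∂seqLaw q, ∀ N, ¬ (IsBranching a e s ∧ ∑' k, g (k + N) s ≤ 2⁻¹) :=
    ae_all_iff.2 fun N => by
      rw [ae_iff]
      simpa only [not_not] using h N
  refine seqLaw_isBranching_ne_zero hq hq1 hδ a e ?_
  have h3 : ∀ᵐ s ∂seqLaw q, ¬ IsBranching a e s := by
    filter_upwards [h1, h2] with s h1 h2 hs
    have h4 := (ENNReal.tendsto_sum_nat_add (fun k => g k s) h1.ne).eventually_le_const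
      (u := (2⁻¹ : ENNReal)) (by simp)
    obtain ⟨N, hN⟩ := h4.exists
    exact h2 N ⟨hs, hN⟩
  rw [ae_iff] at h3
  simpa only [not_not] using h3

variable {Ω : Type*} {X : ℕ → ℕ → Ω → Site d}

/-! ### Consequences of branching for a fixed outcome. -/

section Pathwise

variable {ω : Ω} {a e : Dir d}

theorem graph_adj_of_pos {i : ℕ} (hi : 1 ≤ i) (h0 : ∀ i, X i 0 ω = 0)
    (hw : ∀ i n, (graph X i ω).Adj (X i n ω) (X i (n + 1) ω)) {x y : Site d}
    (hxy : (graph X i ω).Adj x y) : (trace (pos (firstSteps X ω))).Adj x y := by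
  have h1 : pos (firstSteps X ω) = fun n => X 0 n ω := by
    ext n : 1
    exact pos_firstSteps (h0 0) (fun n => (graph X 0 ω).adj_sub (hw 0 n)) n
  rw [h1]
  exact (graph_antitone hw hi).2 hxy

/-- No Z^(i) has isolated vertices, and in the trace of the first walk the origin is a leaf attached
to `unitVec a`. -/
theorem IsBranching.graph_adj_zero (h : IsBranching a e (firstSteps X ω)) (ha : 0 ≤ unitVec a 0)
    (h0 : ∀ i, X i 0 ω = 0)
    (hw : ∀ i n, (graph X i ω).Adj (X i n ω) (X i (n + 1) ω)) (i : ℕ) :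
    (graph X i ω).Adj 0 (unitVec a) := by
  have key : ∀ i, 1 ≤ i → (graph X i ω).Adj 0 (unitVec a) := by
    intro i hi
    obtain ⟨y, hy⟩ := exists_adj_of_mem_verts (NeZero.pos d) hw i 0
      (by rw [← h0 i]; exact (graph X i ω).edge_vert (hw i 0))
    rwa [h.eq_of_adj (unitVec_ne_zero a).symm ha (graph_adj_of_pos hi h0 hw hy)] at hy
  exact (graph_antitone hw (Nat.le_succ i)).2 (key (i + 1) (Nat.succ_pos i))

theorem IsBranching.graph_adj_end (h : IsBranching a e (firstSteps X ω))
    (he : unitVec e 0 ≤ 0) (h0 : ∀ i, X i 0 ω = 0)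
    (hw : ∀ i n, (graph X i ω).Adj (X i n ω) (X i (n + 1) ω)) {i : ℕ} (hi : 1 ≤ i)
    (hv : ∀ j, 1 ≤ j → j < i → ∃ m, X j m ω = unitVec a + unitVec e) :
    (graph X i ω).Adj (unitVec a + unitVec e) (unitVec a) := by
  obtain ⟨i, rfl⟩ := Nat.exists_eq_add_of_le' hi
  have hvert : unitVec a + unitVec e ∈ (graph X (i + 1) ω).verts := by
    rcases i with _ | i
    · exact ⟨2, (pos_firstSteps (h0 0) (fun n => (graph X 0 ω).adj_sub (hw 0 n)) 2).symm.trans h.pos_two⟩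
    · exact hv (i + 1) (Nat.succ_pos i) (Nat.lt_succ_self _)
  obtain ⟨y, hy⟩ := exists_adj_of_mem_verts (NeZero.pos d) hw (i + 1) _ hvert
  rwa [h.eq_of_adj (fun h => unitVec_ne_zero e (by simpa using h))
    (by rw [Pi.add_apply]; omega) (graph_adj_of_pos hi h0 hw hy)] at hy

/-- Only three vertices of the trace are as low as the branching point, so a walk of infinite range
must leave them, which is possible only through this edge. -/
theorem IsBranching.graph_adj_dirOne (h : IsBranching a e (firstSteps X ω))
    (ha : 0 ≤ unitVec a 0) (he : unitVec e 0 ≤ 0) (h0 : ∀ i, X i 0 ω = 0)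
    (hw : ∀ i n, (graph X i ω).Adj (X i n ω) (X i (n + 1) ω))
    (hinf : ∀ i, (Set.range fun n => X i n ω).Infinite) (i : ℕ) :
    (graph X i ω).Adj (unitVec a) (unitVec a + unitVec (dirOne d)) := by
  have key : ∀ i, 1 ≤ i →
      (graph X i ω).Adj (unitVec a) (unitVec a + unitVec (dirOne d)) := by
    intro i hi
    have hadj := fun n => graph_adj_of_pos hi h0 hw (hw i n)
    have hhigh : ∃ n, unitVec a 0 < X i n ω 0 := by
      by_contra! hlow
      refine hinf i (Set.Finite.subset (Set.toFinite {0, unitVec a, unitVec a + unitVec e}) ?_)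
      rintro _ ⟨n, rfl⟩
      obtain ⟨m, hm⟩ := (trace (pos (firstSteps X ω))).edge_vert (hadj n)
      have := hlow n
      simp only
      rw [← hm] at this ⊢
      exact h.pos_mem_of_le this
    classical
    have h1 := Nat.find_spec hhigh
    have h2 := fun m hm => Nat.find_min hhigh (m := m) hm
    rcases hn : Nat.find hhigh with _ | n
    · rw [hn, h0] at h1
      exact absurd h1 (not_lt.2 ha)
    · rw [hn] at h1 h2
      have h3 := h.eq_of_adj_of_le_of_lt ha he (hadj n) (not_lt.1 (h2 n (Nat.lt_succ_self n))) h1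
      have h4 := hw i n
      rwa [h3.1, h3.2] at h4
  exact (graph_antitone hw (Nat.le_succ i)).2 (key (i + 1) (Nat.succ_pos i))

/-- If all walks visit the end of the dangling edge, then the branching point has three neighbours in
the limiting graph. -/
theorem IsBranching.not_isSimplePath (h : IsBranching a e (firstSteps X ω))
    (ha : 0 ≤ unitVec a 0) (he : unitVec e 0 ≤ 0) (hae : unitVec a + unitVec e ≠ 0)
    (h0 : ∀ i, X i 0 ω = 0) (hw : ∀ i n, (graph X i ω).Adj (X i n ω) (X i (n + 1) ω))
    (hinf : ∀ i, (Set.range fun n => X i n ω).Infinite)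
    (hv : ∀ j, 1 ≤ j → ∃ m, X j m ω = unitVec a + unitVec e) :
    ¬ IsSimplePath (limitGraph X ω) := by
  intro hZ
  have hlim : ∀ x y, (∀ i, (graph X i ω).Adj x y) → (limitGraph X ω).Adj x y := fun x y h =>
    SimpleGraph.Subgraph.iInf_adj_of_nonempty.2 h
  have h1 := (hlim _ _ (h.graph_adj_zero ha h0 hw)).symm
  have h2 := hlim _ _ (h.graph_adj_dirOne ha he h0 hw hinf)
  have h3 := (hlim (unitVec a + unitVec e) (unitVec a) fun i =>
    (graph_antitone hw (Nat.le_succ i)).2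
      (h.graph_adj_end he h0 hw (Nat.succ_pos i) fun j hj _ => hv j hj)).symm
  have hone : (unitVec (dirOne d) : Site d) 0 = 1 := by simp [unitVec, dirOne]
  rcases hZ.eq_or_eq_or_eq h1 h2 h3 with h4 | h4 | h4
  · have := congrFun h4 0
    rw [Pi.zero_apply, Pi.add_apply, hone] at this
    omega
  · exact hae h4.symm
  · have := congrFun (add_left_cancel h4) 0
    rw [hone] at this
    omega

end Pathwise

variable [mΩ : MeasurableSpace Ω] {μ : Measure Ω} [IsProbabilityMeasure μ] {p : ℕ → Dir d → ℝ}

/-- Serves the finitely many early walks, for which the avoidance bound need not be small: an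
available path of n steps is followed with conditional probability at least ε^n. -/
theorem measure_inter_visit_ne_zero (hpos : ∀ i e, 0 < p i e) (hp1 : ∀ i, ∑ e, p i e = 1)
    (hX : IsWalkSequence μ p X) (i n : ℕ) (γ : ℕ → Site d) (hγ0 : γ 0 = 0) {A : Set Ω}
    (hAm : MeasurableSet[history X i 0] A)
    (hA : ∀ᵐ ω ∂μ, ω ∈ A → ∀ k < n, (graph X i ω).Adj (γ k) (γ (k + 1))) (hA0 : μ A ≠ 0) :
    μ (A ∩ {ω | X i n ω = γ n}) ≠ 0 := by
  have hle := history_le hX i 0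
  obtain ⟨ε, hε, hεp⟩ := exists_pos_le (hpos i)
  set S : ℕ → Set (Site d) := fun k => if k ≤ n then {γ k} else ∅ᶜ with hS
  set E := {ω | ∀ k ≤ n + 0, X i (0 + k) ω ∈ S k} with hE
  have hEm : MeasurableSet E := measurableSet_stay hX i 0 (n + 0) S
  have h1 : ∀ᵐ ω ∂μ, ω ∈ A → ε ^ n ≤ (μ[E.indicator (fun _ => (1 : ℝ)) | history X i 0]) ω := by
    filter_upwards [condExp_stay hpos hX (NeZero.pos d) i 0 (n + 0) S, hA, hX.start i]
      with ω h2 h3 h4 hω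
    rw [h2, h4, ← hγ0]
    refine le_trans (le_of_eq ?_)
      (pow_mul_le_stayProb (hpos i) (hp1 i) hε.le hεp (graph X i ω) ∅ n 0 γ (h3 hω) (by simp))
    simp [stayProb]
  intro h
  have h2 : ∫ ω in A, (μ[E.indicator (fun _ => (1 : ℝ)) | history X i 0]) ω ∂μ = 0 := by
    rw [setIntegral_condExp hle ((integrable_const 1).indicator hEm) hAm,
      setIntegral_indicator hEm]
    have : μ (A ∩ E) = 0 := by
      refine measure_mono_null (Set.inter_subset_inter_right _ fun ω hω => ?_) h
      have := hω n le_rfl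
      simpa [hS] using this
    rw [setIntegral_measure_zero _ this]
  have h3 : ∫ _ in A, ε ^ n ∂μ ≤
      ∫ ω in A, (μ[E.indicator (fun _ => (1 : ℝ)) | history X i 0]) ω ∂μ :=
    setIntegral_mono_on_ae integrableOn_const integrable_condExp.integrableOn (hle A hAm) h1
  rw [h2, setIntegral_const, smul_eq_mul] at h3
  have h4 : 0 < μ.real A := ENNReal.toReal_pos hA0 (measure_ne_top μ A)
  exact h3.not_gt (mul_pos h4 (pow_pos hε n))

/-- The conditional probability of avoiding w lies below every `stayProb`, so it may itself be taken
as c in the hypothesis. -/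
theorem measure_inter_avoid_le (hpos : ∀ i e, 0 < p i e)
    (hX : IsWalkSequence μ p X) (i : ℕ) (w : Site d) {A : Set Ω}
    (hAm : MeasurableSet[history X i 0] A) {g : Ω → ENNReal}
    (hA : ∀ᵐ ω ∂μ, ω ∈ A → ∀ c : ℝ, (∀ t, c ≤ stayProb (p i) (graph X i ω) t (fun _ => {w}ᶜ) 0) →
      ENNReal.ofReal c ≤ g ω) :
    μ (A ∩ {ω | ∀ m, X i m ω ≠ w}) ≤ ∫⁻ ω in A, g ω ∂μ := by
  have hle := history_le hX i 0
  set E := {ω | ∀ m, X i m ω ≠ w} with hE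
  have hEm : MeasurableSet E := by
    have : E = ⋂ m, (X i m ⁻¹' {w})ᶜ := by ext ω; simp [hE]
    rw [this]
    exact MeasurableSet.iInter fun m => (hX.measurable i m (measurableSet_singleton w)).compl
  have hint : ∀ {F : Set Ω}, MeasurableSet F → Integrable (F.indicator fun _ => (1 : ℝ)) μ :=
    fun hF => (integrable_const 1).indicator hF
  have h1 : ∀ᵐ ω ∂μ, ∀ t, (μ[E.indicator (fun _ => (1 : ℝ)) | history X i 0]) ω ≤
      stayProb (p i) (graph X i ω) t (fun _ => {w}ᶜ) 0 := by
    refine ae_all_iff.2 fun t => ?_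
    have hsub : E ⊆ {ω | ∀ k ≤ t, X i (0 + k) ω ∈ ({w}ᶜ : Set (Site d))} :=
      fun ω hω k _ => hω (0 + k)
    have h2 := condExp_mono (m := history X i 0) (hint hEm)
      (hint (measurableSet_stay hX i 0 t fun _ => {w}ᶜ)) (Filter.Eventually.of_forall fun ω =>
        Set.indicator_le_indicator_of_subset hsub (fun _ => zero_le_one) ω)
    filter_upwards [h2, condExp_stay hpos hX (NeZero.pos d) i 0 t fun _ => {w}ᶜ, hX.start i]
      with ω h2 h3 h4
    rw [h3, h4] at h2
    exact h2
  have h2 : ∀ᵐ ω ∂μ, ω ∈ A →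
      ENNReal.ofReal ((μ[E.indicator (fun _ => (1 : ℝ)) | history X i 0]) ω) ≤ g ω := by
    filter_upwards [h1, hA] with ω h1 h2 hω using h2 hω _ h1
  have h3 : 0 ≤ᵐ[μ] μ[E.indicator (fun _ => (1 : ℝ)) | history X i 0] :=
    condExp_nonneg (Filter.Eventually.of_forall fun ω => Set.indicator_nonneg (fun _ _ => zero_le_one) ω)
  have h4 : μ (A ∩ E) = ENNReal.ofReal
      (∫ ω in A, (μ[E.indicator (fun _ => (1 : ℝ)) | history X i 0]) ω ∂μ) := by
    rw [setIntegral_condExp hle (hint hEm) hAm, setIntegral_indicator hEm, setIntegral_const,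
      smul_eq_mul, mul_one, measureReal_def, ENNReal.ofReal_toReal (measure_ne_top μ _)]
  rw [h4, ofReal_integral_eq_lintegral_ofReal integrable_condExp.integrableOn
    (ae_restrict_of_ae h3)]
  exact setLIntegral_mono_ae' (hle A hAm) h2

theorem unitVec_apply_zero_nonpos {e : Dir d} (he : e ≠ dirOne d) : unitVec e 0 ≤ 0 := by
  obtain ⟨j, σ⟩ := e
  by_cases hj : j = 0
  · subst hj
    rcases Int.units_eq_one_or σ with rfl | rfl
    · exact absurd rfl he
    · simp [unitVec]
  · simp [unitVec, Ne.symm hj]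

theorem measure_not_isSimplePath_pos (hd : 2 ≤ d) (hpos : ∀ i e, 0 < p i e)
    (hp1 : ∀ i, ∑ e, p i e = 1) (hX : IsWalkSequence μ p X) (hδ : 0 < drift (p 0) 0)
    (hℓ : ∀ i, 1 ≤ i → 0 < inner ℝ (drift (p 0)) (ell (p i))) {e : Dir d} (he : e ≠ dirOne d)
    (hsum : Summable fun k : ℕ =>
      conductance (p (k + 1)) 0 (unitVec (dirOne d)) / conductance (p (k + 1)) 0 (unitVec e) *
        min 1 ((beta (p (k + 1)) ^
          ((drift (p 0) 0)⁻¹ * inner ℝ (drift (p 0)) (ell (p (k + 1)))) - 1) *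
            beta (p (k + 1)) ^ (drift (p 0) 0)⁻¹)) :
    0 < μ {ω | ¬ IsSimplePath (limitGraph X ω)} := by
  obtain ⟨f, hfe, hf1⟩ := exists_dir_ne hd e (dirOne d)
  -- As f differs from e and e_1, its opposite a satisfies a + e ≠ 0 and does not lower the first
  -- coordinate.
  set a : Dir d := (f.1, -f.2) with ha_def
  have hva : unitVec a = -unitVec f := unitVec_neg f.1 f.2
  have ha : 0 ≤ unitVec a 0 := by
    have := unitVec_apply_zero_nonpos hf1
    rw [hva, Pi.neg_apply]; omega
  have he0 := unitVec_apply_zero_nonpos he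
  have hae : unitVec a + unitVec e ≠ 0 := by
    intro h
    rw [hva, neg_add_eq_zero] at h
    exact hfe (unitVec_injective h)
  set w := unitVec a + unitVec e with hw_def
  obtain ⟨N, hN⟩ := exists_branching_tail_le (hpos 0) (hp1 0) hδ a e
    (g := fun k => avoidBound (p (k + 1)) e) (fun k => measurable_avoidBound _ e)
    (ne_top_of_le_ne_top hsum.tsum_ofReal_ne_top (ENNReal.tsum_le_tsum fun k =>
      lintegral_avoidBound_le (hpos 0) (hp1 0) hδ (hpos _) (hℓ _ (Nat.succ_pos k)) e))
  set G : Set (ℕ → Dir d) :=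
    {s | IsBranching a e s ∧ ∑' k, avoidBound (p (k + N + 1)) e s ≤ 2⁻¹} with hG
  have hGm : MeasurableSet G := (measurableSet_isBranching a e).inter
    (measurableSet_le (Measurable.tsum fun k => measurable_avoidBound _ e) measurable_const)
  -- The first walk branches with a small tail of avoidance bounds, and the walks 1, …, n - 1 all
  -- visit w; this is known before walk n starts.
  set A : ℕ → Set Ω := fun n =>
    firstSteps X ⁻¹' G ∩ {ω | ∀ j, 1 ≤ j → j < n → ∃ m, X j m ω = w} with hA
  have hAanti : Antitone A := fun n m hnm => Set.inter_subset_inter_right _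
    fun ω hω j hj hjn => hω j hj (hjn.trans_le hnm)
  have hAm : ∀ n, 1 ≤ n → MeasurableSet[history X n 0] (A n) := by
    intro n hn
    refine @MeasurableSet.inter Ω (history X n 0) _ _ (measurable_firstSteps hn hGm) ?_
    have : {ω | ∀ j, 1 ≤ j → j < n → ∃ m, X j m ω = w} =
        ⋂ j, ⋂ (_ : 1 ≤ j), ⋂ (_ : j < n), ⋃ m, X j m ⁻¹' {w} := by
      ext ω; simp
    rw [this]
    exact @MeasurableSet.iInter Ω ℕ (history X n 0) _ _ fun j =>
      @MeasurableSet.iInter Ω _ (history X n 0) _ _ fun _ =>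
      @MeasurableSet.iInter Ω _ (history X n 0) _ _ fun hjn =>
      @MeasurableSet.iUnion Ω ℕ (history X n 0) _ _ fun m =>
        measurable_history_of_lt (X := X) hjn 0 m (measurableSet_singleton w)
  have hreg := ae_regular hpos hp1 hX (NeZero.pos d)
  have hAsucc : ∀ n, A n ∩ {ω | ∃ m, X n m ω = w} ⊆ A (n + 1) := by
    rintro n ω ⟨⟨h1, h2⟩, h3⟩
    refine ⟨h1, fun j hj hjn => ?_⟩
    rcases (Nat.lt_succ_iff_lt_or_eq.1 hjn) with hjn | rfl
    exacts [h2 j hj hjn, h3]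
  have hA0 : ∀ n, μ (A (n + 1)) ≠ 0 := by
    intro n
    induction n with
    | zero =>
      have hm : Measurable (firstSteps X) :=
        (measurable_firstSteps (X := X) Nat.zero_lt_one).mono (history_le hX 1 0) le_rfl
      rw [← map_firstSteps hpos hp1 hX, Measure.map_apply hm hGm] at hN
      refine fun h => hN (measure_mono_null ?_ h)
      exact fun ω hω => ⟨hω, fun j hj hj' => by omega⟩
    | succ n ih =>
      have h1 := measure_inter_visit_ne_zero hpos hp1 hX (n + 1) 2
        (fun k => if k = 0 then 0 else if k = 1 then unitVec a else w) (by simp)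
        (hAm (n + 1) (Nat.succ_pos n)) ?_ ih
      · refine fun h => h1 (measure_mono_null (fun ω hω => hAsucc (n + 1) ⟨hω.1, 2, ?_⟩) h)
        simpa using hω.2
      · filter_upwards [hreg] with ω hω hωA k hk
        obtain ⟨h0, hwalk, -⟩ := hω
        interval_cases k
        · simpa using hωA.1.1.graph_adj_zero ha h0 hwalk (n + 1)
        · simpa using (hωA.1.1.graph_adj_end he0 h0 hwalk (Nat.succ_pos n) hωA.2).symm
  have hloss : ∀ n, μ (A (n + 1) \ A (n + 2)) ≤
      ∫⁻ ω in A (n + 1), avoidBound (p (n + 1)) e (firstSteps X ω) ∂μ := by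
    intro n
    refine le_trans (measure_mono ?_) (measure_inter_avoid_le hpos hX (n + 1) w
      (hAm (n + 1) (Nat.succ_pos n)) ?_)
    · rintro ω ⟨h1, h2⟩
      exact ⟨h1, fun m hm => h2 (hAsucc (n + 1) ⟨h1, m, hm⟩)⟩
    · filter_upwards [hreg] with ω hω hωA c hc
      obtain ⟨h0, hwalk, -⟩ := hω
      exact hωA.1.1.ofReal_le_mul_cutCond ha he0 hae (hpos (n + 1))
        (fun x y hxy => graph_adj_of_pos (Nat.succ_pos n) h0 hwalk hxy)
        ⟨_, hωA.1.1.graph_adj_zero ha h0 hwalk (n + 1)⟩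
        (hωA.1.1.graph_adj_end he0 h0 hwalk (Nat.succ_pos n) hωA.2) hc
  have hfm : Measurable (firstSteps X) :=
    (measurable_firstSteps (X := X) Nat.zero_lt_one).mono (history_le hX 1 0) le_rfl
  -- The union bound starts at walk N + 1, from which the avoidance bounds add up to at most 1/2.
  have hmain := measure_iInter_ne_zero (μ := μ) (A := fun k => A (k + N + 1))
    (fun k l hkl => hAanti (by omega))
    (g := fun k ω => avoidBound (p (k + N + 1)) e (firstSteps X ω))
    (fun k => (measurable_avoidBound _ e).comp hfm)
    (fun k => by
      have := hloss (k + N)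
      rwa [show k + N + 2 = k + 1 + N + 1 by omega] at this)
    (fun ω hω => hω.1.2) (hA0 _)
  refine (pos_iff_ne_zero.2 hmain).trans_le (measure_mono_ae ?_)
  filter_upwards [hreg] with ω hω hωA
  obtain ⟨h0, hwalk, hinf⟩ := hω
  have hωA := Set.mem_iInter.1 hωA
  exact (hωA 0).1.1.not_isSimplePath ha he0 hae h0 hwalk hinf fun j hj =>
    (hωA j).2 j hj (by omega)

end Branching

end IteratedTrace

theorem mainTheorem3 {d : ℕ} [NeZero d] (hd : 2 ≤ d)
    {Ω : Type*} [MeasurableSpace Ω] (μ : Measure Ω) [IsProbabilityMeasure μ]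
    (p : ℕ → IteratedTrace.Dir d → ℝ)
    (hp : ∀ i, p i ∈ stdSimplex ℝ (IteratedTrace.Dir d))
    (hadm : IteratedTrace.Admissible p)
    (X : ℕ → ℕ → Ω → IteratedTrace.Site d)
    (hX : IteratedTrace.IsWalkSequence μ p X) :
    ((∃ i, {i' : ℕ | p i' = p i}.Infinite) →
      ∀ᵐ ω ∂μ, IteratedTrace.IsSimplePathFrom (IteratedTrace.limitGraph X ω) 0) ∧
    ((∃ e : IteratedTrace.Dir d, e ≠ IteratedTrace.dirOne d ∧ ∀ c : ℝ, 0 < c →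
        Summable fun k : ℕ =>
          IteratedTrace.conductance (p (k + 1)) 0
              (IteratedTrace.unitVec (IteratedTrace.dirOne d)) /
            IteratedTrace.conductance (p (k + 1)) 0 (IteratedTrace.unitVec e) *
          min 1
            ((IteratedTrace.beta (p (k + 1)) ^
                  (c * inner ℝ (IteratedTrace.drift (p 0)) (IteratedTrace.ell (p (k + 1)))) - 1) *
              IteratedTrace.beta (p (k + 1)) ^ c)) →
      0 < μ {ω | ¬ IteratedTrace.IsSimplePath (IteratedTrace.limitGraph X ω)}) := by
  have hp1 : ∀ i, ∑ e, p i e = 1 := fun i => (hp i).2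
  refine ⟨fun ⟨i, hi⟩ => ?_, fun ⟨e, he, hsum⟩ => ?_⟩
  -- The positivity of δ^(0)·ℓ^(i) is assumed only for i ≥ 1, so a positive index with the same law
  -- is taken.
  · obtain ⟨j, hj, hj0⟩ := hi.exists_gt 0
    have hj : p j = p i := hj
    exact IteratedTrace.ae_isSimplePathFrom_limitGraph hadm.pos hp1 hX (p i) hi
      (hj ▸ hadm.transient j hj0)
  · exact IteratedTrace.measure_not_isSimplePath_pos hd hadm.pos hp1 hX hadm.drift_pos
      hadm.transient he (hsum _ (inv_pos.2 hadm.drift_pos))
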